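/- **Setting.** Let $S^{n-1}$ be the unit sphere of $\mathbb R^n$, and let $M(n,\theta)$ be the largest size of a $\theta$-spherical code, i.e. of a finite set $A\subset S^{n-1}$ whose distinct points are pairwise at angular distance at least $\theta$. For $\alpha>-1$ let $d\mu_\alpha=(1-t^2)^\alpha dt\big/\int_{-1}^1(1-t^2)^\alpha dt$ on $[-1,1]$, and let $(p_i)_{i\ge 0}$ be its orthonormal polynomials, with $\deg p_i=i$ and $p_i(1)>0$. For $s\in[-1,1]$ let $D(d\mu_\alpha,s)$ be the set of functions $f=\sum_{i\ge0}f_ip_i$ on $[-1,1]$ with $f_i\ge0$, $f_0>0$ (the series converging at each point of $[-1,1]$) and $f\le 0$ on $[-1,s]$; for such $f$ put $\mathcal L(f)=f(1)/f_0$, where $f_0=\int f\,d\mu_\alpha$. Let $n\ge 3$, $0<\theta<\theta'<\pi$, and let $g=g_{\theta'}\in D(d\mu_{\frac{n-4}2},\cos\theta')$. Call $F:[-1,1]\to\mathbb R$ *admissible* if $F\ge0$, $F$ is square integrable for $d\mu_{\frac{n-3}2}$, and $F_0:=\int F\,d\mu_{\frac{n-3}2}>0$; put $\|F\|_2^2=\int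 F^2\,d\mu_{\frac{n-3}2}$. For $x,y,z\in S^{n-1}$ let $\tilde x,\tilde y$ be the normalized orthogonal projections of $x,y$ to $z^\perp$, put $h(x,y;z)=F(\langle x,z\rangle)F(\langle y,z\rangle)\,g(\langle\tilde x,\tilde y\rangle)$ and $$h(x,y)=\int_{O(n)}h(x,y;kz)\,dk,$$ with $dk$ the normalized Haar measure. **Proposition 4.4, general part.** The average $h(x,y)$ does not depend on $z$ and depends on $x,y$ only through $t=\langle x,y\rangle$, so it defines a function $h=h_F$ on $[-1,1]$. If $F$ is admissible and $h_F(t)\le0$ for all $-1\le t\le\cos\theta$, then $h_F\in D(d\mu_{\frac{n-3}2},\cos\theta)$ and $$M(n,\theta)\le\mathcal L(h_F)=\mathcal L(g_{\theta'})\,\frac{\|F\|_2^2}{F_0^2}.$$ **Weights supported in the strip.** Assume moreover $\theta'<\pi/2$. Put $s=\cos\theta$, $s'=\cos\theta'$, $r=\sqrt{\frac{s-s'}{1-s'}}$, $\gamma=2\arctan\frac{s}{\sqrt{(1-s)(s-s')}}+\arccos r-\pi$, $R=\cos\gamma$, and let $\chi$ be the indicator function of $(r,R]$. Then $r<R\le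 1$, the weight $\chi$ is admissible, every admissible $F$ vanishing on $[-1,1]\setminus[r,R]$ satisfies $h_F\in D(d\mu_{\frac{n-3}2},\cos\theta)$, and among these $F$ the weight $\chi$ minimizes $\mathcal L(h_F)$. Let $\mu_n(\theta,\theta')$ be the normalized surface measure of a cap on $S^{n-1}$, contained in a hemisphere, whose boundary has Euclidean radius $\frac{\sin(\theta/2)}{\sin(\theta'/2)}$, and let $c=\frac12\log\frac{1-r^2}{1-R^2}$ (with $c=\infty$ and $e^{-nc}=0$ if $R=1$). Then $c>0$ and $$M(n,\theta)\le\mathcal L(h_\chi)\le\frac{\mathcal L(g_{\theta'})}{\mu_n(\theta,\theta')}\bigl(1+O(ne^{-nc})\bigr),$$ where the implied constant depends only on $\theta$ and $\theta'$ (not on $n\ge 3$ or $g_{\theta'}$). -/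

import Mathlib

open MeasureTheory Real Set
open scoped ENNReal RealInnerProductSpace

noncomputable section

namespace SphCode

/-- The ambient Euclidean space `ℝⁿ`. -/
abbrev E (n : ℕ) := EuclideanSpace ℝ (Fin n)

/-! ### Spherical codes -/

/-- `A` is a `θ`-spherical code in `S^{n-1}`: a finite set of unit vectors, any two distinct ones
at angular distance at least `θ`. -/
def IsSphericalCode {n : ℕ} (θ : ℝ) (A : Finset (E n)) : Prop :=
  (∀ x ∈ A, ‖x‖ = 1) ∧
    ∀ x ∈ A, ∀ y ∈ A, x ≠ y → θ ≤ InnerProductGeometry.angle x y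

/-- `M(n, θ)`, the largest cardinality of a `θ`-spherical code in `S^{n-1}`
(as an extended natural number, so that the supremum carries no default value). -/
def maxCode (n : ℕ) (θ : ℝ) : ℕ∞ :=
  ⨆ (A : Finset (E n)) (_ : IsSphericalCode θ A), (A.card : ℕ∞)

/-! ### The linear programming cone and functional -/

/-- The probability measure `dμ_α = (1 - t²)^α dt / ∫_{-1}^{1} (1 - t²)^α dt` on `[-1, 1]`. -/
def gegenbauerMeasure (α : ℝ) : Measure ℝ :=
  (volume.restrict (Icc (-1 : ℝ) 1)).withDensity
    (fun t => ENNReal.ofReal ((1 - t ^ 2) ^ α / ∫ u in (-1 : ℝ)..1, (1 - u ^ 2) ^ α))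

/-- `p` is the orthonormal polynomial basis of `μ`: `p i` has degree `i` and `p i (1) > 0`.
These conditions determine `p`. -/
def IsOrthonormalBasis (μ : Measure ℝ) (p : ℕ → Polynomial ℝ) : Prop :=
  (∀ i, (p i).natDegree = i) ∧ (∀ i, 0 < (p i).eval 1) ∧
    ∀ i j, ∫ t, (p i).eval t * (p j).eval t ∂μ = if i = j then 1 else 0

/-- The class `D(μ, s)`: functions `f = ∑ fᵢ pᵢ` on `[-1, 1]` with `fᵢ ≥ 0`, `f₀ > 0`, and
`f ≤ 0` on `[-1, s]`. Values outside `[-1, 1]` are irrelevant. -/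
def D (μ : Measure ℝ) (s : ℝ) : Set (ℝ → ℝ) :=
  {f | ∃ p : ℕ → Polynomial ℝ, IsOrthonormalBasis μ p ∧ ∃ c : ℕ → ℝ,
    (∀ i, 0 ≤ c i) ∧ 0 < c 0 ∧
    (∀ t ∈ Icc (-1 : ℝ) 1, HasSum (fun i => c i * (p i).eval t) (f t)) ∧
    ∀ t ∈ Icc (-1 : ℝ) s, f t ≤ 0}

/-- `L(f) = f(1) / f₀`, where `f₀ = ∫ f dμ` is the zeroth coefficient (recall `p₀ = 1`). -/
def L (μ : Measure ℝ) (f : ℝ → ℝ) : ℝ := f 1 / ∫ t, f t ∂μ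

/-! ### The orthogonal group with its normalized Haar measure -/

/-- The compact topological group `O(n)`. -/
abbrev O (n : ℕ) := Matrix.orthogonalGroup (Fin n) ℝ

instance (n : ℕ) : CompactSpace (O n) := by
  have hc : IsClosed ((O n : Submonoid (Matrix (Fin n) (Fin n) ℝ)) :
      Set (Matrix (Fin n) (Fin n) ℝ)) := isClosed_unitary
  have hK : IsCompact (Set.pi univ fun _ : Fin n => Set.pi univ fun _ : Fin n =>
      Icc (-1 : ℝ) 1) :=
    isCompact_univ_pi fun _ => isCompact_univ_pi fun _ => isCompact_Icc
  refine isCompact_iff_compactSpace.mp (IsCompact.of_isClosed_subset hK hc ?_)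
  intro U hU i _ j _
  have h := entry_norm_bound_of_unitary (𝕜 := ℝ) hU i j
  exact abs_le.mp h

instance (n : ℕ) : MeasurableSpace (O n) := borel _

instance (n : ℕ) : BorelSpace (O n) := ⟨rfl⟩

/-- The Haar measure on `O(n)` of total mass one. -/
def haarO (n : ℕ) : Measure (O n) := Measure.haarMeasure ⊤

/-- The action of `O(n)` on `ℝⁿ`. -/
def act {n : ℕ} (k : O n) (z : E n) : E n :=
  WithLp.toLp 2 (Matrix.mulVec (k : Matrix (Fin n) (Fin n) ℝ) (WithLp.ofLp z))

/-! ### The averaged three-point function -/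

/-- `x̃`: the orthogonal projection `x - ⟨x, z⟩ z` of `x` to the tangent space of the sphere at
`z`, normalized to length one (undefined, here `0`, only for `x = ± z`). -/
def tilde {n : ℕ} (z x : E n) : E n :=
  ‖x - ⟪x, z⟫ • z‖⁻¹ • (x - ⟪x, z⟫ • z)

/-- `h(x, y; z) = F(⟨x, z⟩) F(⟨y, z⟩) g(⟨x̃, ỹ⟩)`. -/
def threePoint {n : ℕ} (F g : ℝ → ℝ) (x y z : E n) : ℝ :=
  F ⟪x, z⟫ * F ⟪y, z⟫ * g ⟪tilde z x, tilde z y⟫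

/-- `h(x, y) = ∫_{O(n)} h(x, y; k z) dμ(k)`, for a base point `z` on the sphere. -/
def pairAvg {n : ℕ} (F g : ℝ → ℝ) (z x y : E n) : ℝ :=
  ∫ k : O n, threePoint F g x y (act k z) ∂(haarO n)

/-- The first standard basis vector `(1, 0, …, 0)` (for `n ≥ 1`). -/
def pole (n : ℕ) : E n := WithLp.toLp 2 fun i => if i.val = 0 then 1 else 0

/-- The vector `(t, √(1 - t²), 0, …, 0)`; for `n ≥ 2` and `t ∈ [-1, 1]` it is a unit vector
whose inner product with the pole is `t`. -/
def tilted (n : ℕ) (t : ℝ) : E n :=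
  WithLp.toLp 2 fun i => if i.val = 0 then t else if i.val = 1 then √(1 - t ^ 2) else 0

/-- The point-pair invariant `h(x, y)` regarded as a function `h(t)` of `t = ⟨x, y⟩ ∈ [-1, 1]`. -/
def h (n : ℕ) (F g : ℝ → ℝ) (t : ℝ) : ℝ :=
  pairAvg F g (pole n) (pole n) (tilted n t)

/-- The admissible weights in dimension `n`: nonnegative on `[-1, 1]`, not almost everywhere zero
(`F₀ > 0`), and square integrable, hence integrable, for the probability measure
`dμ_{(n-3)/2}`. -/
structure Admissible (n : ℕ) (F : ℝ → ℝ) : Prop where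
  nonneg : ∀ u ∈ Icc (-1 : ℝ) 1, 0 ≤ F u
  memLp : MemLp F 2 (gegenbauerMeasure (((n : ℝ) - 3) / 2))
  pos : 0 < ∫ u, F u ∂(gegenbauerMeasure (((n : ℝ) - 3) / 2))

/-! ### The strip and the cap -/

/-- `r = √((s - s') / (1 - s'))`, with `s = cos θ`, `s' = cos θ'`. -/
def r (θ θ' : ℝ) : ℝ := √((cos θ - cos θ') / (1 - cos θ'))

/-- `γ = 2 arctan (s / √((1 - s)(s - s'))) + arccos r - π`. -/
def γ (θ θ' : ℝ) : ℝ :=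
  2 * arctan (cos θ / √((1 - cos θ) * (cos θ - cos θ'))) + arccos (r θ θ') - π

/-- `R = cos γ`. -/
def R (θ θ' : ℝ) : ℝ := cos (γ θ θ')

open Classical in
/-- The indicator function `χ` of `(r, R]`. -/
def χ (θ θ' : ℝ) (y : ℝ) : ℝ := if r θ θ' < y ∧ y ≤ R θ θ' then 1 else 0

/-- `c = (1/2) log ((1 - r²) / (1 - R²))` (finite when `R < 1`). -/
def c (θ θ' : ℝ) : ℝ := 1 / 2 * log ((1 - r θ θ' ^ 2) / (1 - R θ θ' ^ 2))

/-- The surface measure of the unit sphere of `ℝⁿ`, normalized to total mass one. -/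
def sphereMeasure (n : ℕ) : Measure (Metric.sphere (0 : E n) 1) :=
  ((volume : Measure (E n)).toSphere univ)⁻¹ • (volume : Measure (E n)).toSphere

/-- `μ_n(θ, θ')`: the mass of a cap on `S^{n-1}` (centred at the pole and contained in a
hemisphere) of radius `ρ = sin (θ/2) / sin (θ'/2)`; here the radius is the Euclidean radius of the
boundary of the cap, which lies at height `√(1 - ρ²)`. -/
def capMass (n : ℕ) (θ θ' : ℝ) : ℝ :=
  (sphereMeasure n).real
    {x | √(1 - (sin (θ / 2) / sin (θ' / 2)) ^ 2) ≤ ⟪(x : E n), pole n⟫}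

end SphCode

end

/-!
Everything rests on three facts about the kernel `h(x, y) = ∫ h(x, y; kz) dk`.

*It is a point-pair invariant* (`pairAvg_eq_h`): Haar measure absorbs an isometry applied to `x, y`
and a change of `z`, and two pairs of unit vectors with the same inner product differ by an
isometry.

*It is positive definite and continuous* (`zonalPosDef_h`, `continuousOn_h`): for almost every `z`
the three-point kernel is `g(⟨x̃, ỹ⟩)` on the unit sphere of `z^⊥`, positive definite because `g` is
a nonnegative combination of zonal polynomials, rescaled by `F(⟨x, z⟩) F(⟨y, z⟩)`. Continuity holds
by dominated convergence for bounded continuous `F`, and in general by approximation in `L²`, which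
makes the averages converge uniformly. Schoenberg's theorem (`ZonalPosDef.hasSum`) then expands `h`
in the orthonormal zonal polynomials with nonnegative coefficients, the series converging at each
point.

*Its mean and its value at `1` factor* (`integral_h`, `h_eval_one`): by Fubini `∫ h = F₀² ∫ g`,
since for fixed `x, z` and random `y` the direction `ỹ` is uniform on the sphere of `z^⊥` and
independent of `⟨y, z⟩` (`integral_fiber`); at `t = 1` one has `x̃ = ỹ`, so `h(1) = g(1) ‖F‖²`.

The linear programming bound (`card_le_L`) then gives the general part: sum `h(⟨x, y⟩)` over a code
and compare the diagonal with the constant coefficient.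

The harmonic analysis is done with polynomials only. The law of a coordinate of a uniform point of
the sphere is the Gegenbauer measure, because both have the same moments (`map_inner_eq_zonal`). The
convolution of two zonal polynomials is again a zonal polynomial, which yields the Funk–Hecke
formula (`funk_hecke`) and the reproducing property of the orthonormal polynomials, hence their
positive definiteness. In Schoenberg's theorem the coefficients are summable because testing against
convolution squares of `((1 + t) / 2) ^ k` bounds their partial sums.

For weights supported in the strip, the spherical law of cosines writes
`⟨x̃, ỹ⟩ = (t - u v) / (√(1 - u²) √(1 - v²))` with `u = ⟨x, z⟩`, `v = ⟨y, z⟩`. The right-hand side of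
`s ≤ u v + s' √(1 - u²) √(1 - v²)` is concave in each variable, so on `[r, R]²` the corners suffice:
at `(r, r)` the inequality is the definition of `r`, at `(r, R)` that of `γ`, and at `(R, R)` it
follows from `r < R` (`corner_inequality`, `strip_inequality`). It makes `⟨x̃, ỹ⟩ ≤ s'` whenever
`t ≤ s`, so `h(t) ≤ 0`. Optimality of `χ` is the Cauchy–Schwarz inequality. Finally
`L(h_χ) = L(g) / μ((r, R])`, the cap has mass `μ((r, 1])`, and the ratio of the two masses is
`1 + O(n e^{-nc})` by elementary estimates of the two integrals (`tail_le`).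
-/

namespace SphCode

/-! ### The orthogonal group acting on the sphere -/

variable {n : ℕ}

lemma act_eq_toLin (k : O n) (z : E n) :
    act k z = Matrix.toEuclideanLin (k : Matrix (Fin n) (Fin n) ℝ) z := rfl

lemma inner_act_act (k : O n) (x y : E n) : ⟪act k x, act k y⟫ = ⟪x, y⟫ := by
  have hk := Matrix.mem_unitaryGroup_iff'.1 k.2
  rw [EuclideanSpace.inner_eq_star_dotProduct, EuclideanSpace.inner_eq_star_dotProduct]
  simp only [act, star_trivial]
  rw [Matrix.dotProduct_mulVec, ← Matrix.mulVec_transpose, Matrix.mulVec_mulVec]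
  rw [Matrix.star_eq_conjTranspose, Matrix.conjTranspose_eq_transpose_of_trivial] at hk
  rw [hk, Matrix.one_mulVec]

lemma act_mul (k l : O n) (z : E n) : act (k * l) z = act k (act l z) := by
  simp [act, Matrix.mulVec_mulVec]

lemma act_one (z : E n) : act 1 z = z := by
  simp [act]

lemma norm_act (k : O n) (z : E n) : ‖act k z‖ = ‖z‖ := by
  rw [@norm_eq_sqrt_real_inner _ _ _ (act k z), inner_act_act, ← norm_eq_sqrt_real_inner]

lemma continuous_act : Continuous fun p : O n × E n => act p.1 p.2 := by
  unfold act
  refine (PiLp.continuous_toLp 2 _).comp ?_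
  exact Continuous.matrix_mulVec (continuous_subtype_val.comp continuous_fst)
    ((PiLp.continuous_ofLp 2 _).comp continuous_snd)

lemma continuous_act_left (z : E n) : Continuous fun k : O n => act k z :=
  continuous_act.comp (by fun_prop : Continuous fun k : O n => (k, z))

lemma exists_act_eq (U : E n ≃ₗᵢ[ℝ] E n) : ∃ k : O n, ∀ z, act k z = U z := by
  let b := EuclideanSpace.basisFun (Fin n) ℝ
  refine ⟨⟨_, U.toMatrix_mem_unitaryGroup b b⟩, fun z => ?_⟩
  have := LinearMap.toMatrix_mulVec_repr b.toBasis b.toBasis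
    (U.toLinearEquiv : E n →ₗ[ℝ] E n) z
  ext i
  exact congrFun this i

/-- The isometry of `ℝⁿ` given by an orthogonal matrix. -/
noncomputable def actIso (k : O n) : E n ≃ₗᵢ[ℝ] E n :=
  LinearIsometryEquiv.mk
    { toFun := act k
      invFun := act k⁻¹
      map_add' := fun x y => by rw [act_eq_toLin, map_add]; rfl
      map_smul' := fun x y => by rw [act_eq_toLin, map_smul]; rfl
      left_inv := fun x => by rw [← act_mul, inv_mul_cancel, act_one]
      right_inv := fun x => by rw [← act_mul, mul_inv_cancel, act_one] }
    (fun x => norm_act k x)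

@[simp] lemma actIso_apply (k : O n) (x : E n) : actIso k x = act k x := rfl

/-- Two pairs of unit vectors with the same inner product differ by an isometry, a product of two
reflections. -/
lemma exists_isometry_pair {V : Type*} [NormedAddCommGroup V] [InnerProductSpace ℝ V]
    {x y x' y' : V} (hx : ‖x‖ = 1) (hy : ‖y‖ = 1) (hx' : ‖x'‖ = 1)
    (hy' : ‖y'‖ = 1) (h : ⟪x, y⟫ = ⟪x', y'⟫) : ∃ U : V ≃ₗᵢ[ℝ] V, U x = x' ∧ U y = y' := by
  let U₁ := (ℝ ∙ (x - x'))ᗮ.reflection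
  have h₁ : U₁ x = x' := Submodule.reflection_sub (by rw [hx, hx'])
  let U₂ := (ℝ ∙ (U₁ y - y'))ᗮ.reflection
  have h₂ : U₂ (U₁ y) = y' := Submodule.reflection_sub (by rw [U₁.norm_map, hy, hy'])
  have h₃ : U₂ x' = x' := by
    apply Submodule.reflection_mem_subspace_eq_self
    rw [Submodule.mem_orthogonal_singleton_iff_inner_left, inner_sub_right, ← h, ← h₁,
      U₁.inner_map_map, sub_self]
  exact ⟨U₁.trans U₂, by simp [h₁, h₃], by simp [h₂]⟩

lemma exists_isometry_unit {V : Type*} [NormedAddCommGroup V] [InnerProductSpace ℝ V]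
    {x x' : V} (hx : ‖x‖ = 1) (hx' : ‖x'‖ = 1) : ∃ U : V ≃ₗᵢ[ℝ] V, U x = x' := by
  obtain ⟨U, hU, -⟩ := exists_isometry_pair hx hx hx' hx' (by simp [hx, hx'])
  exact ⟨U, hU⟩

instance : IsTopologicalGroup (O n) where

instance : (haarO n).IsHaarMeasure := by unfold haarO; infer_instance

instance : IsProbabilityMeasure (haarO n) := ⟨by
  have := Measure.haarMeasure_self (K₀ := (⊤ : TopologicalSpace.PositiveCompacts (O n)))
  simpa [haarO] using this⟩

instance : SecondCountableTopology (O n) :=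
  have : SecondCountableTopology (Matrix (Fin n) (Fin n) ℝ) :=
    inferInstanceAs (SecondCountableTopology (Fin n → Fin n → ℝ))
  (Topology.IsEmbedding.subtypeVal).secondCountableTopology

instance : (haarO n).IsMulRightInvariant where
  map_mul_right_eq_self g := by
    have : IsProbabilityMeasure ((haarO n).map (· * g)) :=
      Measure.isProbabilityMeasure_map (measurable_mul_const g).aemeasurable
    exact Measure.isHaarMeasure_eq_of_isProbabilityMeasure _ _

lemma integral_isometry_act {G : Type*} [NormedAddCommGroup G] [NormedSpace ℝ G]
    (U : E n ≃ₗᵢ[ℝ] E n) (f : E n → G) (z : E n) :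
    ∫ k, f (U (act k z)) ∂haarO n = ∫ k, f (act k z) ∂haarO n := by
  obtain ⟨l, hl⟩ := exists_act_eq U
  simp_rw [← hl, ← act_mul]
  exact integral_mul_left_eq_self (fun k => f (act k z)) l

/-- Right invariance of Haar measure: the sphere is a single orbit, and all its points have the same
orbital means. -/
lemma integral_act_congr {G : Type*} [NormedAddCommGroup G] [NormedSpace ℝ G]
    (f : E n → G) {z z' : E n} (hz : ‖z‖ = 1) (hz' : ‖z'‖ = 1) :
    ∫ k, f (act k z) ∂haarO n = ∫ k, f (act k z') ∂haarO n := by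
  obtain ⟨U, hU⟩ := exists_isometry_unit hz' hz
  obtain ⟨l, hl⟩ := exists_act_eq U
  rw [← hU, ← hl]
  simp_rw [← act_mul]
  exact integral_mul_right_eq_self (fun k => f (act k z')) l

lemma tilde_isometry (U : E n ≃ₗᵢ[ℝ] E n) (z x : E n) : tilde (U z) (U x) = U (tilde z x) := by
  have : U x - ⟪U x, U z⟫ • U z = U (x - ⟪x, z⟫ • z) := by simp
  rw [tilde, this, U.norm_map, tilde, map_smul]

lemma threePoint_isometry (U : E n ≃ₗᵢ[ℝ] E n) (F g : ℝ → ℝ) (x y z : E n) :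
    threePoint F g (U x) (U y) (U z) = threePoint F g x y z := by
  simp only [threePoint, tilde_isometry, U.inner_map_map]

lemma norm_pole (hn : 1 ≤ n) : ‖pole n‖ = 1 := by
  obtain ⟨m, rfl⟩ : ∃ m, n = m + 1 := ⟨n - 1, by omega⟩
  rw [EuclideanSpace.norm_eq, Real.sqrt_eq_one, Fin.sum_univ_succ]
  simp [pole]

lemma norm_tilted (hn : 2 ≤ n) {t : ℝ} (ht : t ∈ Icc (-1 : ℝ) 1) : ‖tilted n t‖ = 1 := by
  obtain ⟨m, rfl⟩ : ∃ m, n = m + 2 := ⟨n - 2, by omega⟩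
  rw [EuclideanSpace.norm_eq, Real.sqrt_eq_one, Fin.sum_univ_succ, Fin.sum_univ_succ]
  have : (0 : ℝ) ≤ 1 - t ^ 2 := by nlinarith [ht.1, ht.2]
  simp [tilted, Real.sq_sqrt this]

lemma inner_eq_sum (x y : E n) : ⟪x, y⟫ = ∑ i, x i * y i := by
  rw [PiLp.inner_apply]
  simp [mul_comm]

lemma inner_pole_tilted (hn : 1 ≤ n) (t : ℝ) : ⟪pole n, tilted n t⟫ = t := by
  obtain ⟨m, rfl⟩ : ∃ m, n = m + 1 := ⟨n - 1, by omega⟩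
  rw [inner_eq_sum, Fin.sum_univ_succ]
  simp [pole, tilted]

lemma tilted_one : tilted n 1 = pole n := by
  ext i
  simp [tilted, pole]

lemma inner_mem_Icc {V : Type*} [NormedAddCommGroup V] [InnerProductSpace ℝ V]
    {x y : V} (hx : ‖x‖ ≤ 1) (hy : ‖y‖ ≤ 1) : ⟪x, y⟫ ∈ Icc (-1 : ℝ) 1 := by
  have h := abs_real_inner_le_norm x y
  exact abs_le.1 (h.trans (mul_le_one₀ hx (norm_nonneg _) hy))

theorem pairAvg_eq_h (hn : 2 ≤ n) (F g : ℝ → ℝ) {x y z : E n} (hx : ‖x‖ = 1) (hy : ‖y‖ = 1)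
    (hz : ‖z‖ = 1) : pairAvg F g z x y = h n F g ⟪x, y⟫ := by
  have ht := inner_mem_Icc hx.le hy.le
  have hp := norm_pole (n := n) (by omega)
  obtain ⟨U, hUx, hUy⟩ := exists_isometry_pair hp (norm_tilted hn ht) hx hy
    (inner_pole_tilted (by omega) _)
  unfold h pairAvg
  rw [integral_act_congr _ hz hp, ← integral_isometry_act U]
  conv_lhs => rw [← hUx, ← hUy]
  rw [hUx, hUy]
  refine integral_congr_ae (.of_forall fun k => ?_)
  have := threePoint_isometry U F g (pole n) (tilted n ⟪x, y⟫) (act k (pole n))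
  rw [hUx, hUy] at this
  exact this

end SphCode

namespace SphCode

/-! ### The Gegenbauer measures -/

section Gegenbauer

variable {α : ℝ}

lemma one_sub_sq_pos {t : ℝ} (ht : t ∈ Ioo (-1 : ℝ) 1) : 0 < 1 - t ^ 2 := by
  nlinarith [ht.1, ht.2]

lemma one_sub_sq_nonneg {t : ℝ} (ht : t ∈ Icc (-1 : ℝ) 1) : 0 ≤ 1 - t ^ 2 := by
  nlinarith [ht.1, ht.2]

lemma weight_nonneg {t : ℝ} (ht : t ∈ Icc (-1 : ℝ) 1) : 0 ≤ (1 - t ^ 2) ^ α :=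
  Real.rpow_nonneg (one_sub_sq_nonneg ht) _

lemma measurable_weight : Measurable fun t : ℝ => (1 - t ^ 2) ^ α := by fun_prop

/-- For `α ≥ -1/2` the weight is dominated by the arcsine density. -/
lemma intervalIntegrable_weight (hα : -1 / 2 ≤ α) :
    IntervalIntegrable (fun t : ℝ => (1 - t ^ 2) ^ α) volume (-1) 1 := by
  have h0 : IntervalIntegrable (fun t : ℝ => 1 / √(1 - t ^ 2)) volume (-1) 1 := by
    refine intervalIntegral.intervalIntegrable_deriv_of_nonneg (g := arcsin)
      continuous_arcsin.continuousOn ?_ ?_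
    · intro t ht
      simp only [min_eq_left (by norm_num : (-1 : ℝ) ≤ 1),
        max_eq_right (by norm_num : (-1 : ℝ) ≤ 1)] at ht
      exact hasDerivAt_arcsin ht.1.ne' ht.2.ne
    · intro t _
      positivity
  rw [intervalIntegrable_iff_integrableOn_Ioo_of_le (by norm_num)] at h0 ⊢
  refine h0.mono' measurable_weight.aestronglyMeasurable ?_
  filter_upwards [ae_restrict_mem measurableSet_Ioo] with t ht
  have hp := one_sub_sq_pos ht
  rw [Real.norm_of_nonneg (Real.rpow_nonneg hp.le _), Real.sqrt_eq_rpow, one_div,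
    ← Real.rpow_neg hp.le]
  exact Real.rpow_le_rpow_of_exponent_ge hp (by nlinarith [sq_nonneg t]) (by linarith)

lemma integral_weight_pos (hα : -1 / 2 ≤ α) : 0 < ∫ u in (-1 : ℝ)..1, (1 - u ^ 2) ^ α :=
  intervalIntegral.intervalIntegral_pos_of_pos_on (intervalIntegrable_weight hα)
    (fun _ hx => Real.rpow_pos_of_pos (one_sub_sq_pos hx) _) (by norm_num)

lemma integral_gegenbauer (hα : -1 / 2 ≤ α) (f : ℝ → ℝ) :
    ∫ t, f t ∂gegenbauerMeasure α =
      (∫ t in (-1 : ℝ)..1, f t * (1 - t ^ 2) ^ α) / ∫ u in (-1 : ℝ)..1, (1 - u ^ 2) ^ α := by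
  rw [gegenbauerMeasure, integral_withDensity_eq_integral_toReal_smul
    (by fun_prop) (by simp),
    intervalIntegral.integral_of_le (f := fun t => f t * _) (by norm_num : (-1 : ℝ) ≤ 1),
    ← integral_Icc_eq_integral_Ioc, ← integral_div]
  refine setIntegral_congr_fun measurableSet_Icc fun t ht => ?_
  have := weight_nonneg (α := α) ht
  have h2 := integral_weight_pos hα
  simp only [smul_eq_mul]
  rw [ENNReal.toReal_ofReal (by positivity)]
  ring

lemma isProbabilityMeasure_gegenbauer (hα : -1 / 2 ≤ α) :
    IsProbabilityMeasure (gegenbauerMeasure α) := by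
  constructor
  have h2 := integral_weight_pos hα
  rw [gegenbauerMeasure, withDensity_apply _ .univ, Measure.restrict_univ,
    ← ofReal_integral_eq_lintegral_ofReal]
  · rw [integral_Icc_eq_integral_Ioc, ← intervalIntegral.integral_of_le (by norm_num),
      intervalIntegral.integral_div, div_self h2.ne', ENNReal.ofReal_one]
  · have := intervalIntegrable_weight hα
    rw [intervalIntegrable_iff_integrableOn_Icc_of_le (by norm_num)] at this
    exact this.div_const _
  · filter_upwards [ae_restrict_mem measurableSet_Icc] with t ht
    have := weight_nonneg (α := α) ht
    positivity

lemma gegenbauer_absolutelyContinuous :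
    gegenbauerMeasure α ≪ volume.restrict (Icc (-1 : ℝ) 1) :=
  withDensity_absolutelyContinuous _ _

lemma ae_gegenbauer_mem_Icc : ∀ᵐ t ∂gegenbauerMeasure α, t ∈ Icc (-1 : ℝ) 1 :=
  gegenbauer_absolutelyContinuous (ae_restrict_mem measurableSet_Icc)

instance : NullSingletonClass (gegenbauerMeasure α) :=
  ⟨fun _ => gegenbauer_absolutelyContinuous (measure_singleton _)⟩

lemma ae_gegenbauer_mem_Ioo : ∀ᵐ t ∂gegenbauerMeasure α, t ∈ Ioo (-1 : ℝ) 1 := by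
  filter_upwards [ae_gegenbauer_mem_Icc, Measure.ae_ne (gegenbauerMeasure α) 1,
    Measure.ae_ne (gegenbauerMeasure α) (-1)] with t ht h1 h2
  exact ⟨lt_of_le_of_ne ht.1 (Ne.symm h2), lt_of_le_of_ne ht.2 h1⟩

lemma absolutelyContinuous_gegenbauer (hα : -1 / 2 ≤ α) :
    volume.restrict (Icc (-1 : ℝ) 1) ≪ gegenbauerMeasure α := by
  refine withDensity_absolutelyContinuous' (by fun_prop) ?_
  rw [← restrict_Ioo_eq_restrict_Icc]
  filter_upwards [ae_restrict_mem measurableSet_Ioo] with t ht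
  have := Real.rpow_pos_of_pos (one_sub_sq_pos ht) α
  have h2 := integral_weight_pos hα
  simp only [ne_eq, ENNReal.ofReal_eq_zero, not_le]
  positivity

lemma integrable_gegenbauer_of_continuousOn (hα : -1 / 2 ≤ α) {f : ℝ → ℝ}
    (hf : ContinuousOn f (Icc (-1 : ℝ) 1)) : Integrable f (gegenbauerMeasure α) := by
  have := isProbabilityMeasure_gegenbauer hα
  obtain ⟨C, hC⟩ := isCompact_Icc.exists_bound_of_continuousOn hf
  refine Integrable.of_bound (C := C) ?_ ?_
  · exact (hf.aestronglyMeasurable measurableSet_Icc).mono_ac gegenbauer_absolutelyContinuous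
  · filter_upwards [ae_gegenbauer_mem_Icc] with t ht using hC t ht

lemma moment_odd (hα : -1 / 2 ≤ α) {j : ℕ} (hj : Odd j) :
    ∫ t, t ^ j ∂gegenbauerMeasure α = 0 := by
  rw [integral_gegenbauer hα]
  have := intervalIntegral.integral_comp_neg (a := -1) (b := 1)
    (fun t : ℝ => t ^ j * (1 - t ^ 2) ^ α)
  simp only [hj.neg_pow, even_two.neg_pow, neg_neg, neg_mul, intervalIntegral.integral_neg] at this
  have h0 : ∫ t in (-1 : ℝ)..1, t ^ j * (1 - t ^ 2) ^ α = 0 := by linarith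
  rw [h0, zero_div]

/-- The moment recursion, by integration of the derivative of `t ^ (j+1) (1 - t²) ^ (α+1)`. -/
lemma moment_recursion (hα : -1 / 2 ≤ α) (j : ℕ) :
    (2 * (α + 1) + (j + 1)) * ∫ t, t ^ (j + 2) ∂gegenbauerMeasure α =
      (j + 1) * ∫ t, t ^ j ∂gegenbauerMeasure α := by
  have hw := intervalIntegrable_weight hα
  have hint : ∀ i : ℕ, IntervalIntegrable (fun t : ℝ => t ^ i * (1 - t ^ 2) ^ α) volume (-1) 1 :=
    fun i => hw.continuousOn_mul (by fun_prop)
  have key : ∫ t in (-1 : ℝ)..1, ((j + 1) * (t ^ j * (1 - t ^ 2) ^ α) -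
      (2 * (α + 1) + (j + 1)) * (t ^ (j + 2) * (1 - t ^ 2) ^ α)) = 0 := by
    have := intervalIntegral.integral_eq_sub_of_hasDerivAt_of_le (a := -1) (b := 1)
      (f := fun t : ℝ => t ^ (j + 1) * (1 - t ^ 2) ^ (α + 1))
      (f' := fun t : ℝ => (j + 1) * (t ^ j * (1 - t ^ 2) ^ α) -
        (2 * (α + 1) + (j + 1)) * (t ^ (j + 2) * (1 - t ^ 2) ^ α)) (by norm_num) ?_ ?_ ?_
    · rw [this]
      simp [Real.zero_rpow (show α + 1 ≠ 0 by linarith)]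
    · refine ContinuousOn.mul (by fun_prop) ?_
      exact ContinuousOn.rpow_const (by fun_prop) fun t _ => Or.inr (by linarith)
    · intro t ht
      have hp := one_sub_sq_pos ht
      have h1 : HasDerivAt (fun t : ℝ => 1 - t ^ 2) (-(2 * t)) t := by
        simpa using (hasDerivAt_pow 2 t).const_sub 1
      have h2 := (hasDerivAt_pow (j + 1) t).fun_mul (h1.rpow_const (p := α + 1) (Or.inl hp.ne'))
      refine h2.congr_deriv ?_
      rw [Real.rpow_add_one hp.ne', add_sub_cancel_right]
      push_cast
      ring
    · exact ((hint j).const_mul _).sub ((hint (j + 2)).const_mul _)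
  rw [intervalIntegral.integral_sub ((hint j).const_mul _) ((hint (j + 2)).const_mul _),
    intervalIntegral.integral_const_mul, intervalIntegral.integral_const_mul] at key
  rw [integral_gegenbauer hα, integral_gegenbauer hα, ← mul_div_assoc, ← mul_div_assoc]
  congr 1
  linarith

end Gegenbauer

end SphCode

namespace SphCode

/-! ### The law of a coordinate -/

variable {n : ℕ}

/-- The measure `μ_{(n-3)/2}`; for `n ≥ 2` it is the distribution of `⟨x, z⟩` for `x` uniform on the
unit sphere of `ℝⁿ` and a fixed unit vector `z`. -/
noncomputable abbrev zonal (n : ℕ) : Measure ℝ := gegenbauerMeasure (((n : ℝ) - 3) / 2)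

lemma neg_half_le (hn : 2 ≤ n) : (-1 : ℝ) / 2 ≤ ((n : ℝ) - 3) / 2 := by
  have : (2 : ℝ) ≤ n := by exact_mod_cast hn
  linarith

lemma isProbabilityMeasure_zonal (hn : 2 ≤ n) : IsProbabilityMeasure (zonal n) :=
  isProbabilityMeasure_gegenbauer (neg_half_le hn)

/-- Moments determine a probability measure on `[-1, 1]`, by Weierstrass approximation. -/
lemma measure_eq_of_moments {ρ μ : Measure ℝ} [IsProbabilityMeasure ρ] [IsProbabilityMeasure μ]
    (hρ : ∀ᵐ t ∂ρ, t ∈ Icc (-1 : ℝ) 1) (hμ : ∀ᵐ t ∂μ, t ∈ Icc (-1 : ℝ) 1)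
    (h : ∀ j : ℕ, ∫ t, t ^ j ∂ρ = ∫ t, t ^ j ∂μ) : ρ = μ := by
  have hint : ∀ (κ : Measure ℝ) [IsProbabilityMeasure κ], (∀ᵐ t ∂κ, t ∈ Icc (-1 : ℝ) 1) →
      ∀ f : ℝ → ℝ, Continuous f → Integrable f κ := by
    intro κ _ hκ f hf
    obtain ⟨C, hC⟩ := isCompact_Icc.exists_bound_of_continuousOn (hf.continuousOn (s := Icc (-1) 1))
    refine Integrable.of_bound hf.aestronglyMeasurable C ?_
    filter_upwards [hκ] with t ht using hC t ht
  have hpoly : ∀ p : Polynomial ℝ, ∫ t, p.eval t ∂ρ = ∫ t, p.eval t ∂μ := by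
    intro p
    simp_rw [Polynomial.eval_eq_sum_range]
    rw [integral_finsetSum _ fun i _ => hint ρ hρ _ (by fun_prop),
      integral_finsetSum _ fun i _ => hint μ hμ _ (by fun_prop)]
    exact Finset.sum_congr rfl fun i _ => by rw [integral_const_mul, integral_const_mul, h]
  refine ext_of_forall_integral_eq_of_IsFiniteMeasure fun f => ?_
  refine eq_of_forall_dist_le fun ε hε => ?_
  obtain ⟨p, hp⟩ := exists_polynomial_near_of_continuousOn (-1) 1 f f.continuous.continuousOn
    (ε / 2) (by positivity)
  have hb : ∀ (κ : Measure ℝ) [IsProbabilityMeasure κ], (∀ᵐ t ∂κ, t ∈ Icc (-1 : ℝ) 1) →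
      |∫ t, f t ∂κ - ∫ t, p.eval t ∂κ| ≤ ε / 2 := by
    intro κ _ hκ
    rw [← integral_sub (hint κ hκ _ f.continuous) (hint κ hκ _ p.continuous)]
    have := norm_integral_le_of_norm_le_const (μ := κ) (f := fun t => f t - p.eval t)
      (C := ε / 2) ?_
    · simpa using this
    · filter_upwards [hκ] with t ht
      rw [Real.norm_eq_abs, abs_sub_comm]
      exact (hp t ht).le
  have h1 := abs_le.1 (hb ρ hρ)
  have h2 := abs_le.1 (hb μ hμ)
  rw [hpoly p] at h1
  rw [Real.dist_eq, abs_le]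
  constructor <;> linarith [h1.1, h1.2, h2.1, h2.2]

section Invariant

variable {ν : Measure (E n)}

lemma integral_isometry_of_invariant (hinv : ∀ U : E n ≃ₗᵢ[ℝ] E n, ν.map U = ν)
    (U : E n ≃ₗᵢ[ℝ] E n) (f : E n → ℝ) : ∫ y, f (U y) ∂ν = ∫ y, f y ∂ν := by
  conv_rhs => rw [← hinv U]
  exact (integral_map_equiv U.toHomeomorph.toMeasurableEquiv f).symm

lemma moment_inner (hinv : ∀ U : E n ≃ₗᵢ[ℝ] E n, ν.map U = ν) {v e : E n} (he : ‖e‖ = 1)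
    (j : ℕ) : ∫ y, ⟪y, v⟫ ^ j ∂ν = ‖v‖ ^ j * ∫ y, ⟪y, e⟫ ^ j ∂ν := by
  rcases eq_or_ne v 0 with rfl | hv
  · rcases Nat.eq_zero_or_pos j with rfl | hj
    · simp
    · simp [hj.ne']
  have hv' : ‖v‖ ≠ 0 := norm_ne_zero_iff.2 hv
  have hu : ‖‖v‖⁻¹ • v‖ = 1 := by rw [norm_smul, norm_inv, norm_norm, inv_mul_cancel₀ hv']
  obtain ⟨U, hU⟩ := exists_isometry_unit he hu
  rw [← integral_isometry_of_invariant hinv U, ← integral_const_mul]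
  refine integral_congr_ae (.of_forall fun y => ?_)
  simp only
  have : v = ‖v‖ • U e := by rw [hU, smul_smul, mul_inv_cancel₀ hv', one_smul]
  conv_lhs => rw [this]
  rw [inner_smul_right, U.inner_map_map, mul_pow]

variable [IsProbabilityMeasure ν]

lemma integrable_of_sphere (hs : ∀ᵐ y ∂ν, ‖y‖ = 1) {f : E n → ℝ} (hf : Continuous f) :
    Integrable f ν := by
  obtain ⟨C, hC⟩ := (isCompact_sphere (0 : E n) 1).exists_bound_of_continuousOn hf.continuousOn
  refine Integrable.of_bound hf.aestronglyMeasurable C ?_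
  filter_upwards [hs] with y hy using hC y (by simpa using hy)

open Polynomial in
/-- The mixed moments of two orthogonal coordinates, read off from the coefficient of `b²` in
`∫ ⟨y, e + b f⟩ ^ 2k = (1 + b²) ^ k ∫ ⟨y, e⟩ ^ 2k`. -/
lemma mixed_moment (hs : ∀ᵐ y ∂ν, ‖y‖ = 1) (hinv : ∀ U : E n ≃ₗᵢ[ℝ] E n, ν.map U = ν)
    {e f : E n} (he : ‖e‖ = 1) (hf : ‖f‖ = 1) (hef : ⟪e, f⟫ = 0) (k : ℕ) :
    (2 * k + 1) * ∫ y, ⟪y, e⟫ ^ (2 * k) * ⟪y, f⟫ ^ 2 ∂ν = ∫ y, ⟪y, e⟫ ^ (2 * k + 2) ∂ν := by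
  set M := ∫ y, ⟪y, e⟫ ^ (2 * k + 2) ∂ν
  let P : ℝ[X] := ∑ l ∈ Finset.range (2 * (k + 1) + 1),
    C (((2 * (k + 1)).choose l : ℝ) * ∫ y, ⟪y, e⟫ ^ (2 * (k + 1) - l) * ⟪y, f⟫ ^ l ∂ν) * X ^ l
  let Q : ℝ[X] := C M * expand ℝ 2 ((1 + X) ^ (k + 1))
  have hPQ : P = Q := by
    refine Polynomial.funext fun b => ?_
    have h1 : P.eval b = ∫ y, ⟪y, e + b • f⟫ ^ (2 * (k + 1)) ∂ν := by
      simp only [P, eval_finsetSum, eval_mul, eval_C, eval_pow, eval_X, inner_add_right,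
        inner_smul_right]
      simp_rw [add_comm _ (b * _), add_pow]
      rw [integral_finsetSum _ fun i _ => integrable_of_sphere hs (by fun_prop)]
      refine Finset.sum_congr rfl fun l _ => ?_
      rw [mul_right_comm, ← integral_const_mul]
      refine integral_congr_ae (.of_forall fun y => ?_)
      simp only [mul_pow]
      ring
    have h2 : ‖e + b • f‖ ^ 2 = 1 + b ^ 2 := by
      rw [norm_add_sq_real, inner_smul_right, hef, norm_smul, he, hf]
      simp
    rw [h1, moment_inner hinv he, pow_mul, h2]
    simp only [Q, eval_mul, eval_C, expand_eval, eval_pow, eval_add, eval_one, eval_X]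
    rw [mul_comm]
    rfl
  -- coefficients of `b²`: `choose (2k+2) 2` times the mixed moment, and `k + 1` times `M`
  have hc := congrArg (fun p => p.coeff 2) hPQ
  simp only [P, Q, finsetSum_coeff, coeff_C_mul, coeff_X_pow, mul_ite, mul_one, mul_zero,
    Finset.sum_ite_eq, Finset.mem_range] at hc
  rw [if_pos (by omega)] at hc
  have h3 : (expand ℝ 2 ((1 + X : ℝ[X]) ^ (k + 1))).coeff 2 = k + 1 := by
    have := coeff_expand_mul (R := ℝ) (p := 2) (by norm_num) ((1 + X : ℝ[X]) ^ (k + 1)) 1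
    rw [one_mul] at this
    rw [this, coeff_one_add_X_pow]
    simp
  have h4 : (((2 * (k + 1)).choose 2 : ℕ) : ℝ) = (k + 1) * (2 * k + 1) := by
    rw [Nat.cast_choose_two]
    push_cast
    ring
  rw [h3, h4, show 2 * (k + 1) - 2 = 2 * k by omega] at hc
  have h5 : (k : ℝ) + 1 ≠ 0 := by positivity
  refine mul_left_cancel₀ h5 ?_
  linarith

/-- The moments of a coordinate satisfy the recursion of the Gegenbauer moments: multiply
`∑ yᵢ² = 1` by `⟨y, e⟩ ^ 2k` and integrate. -/
lemma sphere_moment_recursion (hs : ∀ᵐ y ∂ν, ‖y‖ = 1)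
    (hinv : ∀ U : E n ≃ₗᵢ[ℝ] E n, ν.map U = ν) {e : E n} (he : ‖e‖ = 1) (k : ℕ) :
    (n + 2 * k) * ∫ y, ⟪y, e⟫ ^ (2 * k + 2) ∂ν = (2 * k + 1) * ∫ y, ⟪y, e⟫ ^ (2 * k) ∂ν := by
  have hn : 0 < n := by
    rcases Nat.eq_zero_or_pos n with rfl | h
    · have : e = 0 := Subsingleton.elim _ _
      simp [this] at he
    · exact h
  let e0 : E n := EuclideanSpace.single ⟨0, hn⟩ 1
  have he0 : ‖e0‖ = 1 := by simp [e0]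
  have red : ∀ j, ∫ y, ⟪y, e⟫ ^ j ∂ν = ∫ y, ⟪y, e0⟫ ^ j ∂ν := fun j => by
    rw [moment_inner hinv he0, he, one_pow, one_mul]
  rw [red, red]
  have hsum : ∑ i : Fin n, ∫ y, ⟪y, e0⟫ ^ (2 * k) * ⟪y, EuclideanSpace.single i 1⟫ ^ 2 ∂ν =
      ∫ y, ⟪y, e0⟫ ^ (2 * k) ∂ν := by
    rw [← integral_finsetSum _ fun i _ => integrable_of_sphere hs (by fun_prop)]
    refine integral_congr_ae ?_
    filter_upwards [hs] with y hy
    have : ∑ i, y i ^ 2 = 1 := by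
      rw [← EuclideanSpace.real_norm_sq_eq, hy, one_pow]
    simp only [← Finset.mul_sum, EuclideanSpace.inner_single_right]
    simp [this]
  have h0 : ∫ y, ⟪y, e0⟫ ^ (2 * k) * ⟪y, EuclideanSpace.single ⟨0, hn⟩ 1⟫ ^ 2 ∂ν =
      ∫ y, ⟪y, e0⟫ ^ (2 * k + 2) ∂ν := by
    simp_rw [pow_add]
    rfl
  rw [← Finset.add_sum_erase _ _ (Finset.mem_univ (⟨0, hn⟩ : Fin n)), h0] at hsum
  -- the `n - 1` coordinates orthogonal to `e0` contribute equally
  have hrest : ∀ i ∈ Finset.univ.erase (⟨0, hn⟩ : Fin n),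
      (2 * k + 1 : ℝ) * ∫ y, ⟪y, e0⟫ ^ (2 * k) * ⟪y, EuclideanSpace.single i 1⟫ ^ 2 ∂ν =
        ∫ y, ⟪y, e0⟫ ^ (2 * k + 2) ∂ν := by
    intro i hi
    refine mixed_moment hs hinv he0 (by simp) ?_ k
    have := Finset.ne_of_mem_erase hi
    simp [e0, EuclideanSpace.inner_single_left, this.symm]
  have hsum2 := Finset.sum_congr rfl hrest
  rw [← Finset.mul_sum, Finset.sum_const, Finset.card_erase_of_mem (Finset.mem_univ _),
    Finset.card_univ, Fintype.card_fin, nsmul_eq_mul, Nat.cast_sub hn] at hsum2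
  rw [← hsum, mul_add, hsum2]
  push_cast
  ring

/-- The law of one coordinate under an isometry-invariant probability measure on the unit sphere
is the Gegenbauer measure: both have the same moments. -/
theorem map_inner_eq_zonal (hn : 2 ≤ n) (hs : ∀ᵐ y ∂ν, ‖y‖ = 1)
    (hinv : ∀ U : E n ≃ₗᵢ[ℝ] E n, ν.map U = ν) {e : E n} (he : ‖e‖ = 1) :
    ν.map (fun y => ⟪y, e⟫) = zonal n := by
  have hm : Measurable fun y : E n => ⟪y, e⟫ := by fun_prop
  have := Measure.isProbabilityMeasure_map (μ := ν) hm.aemeasurable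
  have := isProbabilityMeasure_zonal hn
  refine measure_eq_of_moments ?_ ae_gegenbauer_mem_Icc fun j => ?_
  · refine (ae_map_iff hm.aemeasurable measurableSet_Icc).2 ?_
    filter_upwards [hs] with y hy using inner_mem_Icc hy.le he.le
  rw [integral_map hm.aemeasurable (by fun_prop)]
  -- even moments obey the same recursion, odd moments vanish
  rcases Nat.even_or_odd' j with ⟨k, rfl | rfl⟩
  · induction k with
    | zero => simp
    | succ k ih =>
      have h1 := sphere_moment_recursion hs hinv he k
      have h2 := moment_recursion (neg_half_le hn) (2 * k)
      rw [← ih] at h2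
      have h3 : (n + 2 * k : ℝ) ≠ 0 := by positivity
      refine mul_left_cancel₀ h3 ?_
      rw [mul_add 2 k 1, h1]
      push_cast at h2
      rw [← h2, show 2 * (((n : ℝ) - 3) / 2 + 1) + (2 * k + 1) = n + 2 * k by ring]
  · rw [moment_odd (neg_half_le hn) ⟨k, rfl⟩]
    have := integral_isometry_of_invariant hinv (LinearIsometryEquiv.neg ℝ)
      (fun y => ⟪y, e⟫ ^ (2 * k + 1))
    simp only [LinearIsometryEquiv.coe_neg, inner_neg_left,
      (show Odd (2 * k + 1) from ⟨k, rfl⟩).neg_pow, integral_neg] at this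
    linarith

end Invariant

theorem measurePreserving_inner_act (hn : 2 ≤ n) {x z : E n} (hx : ‖x‖ = 1) (hz : ‖z‖ = 1) :
    MeasurePreserving (fun k : O n => ⟪x, act k z⟫) (haarO n) (zonal n) := by
  have hc := continuous_act_left z
  refine ⟨by fun_prop, ?_⟩
  have := Measure.isProbabilityMeasure_map (μ := haarO n) hc.measurable.aemeasurable
  rw [← map_inner_eq_zonal (ν := (haarO n).map fun k => act k z) hn ?_ ?_ hx,
    Measure.map_map (by fun_prop) hc.measurable]
  · congr 1
    funext k
    exact (real_inner_comm _ _)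
  · rw [ae_map_iff hc.measurable.aemeasurable
      (measurableSet_eq_fun measurable_norm measurable_const)]
    exact .of_forall fun k => by rw [norm_act, hz]
  · intro U
    obtain ⟨l, hl⟩ := exists_act_eq U
    rw [Measure.map_map U.continuous.measurable hc.measurable]
    conv_rhs => rw [← map_mul_left_eq_self (haarO n) l]
    rw [Measure.map_map hc.measurable (measurable_const_mul l)]
    congr 1
    funext k
    simp [← hl, act_mul]

/-- Archimedes' hat-box theorem in dimension `n`: the same law of a coordinate, now for the
normalized surface measure instead of the orbit of Haar measure. -/
theorem map_inner_sphereMeasure (hn : 2 ≤ n) {e : E n} (he : ‖e‖ = 1) :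
    (sphereMeasure n).map (fun x : Metric.sphere (0 : E n) 1 => ⟪(x : E n), e⟫) = zonal n := by
  have : Nonempty (Fin n) := ⟨⟨0, by omega⟩⟩
  have hmc : Measurable (Subtype.val : Metric.sphere (0 : E n) 1 → E n) := measurable_subtype_coe
  set τ := (volume : Measure (E n)).toSphere
  have hτ : τ ≠ 0 := Measure.toSphere_ne_zero _
  have h0 : τ univ ≠ 0 := by simpa using hτ
  have hp : IsProbabilityMeasure (sphereMeasure n) := ⟨by
    simp only [sphereMeasure, Measure.smul_apply, smul_eq_mul]
    exact ENNReal.inv_mul_cancel h0 (measure_ne_top _ _)⟩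
  have := Measure.isProbabilityMeasure_map (μ := sphereMeasure n) hmc.aemeasurable
  rw [← map_inner_eq_zonal (ν := (sphereMeasure n).map Subtype.val) hn ?_ ?_ he,
    Measure.map_map (by fun_prop) hmc]
  · rfl
  · rw [ae_map_iff hmc.aemeasurable (measurableSet_eq_fun measurable_norm measurable_const)]
    exact .of_forall fun y => by simp
  · intro U
    have hU : Measurable U := U.continuous.measurable
    simp only [sphereMeasure, Measure.map_smul]
    congr 1
    ext s hs
    rw [Measure.map_apply hU hs, Measure.map_apply hmc (hU hs), Measure.map_apply hmc hs,
      Measure.toSphere_apply' _ (hmc (hU hs)), Measure.toSphere_apply' _ (hmc hs)]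
    congr 1
    conv_rhs =>
      rw [← U.measurePreserving.measure_preimage_equiv
        (f := U.toHomeomorph.toMeasurableEquiv)]
    congr 1
    ext v
    simp only [Set.mem_smul, Set.mem_image, Set.mem_preimage]
    constructor
    · rintro ⟨a, ha, -, ⟨y, hy, rfl⟩, rfl⟩
      exact ⟨a, ha, U y, ⟨⟨U y, by simp⟩, hy, rfl⟩, (map_smul U a _).symm⟩
    · rintro ⟨a, ha, -, ⟨y, hy, rfl⟩, h⟩
      refine ⟨a, ha, U.symm y, ⟨⟨U.symm y, by simp⟩, by simpa using hy, rfl⟩, ?_⟩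
      apply U.injective
      rw [map_smul, U.apply_symm_apply]
      exact h

end SphCode

namespace SphCode

/-! ### Integrals of zonal polynomials -/

open Polynomial

variable {n : ℕ}

lemma integrable_poly (hn : 2 ≤ n) (p : ℝ[X]) : Integrable (fun t => p.eval t) (zonal n) :=
  integrable_gegenbauer_of_continuousOn (neg_half_le hn) p.continuous.continuousOn

lemma integrable_poly_mul (hn : 2 ≤ n) (p q : ℝ[X]) :
    Integrable (fun t => p.eval t * q.eval t) (zonal n) := by
  simpa using integrable_poly hn (p * q)

lemma integrable_of_continuous_haar {f : O n → ℝ} (hf : Continuous f) :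
    Integrable f (haarO n) :=
  hf.integrable_of_hasCompactSupport (HasCompactSupport.of_compactSpace f)

lemma integral_inner_act (hn : 2 ≤ n) {x z : E n} (hx : ‖x‖ = 1) (hz : ‖z‖ = 1) {f : ℝ → ℝ}
    (hf : AEStronglyMeasurable f (zonal n)) :
    ∫ k, f ⟪x, act k z⟫ ∂haarO n = ∫ t, f t ∂zonal n := by
  have h := measurePreserving_inner_act hn hx hz
  rw [← h.map_eq, integral_map h.measurable.aemeasurable (by rwa [h.map_eq])]

lemma eq_zero_of_integral_sq_eq_zero (hn : 2 ≤ n) {f : ℝ → ℝ}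
    (hf : ContinuousOn f (Icc (-1 : ℝ) 1)) (h : ∫ t, f t ^ 2 ∂zonal n = 0) :
    ∀ t ∈ Icc (-1 : ℝ) 1, f t = 0 := by
  have hint := integrable_gegenbauer_of_continuousOn (neg_half_le hn) (hf.pow 2)
  have h0 := (integral_eq_zero_iff_of_nonneg (fun t => sq_nonneg (f t)) hint).1 h
  have h1 := absolutelyContinuous_gegenbauer (neg_half_le hn) h0
  have h2 : f =ᵐ[volume.restrict (Icc (-1 : ℝ) 1)] fun _ => 0 := by
    filter_upwards [h1] with t ht
    simpa using ht
  exact Measure.eqOn_Icc_of_ae_eq volume (by norm_num) h2 hf continuousOn_const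

lemma integral_poly_sq_pos (hn : 2 ≤ n) {q : ℝ[X]} (hq : q ≠ 0) :
    0 < ∫ t, q.eval t ^ 2 ∂zonal n := by
  refine lt_of_le_of_ne (integral_nonneg fun t => sq_nonneg _) fun h => hq ?_
  have := eq_zero_of_integral_sq_eq_zero hn q.continuous.continuousOn h.symm
  exact Polynomial.eq_zero_of_infinite_isRoot q
    ((Icc_infinite (by norm_num : (-1 : ℝ) < 1)).mono this)

/-! ### Convolution of zonal polynomials -/

/-- The convolution on the sphere of two zonal polynomials is a zonal polynomial, of degree at most
that of the first factor: in `⟨x, y⟩ = t y₀ + √(1 - t²) y₁` only even powers of `y₁` survive the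
integration over `y`. -/
lemma exists_convolution_pow (hn : 2 ≤ n) (d : ℕ) (f : ℝ[X]) :
    ∃ Q : ℝ[X], Q.natDegree ≤ d ∧ ∀ x z : E n, ‖x‖ = 1 → ‖z‖ = 1 →
      ∫ k, ⟪x, act k (pole n)⟫ ^ d * f.eval ⟪z, act k (pole n)⟫ ∂haarO n = Q.eval ⟪x, z⟫ := by
  have hp := norm_pole (n := n) (by omega)
  have hca := continuous_act_left (pole n)
  let e : E n := EuclideanSpace.single ⟨1, hn⟩ 1
  have hpe : ⟪e, pole n⟫ = 0 := by simp [e, EuclideanSpace.inner_single_left, pole]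
  let A : ℕ → ℝ := fun b => ∫ k, ⟪pole n, act k (pole n)⟫ ^ (d - b) * ⟪e, act k (pole n)⟫ ^ b *
    f.eval ⟪pole n, act k (pole n)⟫ ∂haarO n
  -- the reflection in `e^⊥` fixes the pole and changes the sign of `⟨e, y⟩`
  have hA : ∀ b, Odd b → A b = 0 := by
    intro b hb
    let U := (ℝ ∙ e)ᗮ.reflection
    have h1 : U e = -e := Submodule.reflection_orthogonalComplement_singleton_eq_neg e
    have h2 : U (pole n) = pole n := by
      apply Submodule.reflection_mem_subspace_eq_self
      rw [Submodule.mem_orthogonal_singleton_iff_inner_right, hpe]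
    have h3 : ∀ y, ⟪e, U y⟫ = -⟪e, y⟫ := fun y => by
      rw [← U.inner_map_map e y, h1, inner_neg_left, neg_neg]
    have h4 : ∀ y, ⟪pole n, U y⟫ = ⟪pole n, y⟫ := fun y => by
      conv_lhs => rw [← h2, U.inner_map_map]
    have := integral_isometry_act U (fun y => ⟪pole n, y⟫ ^ (d - b) * ⟪e, y⟫ ^ b *
      f.eval ⟪pole n, y⟫) (pole n)
    simp only [h3, h4, hb.neg_pow, mul_neg, neg_mul, integral_neg] at this
    change -A b = A b at this
    linarith
  refine ⟨∑ b ∈ Finset.range (d + 1),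
    if Even b then C (d.choose b * A b) * (X ^ (d - b) * (1 - X ^ 2) ^ (b / 2)) else 0,
    ?_, ?_⟩
  · refine natDegree_sum_le_of_forall_le _ _ fun b hb => ?_
    have hb' : b ≤ d := by
      have := Finset.mem_range.1 hb
      omega
    split_ifs with he
    · refine (natDegree_C_mul_le _ _).trans (natDegree_mul_le.trans ?_)
      have h1 : ((1 - X ^ 2 : ℝ[X]) ^ (b / 2)).natDegree ≤ b / 2 * 2 :=
        natDegree_pow_le_of_le _ ((natDegree_sub_le _ _).trans (by simp))
      rw [natDegree_X_pow]
      omega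
    · simp
  · intro x z hx hz
    set t := ⟪x, z⟫ with ht
    have htI : t ∈ Icc (-1 : ℝ) 1 := inner_mem_Icc hx.le hz.le
    have hs := Real.sq_sqrt (one_sub_sq_nonneg htI)
    obtain ⟨U, hU1, hU2⟩ := exists_isometry_pair (norm_tilted hn htI) hp hx hz
      (by rw [real_inner_comm, inner_pole_tilted (by omega)])
    rw [← integral_isometry_act U (fun y => ⟪x, y⟫ ^ d * f.eval ⟪z, y⟫) (pole n), ← hU1, ← hU2]
    simp only [U.inner_map_map]
    -- an isometry moves `(x, z)` to `(tilted t, pole)`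
    have hti : ∀ y, ⟪tilted n t, y⟫ = √(1 - t ^ 2) * ⟪e, y⟫ + t * ⟪pole n, y⟫ := by
      intro y
      rw [← real_inner_smul_left, ← real_inner_smul_left, ← inner_add_left]
      congr 1
      ext ⟨i, hi⟩
      by_cases h0 : i = 0
      · simp [tilted, pole, e, h0]
      · by_cases h1 : i = 1
        · simp [tilted, pole, e, h1]
        · simp [tilted, pole, e, h0, h1]
    simp only [hti, add_pow, Finset.sum_mul]
    rw [integral_finsetSum _ fun b _ => integrable_of_continuous_haar (by fun_prop),
      eval_finsetSum]
    refine Finset.sum_congr rfl fun b _ => ?_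
    have h5 : ∫ k, (√(1 - t ^ 2) * ⟪e, act k (pole n)⟫) ^ b *
        (t * ⟪pole n, act k (pole n)⟫) ^ (d - b) * (d.choose b) *
        f.eval ⟪pole n, act k (pole n)⟫ ∂haarO n =
        √(1 - t ^ 2) ^ b * t ^ (d - b) * d.choose b * A b := by
      rw [← integral_const_mul]
      refine integral_congr_ae (.of_forall fun k => ?_)
      simp only [mul_pow]
      ring
    rw [h5]
    split_ifs with he
    · obtain ⟨c, rfl⟩ := he
      rw [← two_mul, pow_mul, hs, Nat.mul_div_cancel_left _ (by norm_num)]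
      simp
      ring
    · rw [hA b (Nat.not_even_iff_odd.1 he)]
      simp

lemma exists_convolution (hn : 2 ≤ n) (q f : ℝ[X]) :
    ∃ Q : ℝ[X], Q.natDegree ≤ q.natDegree ∧ ∀ x z : E n, ‖x‖ = 1 → ‖z‖ = 1 →
      ∫ k, q.eval ⟪x, act k (pole n)⟫ * f.eval ⟪z, act k (pole n)⟫ ∂haarO n =
        Q.eval ⟪x, z⟫ := by
  choose Q hQd hQ using fun d => exists_convolution_pow hn d f
  have hca := continuous_act_left (pole n)
  refine ⟨∑ d ∈ Finset.range (q.natDegree + 1), C (q.coeff d) * Q d, ?_, fun x z hx hz => ?_⟩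
  · refine natDegree_sum_le_of_forall_le _ _ fun d hd => ?_
    exact (natDegree_C_mul_le _ _).trans ((hQd d).trans (Nat.lt_succ_iff.1 (Finset.mem_range.1 hd)))
  · simp only [eval_eq_sum_range (p := q), Finset.sum_mul]
    rw [integral_finsetSum _ fun b _ => integrable_of_continuous_haar (by fun_prop),
      eval_finsetSum]
    refine Finset.sum_congr rfl fun d _ => ?_
    rw [eval_mul, eval_C, ← hQ d x z hx hz, ← integral_const_mul]
    simp only [mul_assoc]

/-! ### Orthonormal polynomials -/

section Orthonormal

variable {p : ℕ → ℝ[X]}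

lemma ortho_ne_zero (hort : ∀ i j, ∫ t, (p i).eval t * (p j).eval t ∂zonal n =
    if i = j then 1 else 0) (i : ℕ) : p i ≠ 0 := by
  intro h
  simpa [h] using hort i i

lemma eq_sum_ortho (hn : 2 ≤ n) (hdeg : ∀ i, (p i).natDegree = i)
    (hort : ∀ i j, ∫ t, (p i).eval t * (p j).eval t ∂zonal n = if i = j then 1 else 0)
    (i : ℕ) (Q : ℝ[X]) (hQ : Q.natDegree ≤ i) :
    Q = ∑ j ∈ Finset.range (i + 1), C (∫ t, Q.eval t * (p j).eval t ∂zonal n) * p j := by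
  have hex : ∀ i : ℕ, ∀ Q : ℝ[X], Q.natDegree ≤ i →
      ∃ a : ℕ → ℝ, Q = ∑ j ∈ Finset.range (i + 1), C (a j) * p j := by
    intro i
    induction i with
    | zero =>
      intro Q hQ
      have h0 := ortho_ne_zero hort 0
      obtain ⟨b, hb⟩ := natDegree_eq_zero.1 (hdeg 0)
      obtain ⟨a, ha⟩ := natDegree_eq_zero.1 (Nat.le_zero.1 hQ)
      have hb0 : b ≠ 0 := by
        rintro rfl
        exact h0 (by simpa using hb.symm)
      refine ⟨fun _ => a / b, ?_⟩
      rw [← ha, Finset.sum_range_one, ← hb, ← C_mul, div_mul_cancel₀ _ hb0]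
    | succ i ih =>
      intro Q hQ
      have hl : (p (i + 1)).coeff (i + 1) ≠ 0 := by
        have := leadingCoeff_ne_zero.2 (ortho_ne_zero hort (i + 1))
        rwa [leadingCoeff, hdeg] at this
      let a := Q.coeff (i + 1) / (p (i + 1)).coeff (i + 1)
      have hd : (Q - C a * p (i + 1)).natDegree ≤ i := by
        refine Nat.lt_succ_iff.1 (Nat.lt_succ_of_le ?_)
        rw [natDegree_le_iff_coeff_eq_zero]
        intro N hN
        rcases Nat.lt_or_ge (i + 1) N with h | h
        · rw [coeff_sub, coeff_C_mul, coeff_eq_zero_of_natDegree_lt (by omega),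
            coeff_eq_zero_of_natDegree_lt (by rw [hdeg]; omega)]
          simp
        · have : N = i + 1 := by omega
          subst this
          rw [coeff_sub, coeff_C_mul, div_mul_cancel₀ _ hl, sub_self]
      obtain ⟨b, hb⟩ := ih _ hd
      refine ⟨Function.update b (i + 1) a, ?_⟩
      rw [Finset.sum_range_succ, Function.update_self, ← sub_eq_iff_eq_add, hb]
      refine Finset.sum_congr rfl fun j hj => ?_
      rw [Function.update_of_ne (Finset.mem_range.1 hj).ne]
  obtain ⟨a, ha⟩ := hex i Q hQ
  conv_lhs => rw [ha]
  refine Finset.sum_congr rfl fun j hj => ?_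
  congr 2
  rw [ha]
  simp only [eval_finsetSum, eval_mul, eval_C, Finset.sum_mul, mul_assoc]
  rw [integral_finsetSum _ fun i _ => (integrable_poly_mul hn _ _).const_mul _]
  simp only [integral_const_mul, hort, mul_ite, mul_one, mul_zero]
  rw [Finset.sum_ite_eq' _ j, if_pos hj]

lemma integral_mul_ortho_eq_zero (hn : 2 ≤ n) (hdeg : ∀ i, (p i).natDegree = i)
    (hort : ∀ i j, ∫ t, (p i).eval t * (p j).eval t ∂zonal n = if i = j then 1 else 0)
    {i : ℕ} {Q : ℝ[X]} (hQ : Q.natDegree < i) :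
    ∫ t, (p i).eval t * Q.eval t ∂zonal n = 0 := by
  rw [eq_sum_ortho hn hdeg hort _ Q le_rfl]
  simp only [eval_finsetSum, eval_mul, eval_C, Finset.mul_sum, mul_left_comm (eval _ (p i))]
  rw [integral_finsetSum _ fun i _ => (integrable_poly_mul hn _ _).const_mul _]
  refine Finset.sum_eq_zero fun j hj => ?_
  have := Finset.mem_range.1 hj
  rw [integral_const_mul, hort, if_neg (by omega), mul_zero]

/-- The Funk–Hecke formula for polynomial kernels. The convolution of `p i` and `f` has degree
at most `i`, and it is orthogonal to `p j` for `j < i` because the convolution of `f` and `p j` has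
degree at most `j`. -/
lemma funk_hecke (hn : 2 ≤ n) (hdeg : ∀ i, (p i).natDegree = i)
    (hort : ∀ i j, ∫ t, (p i).eval t * (p j).eval t ∂zonal n = if i = j then 1 else 0)
    (i : ℕ) (f : ℝ[X]) :
    ∃ c : ℝ, c * (p i).eval 1 = ∫ t, (p i).eval t * f.eval t ∂zonal n ∧
      ∀ x z : E n, ‖x‖ = 1 → ‖z‖ = 1 →
        ∫ k, (p i).eval ⟪x, act k (pole n)⟫ * f.eval ⟪z, act k (pole n)⟫ ∂haarO n =
          c * (p i).eval ⟪x, z⟫ := by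
  have hp := norm_pole (n := n) (by omega)
  have hca := continuous_act_left (pole n)
  obtain ⟨Q, hQd, hQ⟩ := exists_convolution hn (p i) f
  rw [hdeg] at hQd
  have horth : ∀ j < i, ∫ t, Q.eval t * (p j).eval t ∂zonal n = 0 := by
    intro j hj
    obtain ⟨R, hRd, hR⟩ := exists_convolution hn (p j) f
    rw [hdeg] at hRd
    rw [← integral_inner_act hn hp hp (f := fun t => Q.eval t * (p j).eval t)
      (by fun_prop)]
    have h1 : ∀ l : O n, Q.eval ⟪pole n, act l (pole n)⟫ * (p j).eval ⟪pole n, act l (pole n)⟫ =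
        ∫ k, (p i).eval ⟪pole n, act k (pole n)⟫ *
          (f.eval ⟪act k (pole n), act l (pole n)⟫ * (p j).eval ⟪pole n, act l (pole n)⟫)
            ∂haarO n := by
      intro l
      rw [← hQ _ _ hp ((norm_act l _).trans hp), ← integral_mul_const]
      refine integral_congr_ae (.of_forall fun k => ?_)
      simp only [real_inner_comm (act k (pole n)) (act l (pole n))]
      ring
    simp_rw [h1]
    rw [integral_integral_swap]
    · have h2 : ∀ k : O n, ∫ l, (p i).eval ⟪pole n, act k (pole n)⟫ *
          (f.eval ⟪act k (pole n), act l (pole n)⟫ * (p j).eval ⟪pole n, act l (pole n)⟫)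
            ∂haarO n = (fun t => (p i).eval t * R.eval t) ⟪pole n, act k (pole n)⟫ := by
        intro k
        rw [integral_const_mul]
        simp only
        rw [← hR _ _ hp ((norm_act k _).trans hp)]
        congr 1
        refine integral_congr_ae (.of_forall fun l => ?_)
        simp only
        ring
      simp_rw [h2]
      rw [integral_inner_act hn hp hp (f := fun t => (p i).eval t * R.eval t) (by fun_prop)]
      exact integral_mul_ortho_eq_zero hn hdeg hort (by omega)
    · refine Continuous.integrable_of_hasCompactSupport ?_ (HasCompactSupport.of_compactSpace _)
      simp only [Function.uncurry_def]
      fun_prop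
  have hQe : Q = C (∫ t, Q.eval t * (p i).eval t ∂zonal n) * p i := by
    conv_lhs => rw [eq_sum_ortho hn hdeg hort i Q hQd]
    rw [Finset.sum_range_succ, Finset.sum_eq_zero, zero_add]
    intro j hj
    rw [horth j (Finset.mem_range.1 hj)]
    simp
  have hc : ∀ t, Q.eval t = (∫ t, Q.eval t * (p i).eval t ∂zonal n) * (p i).eval t := fun t => by
    conv_lhs => rw [hQe]
    simp
  refine ⟨∫ t, Q.eval t * (p i).eval t ∂zonal n, ?_, fun x z hx hz => ?_⟩
  · rw [← hc, ← integral_inner_act hn hp hp (f := fun t => (p i).eval t * f.eval t) (by fun_prop),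
      hQ _ _ hp hp, real_inner_self_eq_norm_sq, hp]
    simp
  · rw [hQ x z hx hz, hc]

lemma ortho_eval_one_ne_zero (hn : 2 ≤ n) (hdeg : ∀ i, (p i).natDegree = i)
    (hort : ∀ i j, ∫ t, (p i).eval t * (p j).eval t ∂zonal n = if i = j then 1 else 0)
    (i : ℕ) : (p i).eval 1 ≠ 0 := by
  obtain ⟨c, hc, -⟩ := funk_hecke hn hdeg hort i (p i)
  rw [hort, if_pos rfl] at hc
  intro h
  simp [h] at hc

lemma reproducing (hn : 2 ≤ n) (hp : IsOrthonormalBasis (zonal n) p) (i : ℕ) {x z : E n}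
    (hx : ‖x‖ = 1) (hz : ‖z‖ = 1) :
    (p i).eval ⟪x, z⟫ = (p i).eval 1 *
      ∫ k, (p i).eval ⟪x, act k (pole n)⟫ * (p i).eval ⟪z, act k (pole n)⟫ ∂haarO n := by
  obtain ⟨c, hc, h⟩ := funk_hecke hn hp.1 hp.2.2 i (p i)
  rw [hp.2.2, if_pos rfl] at hc
  rw [h x z hx hz, ← mul_assoc, mul_comm _ c, hc, one_mul]

/-- Zonal orthonormal polynomials are positive definite on the sphere: by the reproducing property
the quadratic form is an integral of squares. -/
lemma ortho_posDef (hn : 2 ≤ n) (hp : IsOrthonormalBasis (zonal n) p) (i : ℕ) {ι : Type*}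
    (s : Finset ι) (a : ι → ℝ) (x : ι → E n) (hx : ∀ j ∈ s, ‖x j‖ = 1) :
    0 ≤ ∑ j ∈ s, ∑ l ∈ s, a j * a l * (p i).eval ⟪x j, x l⟫ := by
  have hca := continuous_act_left (pole n)
  have h : ∑ j ∈ s, ∑ l ∈ s, a j * a l * (p i).eval ⟪x j, x l⟫ =
      (p i).eval 1 * ∫ k, (∑ j ∈ s, a j * (p i).eval ⟪x j, act k (pole n)⟫) ^ 2 ∂haarO n := by
    simp only [sq, Finset.sum_mul_sum]
    rw [integral_finsetSum _ fun j _ => integrable_of_continuous_haar (by fun_prop),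
      Finset.mul_sum]
    refine Finset.sum_congr rfl fun j hj => ?_
    rw [integral_finsetSum _ fun l _ => integrable_of_continuous_haar (by fun_prop),
      Finset.mul_sum]
    refine Finset.sum_congr rfl fun l hl => ?_
    rw [reproducing hn hp i (hx j hj) (hx l hl), mul_left_comm, ← integral_const_mul]
    congr 2
    funext k
    ring
  rw [h]
  exact mul_nonneg (hp.2.1 i).le (integral_nonneg fun k => sq_nonneg _)

lemma abs_ortho_le (hn : 2 ≤ n) (hp : IsOrthonormalBasis (zonal n) p) (i : ℕ) {t : ℝ}
    (ht : t ∈ Icc (-1 : ℝ) 1) : |(p i).eval t| ≤ (p i).eval 1 := by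
  have h1 := norm_pole (n := n) (by omega)
  have h2 := norm_tilted hn ht
  have key : ∀ a : ℝ, 0 ≤ (p i).eval 1 + 2 * a * (p i).eval t + a * a * (p i).eval 1 := by
    intro a
    have := ortho_posDef hn hp i (Finset.univ : Finset (Fin 2)) ![1, a] ![pole n, tilted n t]
      (by intro j _; fin_cases j <;> simp [h1, h2])
    simp [Fin.sum_univ_two, inner_pole_tilted (n := n) (by omega), real_inner_comm (pole n),
      h1, h2] at this
    linarith
  rw [abs_le]
  constructor <;> [have := key 1; have := key (-1)] <;> linarith

lemma ortho_zero (hn : 2 ≤ n) (hp : IsOrthonormalBasis (zonal n) p) (t : ℝ) :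
    (p 0).eval t = 1 := by
  have := isProbabilityMeasure_zonal hn
  obtain ⟨b, hb⟩ := natDegree_eq_zero.1 (hp.1 0)
  have h1 := hp.2.1 0
  have h2 := hp.2.2 0 0
  rw [← hb] at h1 h2 ⊢
  simp at h1 h2 ⊢
  nlinarith

end Orthonormal

/-! ### Existence of the orthonormal basis -/

/-- Gram–Schmidt orthonormalization of the monomials in `L²(μ)`. The leading coefficients are
positive; the sign at `1` is adjusted afterwards. -/
noncomputable def gramSchmidtPoly (μ : Measure ℝ) : ℕ → ℝ[X]
  | i =>
    let q := X ^ i - ∑ j : Fin i,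
      C (∫ t, t ^ i * (gramSchmidtPoly μ j).eval t ∂μ) * gramSchmidtPoly μ j
    C (√(∫ t, q.eval t ^ 2 ∂μ))⁻¹ * q

lemma gramSchmidtPoly_spec (hn : 2 ≤ n) (i : ℕ) :
    (gramSchmidtPoly (zonal n) i).natDegree = i ∧
      ∀ j ≤ i, ∫ t, (gramSchmidtPoly (zonal n) i).eval t * (gramSchmidtPoly (zonal n) j).eval t
        ∂zonal n = if i = j then 1 else 0 := by
  induction i using Nat.strong_induction_on with
  | _ i ih =>
  set p := gramSchmidtPoly (zonal n) with hpdef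
  obtain ⟨q, hq⟩ : ∃ q : ℝ[X], q = X ^ i - ∑ j : Fin i,
      C (∫ t, t ^ i * (p j).eval t ∂zonal n) * p j := ⟨_, rfl⟩
  have hpi : p i = C (√(∫ t, q.eval t ^ 2 ∂zonal n))⁻¹ * q := by
    rw [hq, hpdef, gramSchmidtPoly]
  have hsym : ∀ j < i, ∀ k < i, ∫ t, (p j).eval t * (p k).eval t ∂zonal n =
      if j = k then 1 else 0 := by
    intro j hj k hk
    rcases le_total k j with h | h
    · exact (ih j hj).2 k h
    · simp_rw [mul_comm ((p j).eval _)]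
      rw [(ih k hk).2 j h]
      simp only [eq_comm]
  have hlow : (∑ j : Fin i, C (∫ t, t ^ i * (p j).eval t ∂zonal n) * p j).degree < (i : ℕ) := by
    rw [← mem_degreeLT]
    refine Submodule.sum_mem _ fun j _ => ?_
    rw [← smul_eq_C_mul]
    refine Submodule.smul_mem _ _ ?_
    rw [mem_degreeLT]
    refine degree_le_natDegree.trans_lt ?_
    rw [(ih j j.2).1]
    exact_mod_cast j.2
  have hdeg : q.degree = i := by
    rw [hq, degree_sub_eq_left_of_degree_lt (by rwa [degree_X_pow]), degree_X_pow]
  have hq0 : q ≠ 0 := by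
    rintro rfl
    simp at hdeg
  have hpos := integral_poly_sq_pos hn hq0
  have hqp : ∀ k < i, ∫ t, q.eval t * (p k).eval t ∂zonal n = 0 := by
    intro k hk
    rw [hq]
    simp only [eval_sub, eval_pow, eval_X, eval_finsetSum, eval_mul, eval_C, sub_mul,
      Finset.sum_mul, mul_assoc]
    rw [integral_sub, integral_finsetSum _ fun j _ => (integrable_poly_mul hn _ _).const_mul _]
    · simp only [integral_const_mul]
      rw [Finset.sum_eq_single ⟨k, hk⟩]
      · rw [hsym k hk k hk, if_pos rfl, mul_one, sub_self]
      · intro j _ hj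
        rw [hsym j j.2 k hk, if_neg, mul_zero]
        exact fun h => hj (Fin.ext h)
      · simp
    · simpa using integrable_poly_mul hn (X ^ i) (p k)
    · exact integrable_finsetSum _ fun j _ => (integrable_poly_mul hn _ _).const_mul _
  have hs := Real.sqrt_pos.2 hpos
  refine ⟨?_, fun j hj => ?_⟩
  · rw [hpi, natDegree_C_mul (by positivity), natDegree_eq_of_degree_eq_some hdeg]
  · rcases hj.eq_or_lt with rfl | hj
    · rw [if_pos rfl, hpi]
      simp only [eval_mul, eval_C]
      have : ∀ t, (√(∫ t, q.eval t ^ 2 ∂zonal n))⁻¹ * q.eval t *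
          ((√(∫ t, q.eval t ^ 2 ∂zonal n))⁻¹ * q.eval t) =
          (∫ t, q.eval t ^ 2 ∂zonal n)⁻¹ * q.eval t ^ 2 := by
        intro t
        rw [mul_mul_mul_comm, ← mul_inv, Real.mul_self_sqrt hpos.le, sq]
      simp_rw [this]
      rw [integral_const_mul, inv_mul_cancel₀ hpos.ne']
    · rw [if_neg hj.ne', hpi]
      simp only [eval_mul, eval_C, mul_assoc]
      rw [integral_const_mul, hqp j hj, mul_zero]

lemma exists_isOrthonormalBasis (hn : 2 ≤ n) : ∃ p, IsOrthonormalBasis (zonal n) p := by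
  set q := gramSchmidtPoly (zonal n)
  have hdeg : ∀ i, (q i).natDegree = i := fun i => (gramSchmidtPoly_spec hn i).1
  have hort : ∀ i j, ∫ t, (q i).eval t * (q j).eval t ∂zonal n = if i = j then 1 else 0 := by
    intro i j
    rcases le_total j i with h | h
    · exact (gramSchmidtPoly_spec hn i).2 j h
    · simp_rw [mul_comm ((q i).eval _)]
      rw [(gramSchmidtPoly_spec hn j).2 i h]
      simp only [eq_comm]
  have hne := ortho_eval_one_ne_zero hn hdeg hort
  let σ : ℕ → ℝ := fun i => SignType.sign ((q i).eval 1)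
  have hσ : ∀ i, σ i ≠ 0 := fun i => by
    rcases lt_or_gt_of_ne (hne i) with h | h <;> simp [σ, h]
  have hσσ : ∀ i, σ i * σ i = 1 := fun i => by
    rcases lt_or_gt_of_ne (hne i) with h | h <;> simp [σ, h]
  refine ⟨fun i => C (σ i) * q i, fun i => ?_, fun i => ?_, fun i j => ?_⟩
  · rw [natDegree_C_mul (hσ i), hdeg]
  · rw [eval_mul, eval_C, sign_mul_self]
    exact abs_pos.2 (hne i)
  · simp only [eval_mul, eval_C, mul_mul_mul_comm (σ i) _ (σ j)]
    rw [integral_const_mul, hort]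
    split_ifs with h
    · rw [h, hσσ, one_mul]
    · simp

/-! ### Means of positive definite zonal functions -/

/-- A positive definite zonal function has nonnegative mean: some configuration of `N` points has
`∑ H⟨x_a, x_b⟩` at most the value `N H(1) + N (N - 1) ∫ H` expected for independent points. -/
lemma integral_nonneg_of_posDef (hn : 2 ≤ n) {H : ℝ → ℝ} (hH : Integrable H (zonal n))
    (hpd : ∀ (N : ℕ) (x : Fin N → E n), (∀ j, ‖x j‖ = 1) → 0 ≤ ∑ j, ∑ l, H ⟪x j, x l⟫) :
    0 ≤ ∫ t, H t ∂zonal n := by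
  have hp := norm_pole (n := n) (by omega)
  set m := ∫ t, H t ∂zonal n
  have hex : ∀ N : ℕ, ∃ x : Fin N → E n, (∀ j, ‖x j‖ = 1) ∧
      ∑ j, ∑ l, H ⟪x j, x l⟫ ≤ N * H 1 + N * (N - 1) * m := by
    intro N
    induction N with
    | zero => exact ⟨Fin.elim0, fun j => j.elim0, by simp⟩
    | succ N ih =>
      obtain ⟨x, hx, hle⟩ := ih
      have hi : ∀ j ∈ Finset.univ, Integrable (fun k => H ⟪x j, act k (pole n)⟫) (haarO n) :=
        fun j _ => (measurePreserving_inner_act hn (hx j) hp).integrable_comp_of_integrable hH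
      -- choose the new point where its interaction with the others is at most the mean
      obtain ⟨k, hk⟩ := exists_le_integral (integrable_finsetSum Finset.univ hi)
      rw [integral_finsetSum _ hi, Finset.sum_congr rfl fun j _ =>
        integral_inner_act hn (hx j) hp hH.aestronglyMeasurable] at hk
      simp only [Finset.sum_const, Finset.card_univ, Fintype.card_fin, nsmul_eq_mul] at hk
      have hy : ‖act k (pole n)‖ = 1 := (norm_act k _).trans hp
      refine ⟨Fin.cons (act k (pole n)) x, fun j => ?_, ?_⟩
      · refine Fin.cases ?_ (fun j => ?_) j <;> simp [hy, hx]
      · simp only [Fin.sum_univ_succ, Fin.cons_zero, Fin.cons_succ, Finset.sum_add_distrib,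
          real_inner_self_eq_norm_sq, hy, fun j => real_inner_comm (x j) (act k (pole n)), one_pow]
        push_cast
        linarith
  by_contra hm
  push Not at hm
  obtain ⟨N, hN⟩ := exists_nat_gt (H 1 / (-m))
  obtain ⟨x, hx, hle⟩ := hex (N + 1)
  have h0 := (hpd _ x hx).trans hle
  push_cast at h0
  rw [div_lt_iff₀ (by linarith)] at hN
  have h1 : (0 : ℝ) < N + 1 := by positivity
  nlinarith

end SphCode

namespace SphCode

open Polynomial

variable {n : ℕ}

/-! ### Series of zonal polynomials with nonnegative coefficients -/

section Series

variable {p : ℕ → ℝ[X]} {c : ℕ → ℝ} {f : ℝ → ℝ}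

lemma abs_term_le (hn : 2 ≤ n) (hp : IsOrthonormalBasis (zonal n) p) (hc : ∀ i, 0 ≤ c i) (i : ℕ)
    {t : ℝ} (ht : t ∈ Icc (-1 : ℝ) 1) :
    ‖c i * (p i).eval t‖ ≤ c i * (p i).eval 1 := by
  rw [norm_mul, Real.norm_of_nonneg (hc i), Real.norm_eq_abs]
  exact mul_le_mul_of_nonneg_left (abs_ortho_le hn hp i ht) (hc i)

lemma series_continuousOn (hn : 2 ≤ n) (hp : IsOrthonormalBasis (zonal n) p)
    (hc : ∀ i, 0 ≤ c i) (hs : Summable fun i => c i * (p i).eval 1)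
    (hf : ∀ t ∈ Icc (-1 : ℝ) 1, HasSum (fun i => c i * (p i).eval t) (f t)) :
    ContinuousOn f (Icc (-1 : ℝ) 1) := by
  refine (continuousOn_tsum (f := fun i t => c i * (p i).eval t) (fun i => by fun_prop) hs
    fun i t ht => abs_term_le hn hp hc i ht).congr fun t ht => ?_
  exact (hf t ht).tsum_eq.symm

lemma series_coeff (hn : 2 ≤ n) (hp : IsOrthonormalBasis (zonal n) p)
    (hc : ∀ i, 0 ≤ c i) (hs : Summable fun i => c i * (p i).eval 1)
    (hf : ∀ t ∈ Icc (-1 : ℝ) 1, HasSum (fun i => c i * (p i).eval t) (f t)) (j : ℕ) :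
    ∫ t, f t * (p j).eval t ∂zonal n = c j := by
  have := isProbabilityMeasure_zonal hn
  have hi : ∀ i, Integrable (fun t => c i * (p i).eval t * (p j).eval t) (zonal n) := fun i => by
    simp only [mul_assoc]
    exact (integrable_poly_mul hn _ _).const_mul _
  have h := hasSum_integral_of_summable_integral_norm hi ?_
  · have h1 : ∫ t, f t * (p j).eval t ∂zonal n =
        ∫ t, ∑' i, c i * (p i).eval t * (p j).eval t ∂zonal n := by
      refine integral_congr_ae ?_
      filter_upwards [ae_gegenbauer_mem_Icc] with t ht
      rw [← (hf t ht).tsum_eq, tsum_mul_right]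
    rw [h1, ← h.tsum_eq]
    simp only [mul_assoc, integral_const_mul, hp.2.2]
    rw [tsum_eq_single j]
    · simp
    · intro i hi
      simp [hi]
  · refine (hs.mul_right ((p j).eval 1)).of_nonneg_of_le (fun i => by positivity) fun i => ?_
    refine (integral_mono_ae (hi i).norm (integrable_const _) ?_).trans
      (le_of_eq (by rw [integral_const, probReal_univ, one_smul]))
    filter_upwards [ae_gegenbauer_mem_Icc] with t ht
    rw [norm_mul]
    exact mul_le_mul (abs_term_le hn hp hc i ht) (abs_ortho_le hn hp j ht) (norm_nonneg _)
      (mul_nonneg (hc i) (hp.2.1 i).le)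

end Series

section Cone

variable {s : ℝ} {f : ℝ → ℝ}

lemma continuousOn_of_mem_D (hn : 2 ≤ n) (hf : f ∈ D (zonal n) s) :
    ContinuousOn f (Icc (-1 : ℝ) 1) := by
  obtain ⟨p, hp, c, hc, hc0, hs, -⟩ := hf
  exact series_continuousOn hn hp hc (hs 1 (by simp)).summable hs

lemma abs_le_of_mem_D (hn : 2 ≤ n) (hf : f ∈ D (zonal n) s) {t : ℝ}
    (ht : t ∈ Icc (-1 : ℝ) 1) : |f t| ≤ f 1 := by
  obtain ⟨p, hp, c, hc, hc0, hs, -⟩ := hf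
  have h1 := hs 1 (by simp)
  rw [← (hs t ht).tsum_eq, ← h1.tsum_eq]
  exact tsum_of_norm_bounded h1.summable.hasSum fun i => abs_term_le hn hp hc i ht

lemma integral_pos_of_mem_D (hn : 2 ≤ n) (hf : f ∈ D (zonal n) s) : 0 < ∫ t, f t ∂zonal n := by
  obtain ⟨p, hp, c, hc, hc0, hs, -⟩ := hf
  have := series_coeff hn hp hc (hs 1 (by simp)).summable hs 0
  simp only [ortho_zero hn hp, mul_one] at this
  rwa [this]

lemma integral_le_eval_one_of_mem_D (hn : 2 ≤ n) (hf : f ∈ D (zonal n) s) :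
    ∫ t, f t ∂zonal n ≤ f 1 := by
  have := isProbabilityMeasure_zonal hn
  refine (integral_mono_ae (integrable_gegenbauer_of_continuousOn (neg_half_le hn)
    (continuousOn_of_mem_D hn hf)) (integrable_const (f 1)) ?_).trans
      (le_of_eq (by rw [integral_const, probReal_univ, one_smul]))
  filter_upwards [ae_gegenbauer_mem_Icc] with t ht
  exact (le_abs_self _).trans (abs_le_of_mem_D hn hf ht)

lemma L_pos_of_mem_D (hn : 2 ≤ n) (hf : f ∈ D (zonal n) s) : 0 < L (zonal n) f :=
  div_pos ((integral_pos_of_mem_D hn hf).trans_le (integral_le_eval_one_of_mem_D hn hf))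
    (integral_pos_of_mem_D hn hf)

lemma posDef_of_mem_D (hn : 2 ≤ n) (hf : f ∈ D (zonal n) s) {ι : Type*}
    (S : Finset ι) (a : ι → ℝ) (x : ι → E n) (hx : ∀ j ∈ S, ‖x j‖ = 1) :
    0 ≤ ∑ j ∈ S, ∑ l ∈ S, a j * a l * f ⟪x j, x l⟫ := by
  obtain ⟨p, hp, c, hc, hc0, hs, -⟩ := hf
  have h : HasSum (fun i => ∑ j ∈ S, ∑ l ∈ S, a j * a l * (c i * (p i).eval ⟪x j, x l⟫))
      (∑ j ∈ S, ∑ l ∈ S, a j * a l * f ⟪x j, x l⟫) :=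
    hasSum_sum fun j hj => hasSum_sum fun l hl =>
      (hs _ (inner_mem_Icc (hx j hj).le (hx l hl).le)).mul_left _
  refine h.nonneg fun i => ?_
  simp only [mul_left_comm _ (c i), ← Finset.mul_sum]
  exact mul_nonneg (hc i) (ortho_posDef hn hp i S a x hx)

/-- The linear programming bound: compare the constant coefficient with the diagonal in the sum of
`f⟨x, y⟩` over all pairs of points of the code. -/
theorem card_le_L (hn : 2 ≤ n) {θ : ℝ} (hθ : 0 < θ) (hf : f ∈ D (zonal n) (cos θ))
    {A : Finset (E n)} (hA : IsSphericalCode θ A) : (A.card : ℝ) ≤ L (zonal n) f := by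
  have hpos := integral_pos_of_mem_D hn hf
  obtain ⟨p, hp, c, hc, hc0, hs, hneg⟩ := id hf
  have hf0 : ∫ t, f t ∂zonal n = c 0 := by
    have := series_coeff hn hp hc (hs 1 (by simp)).summable hs 0
    simpa only [ortho_zero hn hp, mul_one] using this
  rw [L, le_div_iff₀ hpos, hf0]
  rcases A.eq_empty_or_nonempty with rfl | hne
  · have := hpos.trans_le (integral_le_eval_one_of_mem_D hn hf)
    simpa using this.le
  have hcard : (0 : ℝ) < A.card := by exact_mod_cast hne.card_pos
  have hI : ∀ x ∈ A, ∀ y ∈ A, ⟪x, y⟫ ∈ Icc (-1 : ℝ) 1 := fun x hx y hy =>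
    inner_mem_Icc (hA.1 x hx).le (hA.1 y hy).le
  have hlow : (A.card : ℝ) ^ 2 * c 0 ≤ ∑ x ∈ A, ∑ y ∈ A, f ⟪x, y⟫ := by
    have h : HasSum (fun i => ∑ x ∈ A, ∑ y ∈ A, c i * (p i).eval ⟪x, y⟫)
        (∑ x ∈ A, ∑ y ∈ A, f ⟪x, y⟫) :=
      hasSum_sum fun x hx => hasSum_sum fun y hy => hs _ (hI x hx y hy)
    have h0 := le_hasSum h 0 fun i _ => ?_
    · simp only [ortho_zero hn hp, Finset.sum_const, nsmul_eq_mul, mul_one] at h0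
      linarith
    · simp only [← Finset.mul_sum]
      refine mul_nonneg (hc i) ?_
      simpa using ortho_posDef hn hp i A (fun _ => 1) id hA.1
  have hupp : ∑ x ∈ A, ∑ y ∈ A, f ⟪x, y⟫ ≤ A.card * f 1 := by
    rw [← nsmul_eq_mul, ← Finset.sum_const]
    refine Finset.sum_le_sum fun x hx => ?_
    rw [← Finset.add_sum_erase A _ hx, real_inner_self_eq_norm_sq, hA.1 x hx, one_pow]
    refine add_le_of_nonpos_right (Finset.sum_nonpos fun y hy => ?_)
    obtain ⟨hyx, hyA⟩ := Finset.mem_erase.1 hy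
    refine hneg _ ⟨(hI x hx y hyA).1, ?_⟩
    have h1 := hA.2 x hx y hyA (Ne.symm hyx)
    have h2 := cos_le_cos_of_nonneg_of_le_pi hθ.le (InnerProductGeometry.angle_le_pi x y) h1
    rwa [InnerProductGeometry.cos_angle, hA.1 x hx, hA.1 y hyA, mul_one, div_one] at h2
  refine le_of_mul_le_mul_left ?_ hcard
  linarith

theorem maxCode_le_L (hn : 2 ≤ n) {θ : ℝ} (hθ : 0 < θ) (hf : f ∈ D (zonal n) (cos θ)) :
    (maxCode n θ : ℝ≥0∞) ≤ ENNReal.ofReal (L (zonal n) f) := by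
  have h : maxCode n θ ≤ (⌊L (zonal n) f⌋₊ : ℕ∞) :=
    iSup₂_le fun A hA => by exact_mod_cast Nat.le_floor (card_le_L hn hθ hf hA)
  refine (ENat.toENNReal_mono h).trans ?_
  rw [ENat.toENNReal_coe, ← ENNReal.ofReal_natCast]
  exact ENNReal.ofReal_le_ofReal (Nat.floor_le (L_pos_of_mem_D hn hf).le)

end Cone

/-! ### Continuous positive definite zonal functions -/

/-- `H(⟨x, y⟩)` is a positive definite kernel on the unit sphere of `ℝⁿ`. -/
def ZonalPosDef (n : ℕ) (H : ℝ → ℝ) : Prop :=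
  ∀ (N : ℕ) (a : Fin N → ℝ) (x : Fin N → E n), (∀ j, ‖x j‖ = 1) →
    0 ≤ ∑ j, ∑ l, a j * a l * H ⟪x j, x l⟫

lemma ZonalPosDef.abs_le {H : ℝ → ℝ} (hH : ZonalPosDef n H) (hn : 2 ≤ n) {t : ℝ}
    (ht : t ∈ Icc (-1 : ℝ) 1) : |H t| ≤ H 1 := by
  have h1 := norm_pole (n := n) (by omega)
  have h2 := norm_tilted hn ht
  have key : ∀ a : ℝ, 0 ≤ H 1 + 2 * a * H t + a * a * H 1 := by
    intro a
    have := hH 2 ![1, a] ![pole n, tilted n t]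
      (by intro j; fin_cases j <;> simp [h1, h2])
    simp [Fin.sum_univ_two, inner_pole_tilted (n := n) (by omega), real_inner_comm (pole n),
      h1, h2] at this
    linarith
  rw [_root_.abs_le]
  constructor <;> [have := key 1; have := key (-1)] <;> linarith

section Schoenberg

variable {p : ℕ → ℝ[X]} {H : ℝ → ℝ}

/-- The coefficients of a positive definite function are nonnegative: its product with `p i` is
again positive definite, as `p i` is a convolution square. -/
lemma ZonalPosDef.coeff_nonneg (hH : ZonalPosDef n H) (hn : 2 ≤ n)
    (hc : ContinuousOn H (Icc (-1 : ℝ) 1)) (hp : IsOrthonormalBasis (zonal n) p) (i : ℕ) :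
    0 ≤ ∫ t, H t * (p i).eval t ∂zonal n := by
  have hca := continuous_act_left (pole n)
  refine integral_nonneg_of_posDef hn (integrable_gegenbauer_of_continuousOn (neg_half_le hn)
    (hc.mul (p i).continuous.continuousOn)) fun N x hx => ?_
  have h : ∑ j, ∑ l, H ⟪x j, x l⟫ * (p i).eval ⟪x j, x l⟫ = (p i).eval 1 *
      ∫ k, ∑ j, ∑ l, (p i).eval ⟪x j, act k (pole n)⟫ * (p i).eval ⟪x l, act k (pole n)⟫ *
        H ⟪x j, x l⟫ ∂haarO n := by
    rw [integral_finsetSum _ fun j _ => integrable_of_continuous_haar (by fun_prop),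
      Finset.mul_sum]
    refine Finset.sum_congr rfl fun j hj => ?_
    rw [integral_finsetSum _ fun l _ => integrable_of_continuous_haar (by fun_prop),
      Finset.mul_sum]
    refine Finset.sum_congr rfl fun l hl => ?_
    rw [reproducing hn hp i (hx j) (hx l), integral_mul_const]
    ring
  rw [h]
  exact mul_nonneg (hp.2.1 i).le (integral_nonneg fun k => hH N _ x hx)

/-- Testing against the convolution square of a polynomial `q ≥ 0` bounds the coefficients. -/
lemma ZonalPosDef.sum_coeff_le (hH : ZonalPosDef n H) (hn : 2 ≤ n)
    (hc : ContinuousOn H (Icc (-1 : ℝ) 1)) (hp : IsOrthonormalBasis (zonal n) p) (q : ℝ[X])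
    (hq : ∀ t ∈ Icc (-1 : ℝ) 1, 0 ≤ q.eval t) (N : ℕ) :
    ∑ i ∈ Finset.range N, (∫ t, (p i).eval t * q.eval t ∂zonal n) ^ 2 / (p i).eval 1 *
      (∫ t, H t * (p i).eval t ∂zonal n) ≤ H 1 * (∫ t, q.eval t ∂zonal n) ^ 2 := by
  have hpo := norm_pole (n := n) (by omega)
  have hca := continuous_act_left (pole n)
  have hw : ∀ k : O n, ‖act k (pole n)‖ = 1 := fun k => (norm_act k _).trans hpo
  obtain ⟨Q, -, hQ⟩ := exists_convolution hn q q
  have hQ0 : ∀ t ∈ Icc (-1 : ℝ) 1, 0 ≤ Q.eval t := by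
    intro t ht
    have := hQ _ _ hpo (norm_tilted hn ht)
    rw [inner_pole_tilted (by omega)] at this
    rw [← this]
    exact integral_nonneg fun k => mul_nonneg (hq _ (inner_mem_Icc hpo.le (hw k).le))
      (hq _ (inner_mem_Icc (norm_tilted hn ht).le (hw k).le))
  -- two applications of the Funk–Hecke formula
  have hQp : ∀ i, ∫ t, Q.eval t * (p i).eval t ∂zonal n =
      (∫ t, (p i).eval t * q.eval t ∂zonal n) ^ 2 / (p i).eval 1 := by
    intro i
    obtain ⟨c, hc1, hc2⟩ := funk_hecke hn hp.1 hp.2.2 i q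
    rw [← integral_inner_act hn hpo hpo (f := fun t => Q.eval t * (p i).eval t) (by fun_prop)]
    have h1 : ∀ l : O n, Q.eval ⟪pole n, act l (pole n)⟫ * (p i).eval ⟪pole n, act l (pole n)⟫ =
        ∫ k, q.eval ⟪pole n, act k (pole n)⟫ *
          ((p i).eval ⟪pole n, act l (pole n)⟫ * q.eval ⟪act k (pole n), act l (pole n)⟫)
            ∂haarO n := by
      intro l
      rw [← hQ _ _ hpo (hw l), ← integral_mul_const]
      refine integral_congr_ae (.of_forall fun k => ?_)
      simp only [real_inner_comm (act k (pole n)) (act l (pole n))]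
      ring
    simp_rw [h1]
    rw [integral_integral_swap]
    · simp_rw [integral_const_mul, hc2 _ _ hpo (hw _)]
      have h2 := integral_inner_act hn hpo hpo
        (f := fun t => q.eval t * (c * (p i).eval t)) (by fun_prop)
      rw [h2]
      have h3 : ∀ t, q.eval t * (c * (p i).eval t) = c * ((p i).eval t * q.eval t) :=
        fun t => by ring
      simp_rw [h3]
      rw [integral_const_mul, eq_div_iff (hp.2.1 i).ne', ← hc1]
      ring
    · refine Continuous.integrable_of_hasCompactSupport ?_ (HasCompactSupport.of_compactSpace _)
      simp only [Function.uncurry_def]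
      fun_prop
  have hHi : ∀ r : ℝ[X], Integrable (fun t => H t * r.eval t) (zonal n) := fun r =>
    integrable_gegenbauer_of_continuousOn (neg_half_le hn) (hc.mul r.continuous.continuousOn)
  have hsum : ∫ t, H t * Q.eval t ∂zonal n = ∑ i ∈ Finset.range (max N Q.natDegree + 1),
      (∫ t, (p i).eval t * q.eval t ∂zonal n) ^ 2 / (p i).eval 1 *
      (∫ t, H t * (p i).eval t ∂zonal n) := by
    have he := eq_sum_ortho hn hp.1 hp.2.2 (max N Q.natDegree) Q (le_max_right _ _)
    simp only [hQp] at he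
    generalize max N Q.natDegree = M at he ⊢
    rw [he]
    simp only [eval_finsetSum, eval_mul, eval_C, Finset.mul_sum, mul_left_comm (H _)]
    rw [integral_finsetSum _ fun i _ => (hHi _).const_mul _]
    simp only [integral_const_mul]
  have hone : ∫ t, Q.eval t ∂zonal n = (∫ t, q.eval t ∂zonal n) ^ 2 := by
    have := hQp 0
    simpa only [ortho_zero hn hp, mul_one, one_mul, div_one] using this
  calc _ ≤ ∑ i ∈ Finset.range (max N Q.natDegree + 1),
      (∫ t, (p i).eval t * q.eval t ∂zonal n) ^ 2 / (p i).eval 1 *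
      (∫ t, H t * (p i).eval t ∂zonal n) := by
        refine Finset.sum_le_sum_of_subset_of_nonneg
          (Finset.range_mono (by omega)) fun i _ _ => ?_
        exact mul_nonneg (div_nonneg (sq_nonneg _) (hp.2.1 i).le) (hH.coeff_nonneg hn hc hp i)
    _ = ∫ t, H t * Q.eval t ∂zonal n := hsum.symm
    _ ≤ ∫ t, H 1 * Q.eval t ∂zonal n := by
        refine integral_mono_ae (hHi Q) ((integrable_poly hn Q).const_mul _) ?_
        filter_upwards [ae_gegenbauer_mem_Icc] with t ht
        exact mul_le_mul_of_nonneg_right ((le_abs_self _).trans (hH.abs_le hn ht)) (hQ0 t ht)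
    _ = _ := by rw [integral_const_mul, hone]

open Filter Topology in
/-- The polynomials `((1 + t) / 2) ^ k` concentrate at `t = 1`. -/
lemma tendsto_peak (hn : 2 ≤ n) (r : ℝ[X]) :
    Tendsto (fun k : ℕ => (∫ t, r.eval t * (((C (1 / 2) * (1 + X)) ^ k : ℝ[X])).eval t ∂zonal n) /
      ∫ t, (((C (1 / 2) * (1 + X)) ^ k : ℝ[X])).eval t ∂zonal n) atTop (𝓝 (r.eval 1)) := by
  have := isProbabilityMeasure_zonal hn
  have hr : (zonal n).restrict (Icc (-1 : ℝ) 1) = zonal n :=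
    Measure.restrict_eq_self_of_ae_mem ae_gegenbauer_mem_Icc
  have h := tendsto_setIntegral_pow_smul_of_unique_maximum_of_isCompact_of_measure_nhdsWithin_pos
    (μ := zonal n) (s := Icc (-1 : ℝ) 1) (x₀ := 1) (c := fun t => 1 / 2 * (1 + t))
    (g := fun t => r.eval t) isCompact_Icc ?_ (by fun_prop) ?_ ?_ (by norm_num) (by norm_num)
    (integrable_poly hn r).integrableOn r.continuous.continuousWithinAt
  · rw [hr] at h
    refine h.congr fun k => ?_
    simp only [eval_pow, eval_mul, eval_C, eval_add, eval_one, eval_X, smul_eq_mul]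
    rw [inv_mul_eq_div]
    simp only [mul_comm]
  · intro u hu h1
    obtain ⟨ε, hε, hεu⟩ := Metric.isOpen_iff.1 hu 1 h1
    rw [pos_iff_ne_zero]
    intro h0
    have h2 := absolutelyContinuous_gegenbauer (neg_half_le hn) h0
    rw [Measure.restrict_apply' measurableSet_Icc, inter_assoc, inter_self] at h2
    have h3 : Ioo (max (-1) (1 - ε)) 1 ⊆ u ∩ Icc (-1 : ℝ) 1 := by
      intro t ht
      have h4 := max_lt_iff.1 ht.1
      refine ⟨hεu ?_, h4.1.le, ht.2.le⟩
      rw [Metric.mem_ball, Real.dist_eq, abs_lt]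
      constructor <;> linarith [ht.2]
    have h5 := measure_mono_null h3 h2
    rw [Real.volume_Ioo, ENNReal.ofReal_eq_zero, sub_nonpos] at h5
    have : max (-1) (1 - ε) < 1 := max_lt (by norm_num) (by linarith)
    linarith
  · intro y hy hne
    have := lt_of_le_of_ne hy.2 hne
    linarith
  · intro y hy
    have := hy.1
    linarith

open Filter Topology in
/-- Schoenberg's theorem: a continuous positive definite zonal function is, at every point, the
sum of its expansion in zonal polynomials, and the coefficients are nonnegative. -/
theorem ZonalPosDef.hasSum (hH : ZonalPosDef n H) (hn : 2 ≤ n)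
    (hc : ContinuousOn H (Icc (-1 : ℝ) 1)) (hp : IsOrthonormalBasis (zonal n) p) {t : ℝ}
    (ht : t ∈ Icc (-1 : ℝ) 1) :
    HasSum (fun i => (∫ u, H u * (p i).eval u ∂zonal n) * (p i).eval t) (H t) := by
  have := isProbabilityMeasure_zonal hn
  set c : ℕ → ℝ := fun i => ∫ u, H u * (p i).eval u ∂zonal n with hcdef
  have hc0 : ∀ i, 0 ≤ c i := hH.coeff_nonneg hn hc hp
  -- test against the peaked polynomials `q k` and let `k` tend to infinity
  have hbound : ∀ N, ∑ i ∈ Finset.range N, c i * (p i).eval 1 ≤ H 1 := by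
    intro N
    let q : ℕ → ℝ[X] := fun k => (C (1 / 2) * (1 + X)) ^ k
    have hq : ∀ k, ∀ t ∈ Icc (-1 : ℝ) 1, 0 ≤ (q k).eval t := by
      intro k t ht
      simp only [q, eval_pow, eval_mul, eval_C, eval_add, eval_one, eval_X]
      have := ht.1
      exact pow_nonneg (by linarith) k
    have hq0 : ∀ k, 0 ≤ ∫ t, (q k).eval t ∂zonal n := fun k =>
      integral_nonneg_of_ae (by filter_upwards [ae_gegenbauer_mem_Icc] with t ht using hq k t ht)
    have hlim : Tendsto (fun k => ∑ i ∈ Finset.range N,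
        ((∫ t, (p i).eval t * (q k).eval t ∂zonal n) / ∫ t, (q k).eval t ∂zonal n) ^ 2 /
          (p i).eval 1 * c i) atTop
        (𝓝 (∑ i ∈ Finset.range N, ((p i).eval 1) ^ 2 / (p i).eval 1 * c i)) :=
      tendsto_finsetSum _ fun i _ => (((tendsto_peak hn (p i)).pow 2).div_const _).mul_const _
    have hH1 : 0 ≤ H 1 := (abs_nonneg _).trans (hH.abs_le hn (t := 1) (by simp))
    have hle : ∀ k, ∑ i ∈ Finset.range N,
        ((∫ t, (p i).eval t * (q k).eval t ∂zonal n) / ∫ t, (q k).eval t ∂zonal n) ^ 2 /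
          (p i).eval 1 * c i ≤ H 1 := by
      intro k
      have h1 := hH.sum_coeff_le hn hc hp (q k) (hq k) N
      -- if the mean of `q k` vanished, the quotients would be `0` by convention
      rcases (hq0 k).eq_or_lt with h0 | h0
      · rw [← h0]
        simpa using hH1
      · rw [← div_le_iff₀ (by positivity), Finset.sum_div] at h1
        refine (le_of_eq (Finset.sum_congr rfl fun i _ => ?_)).trans h1
        rw [div_pow]
        ring
    have := le_of_tendsto' hlim hle
    refine (le_of_eq (Finset.sum_congr rfl fun i _ => ?_)).trans this
    rw [sq, mul_div_assoc, div_self (hp.2.1 i).ne', mul_one, mul_comm]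
  have hs : Summable fun i => c i * (p i).eval 1 :=
    summable_of_sum_range_le (fun i => mul_nonneg (hc0 i) (hp.2.1 i).le) hbound
  -- the sum `G` of the expansion is continuous, and `H - G` is orthogonal to all polynomials
  let G : ℝ → ℝ := fun t => ∑' i, c i * (p i).eval t
  have hG : ∀ t ∈ Icc (-1 : ℝ) 1, HasSum (fun i => c i * (p i).eval t) (G t) := fun t ht =>
    (Summable.of_norm_bounded hs fun i => abs_term_le hn hp hc0 i ht).hasSum
  have hGc := series_continuousOn hn hp hc0 hs hG
  have hd : ContinuousOn (fun t => H t - G t) (Icc (-1 : ℝ) 1) := hc.sub hGc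
  have hint : ∀ f : ℝ → ℝ, ContinuousOn f (Icc (-1 : ℝ) 1) → Integrable f (zonal n) := fun f hf =>
    integrable_gegenbauer_of_continuousOn (neg_half_le hn) hf
  have hdr : ∀ r : ℝ[X], Integrable (fun t => (H t - G t) * r.eval t) (zonal n) := fun r =>
    hint _ (hd.mul r.continuous.continuousOn)
  have hd2 : Integrable (fun t => (H t - G t) ^ 2) (zonal n) := hint _ (hd.pow 2)
  have horth : ∀ r : ℝ[X], ∫ t, (H t - G t) * r.eval t ∂zonal n = 0 := by
    intro r
    rw [eq_sum_ortho hn hp.1 hp.2.2 _ r le_rfl]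
    simp only [eval_finsetSum, eval_mul, eval_C, Finset.mul_sum, mul_left_comm (H _ - G _)]
    rw [integral_finsetSum _ fun i _ => (hdr (p i)).const_mul _]
    refine Finset.sum_eq_zero fun i _ => ?_
    have h1 : Integrable (fun t => H t * (p i).eval t) (zonal n) :=
      hint _ (hc.mul (p i).continuous.continuousOn)
    have h2 : Integrable (fun t => G t * (p i).eval t) (zonal n) :=
      hint _ (hGc.mul (p i).continuous.continuousOn)
    rw [integral_const_mul]
    simp only [sub_mul]
    rw [integral_sub h1 h2, series_coeff hn hp hc0 hs hG, sub_self, mul_zero]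
  -- hence `H = G`, by Weierstrass approximation of `H - G`
  have hsq : ∫ t, (H t - G t) ^ 2 ∂zonal n = 0 := by
    refine le_antisymm (le_of_forall_pos_le_add fun ε hε => ?_)
      (integral_nonneg fun t => sq_nonneg _)
    obtain ⟨M, hM⟩ := isCompact_Icc.exists_bound_of_continuousOn hd
    have hM0 : 0 ≤ M := (norm_nonneg _).trans (hM 1 (by simp))
    obtain ⟨r, hr⟩ := exists_polynomial_near_of_continuousOn (-1) 1 _ hd (ε / (M + 1))
      (by positivity)
    have h1 : ∫ t, (H t - G t) ^ 2 ∂zonal n =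
        ∫ t, (H t - G t) * ((H t - G t) - r.eval t) ∂zonal n := by
      rw [← sub_zero (∫ t, (H t - G t) ^ 2 ∂zonal n), ← horth r,
        ← integral_sub hd2 (hdr r)]
      congr 1
      funext t
      ring
    rw [h1, zero_add]
    refine (integral_mono_ae (hint _ (hd.mul (hd.sub r.continuous.continuousOn)))
      (integrable_const ε) ?_).trans (le_of_eq (by rw [integral_const, probReal_univ, one_smul]))
    filter_upwards [ae_gegenbauer_mem_Icc] with t ht
    have h2 := hr t ht
    rw [abs_sub_comm] at h2
    calc (H t - G t) * (H t - G t - r.eval t)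
        ≤ |H t - G t| * |H t - G t - r.eval t| := by rw [← abs_mul]; exact le_abs_self _
      _ ≤ M * (ε / (M + 1)) := mul_le_mul (hM t ht) h2.le (abs_nonneg _) hM0
      _ ≤ ε := by
        rw [mul_div_assoc', div_le_iff₀ (by positivity)]
        nlinarith
  have h0 := eq_zero_of_integral_sq_eq_zero hn hd hsq t ht
  rw [sub_eq_zero.1 h0]
  exact hG t ht

end Schoenberg

end SphCode

namespace SphCode

open Module

variable {n m : ℕ}

/-! ### Projection to the tangent space -/

section Tilde

variable {x y z : E n}

lemma norm_sub_proj_sq (hx : ‖x‖ = 1) (hz : ‖z‖ = 1) :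
    ‖x - ⟪x, z⟫ • z‖ ^ 2 = 1 - ⟪x, z⟫ ^ 2 := by
  rw [norm_sub_sq_real, inner_smul_right, norm_smul, hx, hz, Real.norm_eq_abs, mul_one, sq_abs]
  ring

lemma norm_sub_proj (hx : ‖x‖ = 1) (hz : ‖z‖ = 1) :
    ‖x - ⟪x, z⟫ • z‖ = √(1 - ⟪x, z⟫ ^ 2) := by
  rw [← norm_sub_proj_sq hx hz, Real.sqrt_sq (norm_nonneg _)]

lemma norm_sub_proj_pos (hx : ‖x‖ = 1) (hz : ‖z‖ = 1) (h : ⟪x, z⟫ ∈ Ioo (-1 : ℝ) 1) :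
    0 < ‖x - ⟪x, z⟫ • z‖ := by
  rw [norm_sub_proj hx hz]
  exact Real.sqrt_pos.2 (one_sub_sq_pos h)

lemma norm_tilde_le (z x : E n) : ‖tilde z x‖ ≤ 1 := by
  rw [tilde, norm_smul, norm_inv, norm_norm]
  exact inv_mul_le_one

lemma norm_tilde (hx : ‖x‖ = 1) (hz : ‖z‖ = 1) (h : ⟪x, z⟫ ∈ Ioo (-1 : ℝ) 1) :
    ‖tilde z x‖ = 1 := by
  rw [tilde, norm_smul, norm_inv, norm_norm, inv_mul_cancel₀ (norm_sub_proj_pos hx hz h).ne']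

lemma inner_tilde_self (hz : ‖z‖ = 1) (x : E n) : ⟪tilde z x, z⟫ = 0 := by
  rw [tilde, real_inner_smul_left, inner_sub_left, real_inner_smul_left,
    real_inner_self_eq_norm_sq, hz]
  ring

lemma inner_tilde_mem (z x y : E n) : ⟪tilde z x, tilde z y⟫ ∈ Icc (-1 : ℝ) 1 :=
  inner_mem_Icc (norm_tilde_le z x) (norm_tilde_le z y)

/-- The spherical law of cosines. -/
lemma inner_tilde_tilde (hx : ‖x‖ = 1) (hy : ‖y‖ = 1) (hz : ‖z‖ = 1) :
    ⟪tilde z x, tilde z y⟫ =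
      (⟪x, y⟫ - ⟪x, z⟫ * ⟪y, z⟫) / (√(1 - ⟪x, z⟫ ^ 2) * √(1 - ⟪y, z⟫ ^ 2)) := by
  have : ⟪x - ⟪x, z⟫ • z, y - ⟪y, z⟫ • z⟫ = ⟪x, y⟫ - ⟪x, z⟫ * ⟪y, z⟫ := by
    simp only [inner_sub_left, inner_sub_right, real_inner_smul_left, inner_smul_right,
      real_inner_self_eq_norm_sq, hz, real_inner_comm y z]
    ring
  rw [tilde, tilde, real_inner_smul_left, inner_smul_right, this, norm_sub_proj hx hz,
    norm_sub_proj hy hz, div_eq_inv_mul, mul_inv, mul_assoc]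

lemma measurable_tilde_pair {X : Type*} [MeasurableSpace X] {f g : X → E n} (hf : Measurable f)
    (hg : Measurable g) : Measurable fun a => tilde (f a) (g a) := by
  have : Measurable fun a => g a - ⟪g a, f a⟫ • f a :=
    hg.sub (Measurable.smul (f := fun a => ⟪g a, f a⟫) (hg.inner hf) hf)
  exact this.norm.inv.smul this

end Tilde

lemma measurable_inner_pair {X V : Type*} [MeasurableSpace X] [NormedAddCommGroup V]
    [InnerProductSpace ℝ V] [MeasurableSpace V] [BorelSpace V] [SecondCountableTopology V]
    {f g : X → V} (hf : Measurable f) (hg : Measurable g) : Measurable fun x => ⟪f x, g x⟫ :=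
  hf.inner hg

/-! ### Integrability of the three-point function -/

section ThreePoint

variable {F g : ℝ → ℝ} {s' : ℝ}

lemma exists_extension (hn : 2 ≤ n) (hg : g ∈ D (zonal n) s') :
    ∃ G : ℝ → ℝ, Continuous G ∧ (∀ t ∈ Icc (-1 : ℝ) 1, g t = G t) ∧ ∀ t, |G t| ≤ g 1 := by
  refine ⟨IccExtend (by norm_num : (-1 : ℝ) ≤ 1) ((Icc (-1 : ℝ) 1).domRestrict g),
    (continuousOn_of_mem_D hn hg).domRestrict.Icc_extend', fun t ht => ?_, fun t => ?_⟩
  · rw [IccExtend_of_mem _ _ ht, domRestrict_apply]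
  · exact abs_le_of_mem_D hn hg (projIcc (-1 : ℝ) 1 (by norm_num) t).2

lemma eval_one_pos_of_mem_D (hn : 2 ≤ n) (hg : g ∈ D (zonal n) s') : 0 < g 1 :=
  (integral_pos_of_mem_D hn hg).trans_le (integral_le_eval_one_of_mem_D hn hg)

lemma threePoint_congr {G : ℝ → ℝ} (h : ∀ t ∈ Icc (-1 : ℝ) 1, g t = G t) (x y z : E n) :
    threePoint F g x y z = threePoint F G x y z := by
  rw [threePoint, threePoint, h _ (inner_tilde_mem z x y)]

lemma memLp_inner_act (hn : 2 ≤ n) (hF : MemLp F 2 (zonal n)) {x z : E n} (hx : ‖x‖ = 1)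
    (hz : ‖z‖ = 1) : MemLp (fun k => F ⟪x, act k z⟫) 2 (haarO n) :=
  hF.comp_measurePreserving (measurePreserving_inner_act hn hx hz)

lemma integrable_threePoint (hn : 2 ≤ n) (hm : 2 ≤ m) (hF : MemLp F 2 (zonal n))
    (hg : g ∈ D (zonal m) s') {x y z : E n} (hx : ‖x‖ = 1) (hy : ‖y‖ = 1) (hz : ‖z‖ = 1) :
    Integrable (fun k => threePoint F g x y (act k z)) (haarO n) := by
  obtain ⟨G, hG, hgG, hGb⟩ := exists_extension hm hg
  simp only [threePoint_congr hgG]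
  have h2 : Integrable (fun k => F ⟪x, act k z⟫ * F ⟪y, act k z⟫) (haarO n) :=
    (memLp_inner_act hn hF hx hz).integrable_mul (memLp_inner_act hn hF hy hz)
  refine Integrable.mul_bdd (c := g 1) h2 ?_ (.of_forall fun k => hGb _)
  have h1 : ∀ w : E n, Measurable fun k => tilde (act k z) w := fun w =>
    measurable_tilde_pair (continuous_act_left z).measurable measurable_const
  have h3 := measurable_inner_pair (h1 x) (h1 y)
  exact (hG.measurable.comp h3).aestronglyMeasurable

lemma ae_inner_act_mem_Ioo (hn : 2 ≤ n) {x z : E n} (hx : ‖x‖ = 1) (hz : ‖z‖ = 1) :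
    ∀ᵐ k ∂haarO n, ⟪x, act k z⟫ ∈ Ioo (-1 : ℝ) 1 :=
  (measurePreserving_inner_act hn hx hz).quasiMeasurePreserving.ae ae_gegenbauer_mem_Ioo

end ThreePoint

/-! ### Properties of the averaged function -/

section Average

variable {F g : ℝ → ℝ} {s' : ℝ}

/-- Splitting off the direction of a unit vector `z` of `ℝ^{m+1}`: `J` identifies `ℝᵐ` with the
orthogonal complement of `z`, and `P` is the adjoint of `J`. -/
lemma exists_splitting {z : E (m + 1)} (hz : ‖z‖ = 1) :
    ∃ (J : E m →ₗᵢ[ℝ] E (m + 1)) (P : E (m + 1) →L[ℝ] E m), (∀ v, ⟪J v, z⟫ = 0) ∧ P z = 0 ∧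
      (∀ v, P (J v) = v) ∧ ∀ x, ⟪x, z⟫ • z + J (P x) = x := by
  have : Fact (finrank ℝ (E (m + 1)) = m + 1) := ⟨by simp⟩
  have hz0 : z ≠ 0 := norm_ne_zero_iff.1 (by rw [hz]; norm_num)
  let e : (ℝ ∙ z)ᗮ ≃ₗᵢ[ℝ] E m := (OrthonormalBasis.fromOrthogonalSpanSingleton m hz0).repr
  refine ⟨(ℝ ∙ z)ᗮ.subtypeₗᵢ.comp e.symm.toLinearIsometry,
    (e.toContinuousLinearEquiv : _ →L[ℝ] E m).comp (ℝ ∙ z)ᗮ.orthogonalProjectionOnto,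
    fun v => ?_, ?_, fun v => ?_, fun x => ?_⟩
  · exact Submodule.mem_orthogonal_singleton_iff_inner_left.1 (e.symm v).2
  · have : (ℝ ∙ z)ᗮ.orthogonalProjectionOnto z = 0 :=
      Submodule.orthogonalProjectionOnto_orthogonal_apply_eq_zero
        (Submodule.mem_span_singleton_self z)
    simp [this]
  · simp
  · have h1 := (ℝ ∙ z).starProjection_add_starProjection_orthogonal x
    rw [Submodule.starProjection_unit_singleton ℝ hz, real_inner_comm] at h1
    conv_rhs => rw [← h1]
    simp

/-- The average is positive definite: for almost every `z`, the three-point function is, up to the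
factors `F⟨x, z⟩`, the positive definite kernel `g` on the unit sphere of the orthogonal complement
of `z`. -/
theorem zonalPosDef_h (hm : 2 ≤ m) (hF : MemLp F 2 (zonal (m + 1))) (hg : g ∈ D (zonal m) s') :
    ZonalPosDef (m + 1) (h (m + 1) F g) := by
  intro N a x hx
  have hn : 2 ≤ m + 1 := by omega
  have hp := norm_pole (n := m + 1) (by omega)
  have hi := fun j l => integrable_threePoint hn hm hF hg (hx j) (hx l) hp
  have h1 : ∑ j, ∑ l, a j * a l * h (m + 1) F g ⟪x j, x l⟫ =
      ∫ k, ∑ j, ∑ l, a j * a l * threePoint F g (x j) (x l) (act k (pole (m + 1)))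
        ∂haarO (m + 1) := by
    rw [integral_finsetSum _ fun j _ => integrable_finsetSum _ fun l _ => (hi j l).const_mul _]
    refine Finset.sum_congr rfl fun j _ => ?_
    rw [integral_finsetSum _ fun l _ => (hi j l).const_mul _]
    refine Finset.sum_congr rfl fun l _ => ?_
    rw [integral_const_mul, ← pairAvg_eq_h hn F g (hx j) (hx l) hp, pairAvg]
  rw [h1]
  refine integral_nonneg_of_ae ?_
  filter_upwards [ae_all_iff.2 fun j => ae_inner_act_mem_Ioo hn (hx j) hp] with k hk
  set z := act k (pole (m + 1))
  have hz : ‖z‖ = 1 := (norm_act k _).trans hp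
  obtain ⟨J, P, -, -, -, hJP⟩ := exists_splitting hz
  -- the directions `x̃ⱼ` lie on the unit sphere of `z^⊥`, identified with that of `ℝᵐ`
  have hfac : ∀ y, J (P (tilde z y)) = tilde z y := fun y => by
    have := hJP (tilde z y)
    rwa [inner_tilde_self hz, zero_smul, zero_add] at this
  have hv := posDef_of_mem_D hm hg Finset.univ (fun j => a j * F ⟪x j, z⟫)
    (fun j => P (tilde z (x j))) fun j _ => by
      rw [← J.norm_map, hfac, norm_tilde (hx j) hz (hk j)]
  change (0 : ℝ) ≤ ∑ j, ∑ l, a j * a l * threePoint F g (x j) (x l) z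
  convert hv using 1
  refine Finset.sum_congr rfl fun j _ => Finset.sum_congr rfl fun l _ => ?_
  rw [← J.inner_map_map, hfac, hfac, threePoint]
  ring

lemma h_eval_one (hm : 2 ≤ m) (hF : MemLp F 2 (zonal (m + 1))) :
    h (m + 1) F g 1 = g 1 * ∫ u, F u ^ 2 ∂zonal (m + 1) := by
  have hn : 2 ≤ m + 1 := by omega
  have hp := norm_pole (n := m + 1) (by omega)
  have h0 : AEStronglyMeasurable (fun u => F u ^ 2) (zonal (m + 1)) :=
    hF.aestronglyMeasurable.pow 2
  have h1 := integral_inner_act hn hp hp h0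
  rw [h, pairAvg, tilted_one, ← h1, ← integral_const_mul]
  refine integral_congr_ae ?_
  filter_upwards [ae_inner_act_mem_Ioo hn hp hp] with k hk
  rw [threePoint, real_inner_self_eq_norm_sq, norm_tilde hp ((norm_act k _).trans hp) hk, one_pow]
  ring

/-- Conditionally on `⟨y, z⟩`, for `y` uniform on the sphere, `ỹ` is uniform on the unit sphere of
the complement of `z`: this follows by averaging over the stabilizer of `z`. -/
lemma integral_fiber (hm : 2 ≤ m) (hF : Integrable F (zonal (m + 1)))
    (hg : g ∈ D (zonal m) s') {w z : E (m + 1)} (hw : ‖w‖ = 1) (hz : ‖z‖ = 1)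
    (hwz : ⟪w, z⟫ = 0) :
    ∫ k, F ⟪z, act k (pole (m + 1))⟫ * g ⟪w, tilde z (act k (pole (m + 1)))⟫ ∂haarO (m + 1) =
      (∫ u, F u ∂zonal (m + 1)) * ∫ t, g t ∂zonal m := by
  have hn : 2 ≤ m + 1 := by omega
  have hp := norm_pole (n := m + 1) (by omega)
  obtain ⟨G, hG, hgG, hGb⟩ := exists_extension hm hg
  obtain ⟨J, P, hJz, hPz, hPJ, hJP⟩ := exists_splitting hz
  have hfac : ∀ x, ⟪x, z⟫ = 0 → J (P x) = x := fun x hx => by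
    have := hJP x
    rwa [hx, zero_smul, zero_add] at this
  have hJw := hfac w hwz
  have hPw : ‖P w‖ = 1 := by rw [← J.norm_map, hJw, hw]
  have hnorm : ∀ (a : ℝ) (v : E m), ‖a • z + J v‖ ^ 2 = a ^ 2 + ‖v‖ ^ 2 := fun a v => by
    rw [norm_add_sq_real, real_inner_smul_left, real_inner_comm, hJz, norm_smul, hz, J.norm_map,
      Real.norm_eq_abs, mul_one, sq_abs]
    ring
  -- the isometry fixing `z` and acting as `l` on its complement
  have hU : ∀ l : O m, ∃ U : E (m + 1) ≃ₗᵢ[ℝ] E (m + 1), U z = z ∧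
      ∀ x, ⟪x, z⟫ = 0 → U x = J (act l (P x)) := by
    intro l
    let T : E (m + 1) →ₗ[ℝ] E (m + 1) :=
      LinearMap.toSpanSingleton ℝ _ z ∘ₗ (innerₛₗ ℝ z) +
        J.toLinearMap ∘ₗ (actIso l).toLinearEquiv.toLinearMap ∘ₗ P.toLinearMap
    have hT : ∀ x, T x = ⟪x, z⟫ • z + J (act l (P x)) := fun x => by
      simp [T, real_inner_comm]
    have hTn : ∀ x, ‖T x‖ = ‖x‖ := fun x => by
      rw [← sq_eq_sq₀ (norm_nonneg _) (norm_nonneg _), hT, hnorm, norm_act]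
      conv_rhs => rw [← hJP x, hnorm]
    refine ⟨LinearIsometry.toLinearIsometryEquiv ⟨T, hTn⟩ rfl, ?_, fun x hx => ?_⟩
    · change T z = z
      rw [hT, hPz, real_inner_self_eq_norm_sq, hz]
      simp [act]
    · change T x = _
      rw [hT, hx, zero_smul, zero_add]
  let Ψ : O m → O (m + 1) → ℝ := fun l k => F ⟪z, act k (pole (m + 1))⟫ *
    G ⟪P w, act l (P (tilde z (act k (pole (m + 1)))))⟫
  have hinv : ∀ l : O m, ∫ k, F ⟪z, act k (pole (m + 1))⟫ *
      g ⟪w, tilde z (act k (pole (m + 1)))⟫ ∂haarO (m + 1) = ∫ k, Ψ l k ∂haarO (m + 1) := by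
    intro l
    obtain ⟨U, hUz, hUx⟩ := hU l
    rw [← integral_isometry_act U (fun y => F ⟪z, y⟫ * g ⟪w, tilde z y⟫)]
    refine integral_congr_ae (.of_forall fun k => ?_)
    set y := act k (pole (m + 1)) with hy
    have h1 : tilde z (U y) = J (act l (P (tilde z y))) := by
      rw [← hUx _ (inner_tilde_self hz y), ← tilde_isometry, hUz]
    have h2 : ⟪z, U y⟫ = ⟪z, y⟫ := by rw [← U.inner_map_map z y, hUz]
    have h3 : ⟪w, J (act l (P (tilde z y)))⟫ = ⟪P w, act l (P (tilde z y))⟫ := by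
      conv_lhs => rw [← hJw]
      rw [J.inner_map_map]
    simp only [Ψ, ← hy, h2, h1, h3]
    rw [hgG]
    refine inner_mem_Icc hPw.le ?_
    rw [norm_act, ← J.norm_map, hfac _ (inner_tilde_self hz y)]
    exact norm_tilde_le _ _
  have hti : Measurable fun k : O (m + 1) => tilde z (act k (pole (m + 1))) :=
    measurable_tilde_pair measurable_const (continuous_act_left _).measurable
  have hFi : Integrable (fun k => F ⟪z, act k (pole (m + 1))⟫) (haarO (m + 1)) :=
    (measurePreserving_inner_act hn hz hp).integrable_comp_of_integrable hF
  have hΨ : Integrable (Function.uncurry Ψ) ((haarO m).prod (haarO (m + 1))) := by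
    refine (hFi.comp_snd (haarO m)).mul_bdd (c := g 1) ?_ (.of_forall fun k => hGb _)
    have h1 : Measurable fun q : O m × O (m + 1) =>
        act q.1 (P (tilde z (act q.2 (pole (m + 1))))) :=
      continuous_act.measurable.comp
        (measurable_fst.prodMk (P.continuous.measurable.comp (hti.comp measurable_snd)))
    have h2 := measurable_inner_pair (measurable_const (a := P w)) h1
    exact (hG.measurable.comp h2).aestronglyMeasurable
  calc _ = ∫ _ : O m, ∫ k, F ⟪z, act k (pole (m + 1))⟫ *
        g ⟪w, tilde z (act k (pole (m + 1)))⟫ ∂haarO (m + 1) ∂haarO m := by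
        rw [integral_const, probReal_univ, one_smul]
    _ = ∫ l, ∫ k, Ψ l k ∂haarO (m + 1) ∂haarO m :=
        integral_congr_ae (.of_forall hinv)
    _ = ∫ k, ∫ l, Ψ l k ∂haarO m ∂haarO (m + 1) := integral_integral_swap hΨ
    _ = ∫ k, F ⟪z, act k (pole (m + 1))⟫ * ∫ t, g t ∂zonal m ∂haarO (m + 1) := by
        refine integral_congr_ae ?_
        filter_upwards [ae_inner_act_mem_Ioo hn hz hp] with k hk
        set y := act k (pole (m + 1)) with hy
        have hy1 : ‖y‖ = 1 := (norm_act k _).trans hp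
        have hPy : ‖P (tilde z y)‖ = 1 := by
          rw [← J.norm_map, hfac _ (inner_tilde_self hz y), norm_tilde hy1 hz
            (by rwa [real_inner_comm])]
        change ∫ l, F ⟪z, y⟫ * G ⟪P w, act l (P (tilde z y))⟫ ∂haarO m = _
        rw [integral_const_mul, integral_act_congr (fun v => G ⟪P w, v⟫) hPy
          (norm_pole (by omega)), integral_inner_act hm hPw (norm_pole (by omega))
          hG.aestronglyMeasurable]
        congr 1
        refine integral_congr_ae ?_
        filter_upwards [ae_gegenbauer_mem_Icc] with t ht using (hgG t ht).symm
    _ = _ := by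
        rw [integral_mul_const, integral_inner_act hn hz hp hF.aestronglyMeasurable]

/-- Fubini: the mean of the average is the product of the means. -/
theorem integral_h (hm : 2 ≤ m) (hF : MemLp F 2 (zonal (m + 1))) (hg : g ∈ D (zonal m) s')
    (hc : ContinuousOn (h (m + 1) F g) (Icc (-1 : ℝ) 1)) :
    ∫ t, h (m + 1) F g t ∂zonal (m + 1) =
      (∫ t, g t ∂zonal m) * (∫ u, F u ∂zonal (m + 1)) ^ 2 := by
  have hn : 2 ≤ m + 1 := by omega
  have hp := norm_pole (n := m + 1) (by omega)
  have := isProbabilityMeasure_zonal hn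
  have hw : ∀ k : O (m + 1), ‖act k (pole (m + 1))‖ = 1 := fun k => (norm_act k _).trans hp
  have hF1 : Integrable F (zonal (m + 1)) := hF.integrable (by norm_num)
  obtain ⟨G, hG, hgG, hGb⟩ := exists_extension hm hg
  -- two independent points; needed only for integrability on the product
  have hpair : MeasurePreserving
      (fun q : O (m + 1) × O (m + 1) => ⟪act q.1 (pole (m + 1)), act q.2 (pole (m + 1))⟫)
      ((haarO (m + 1)).prod (haarO (m + 1))) (zonal (m + 1)) := by
    have hmeas : Measurable
        (fun q : O (m + 1) × O (m + 1) => ⟪act q.1 (pole (m + 1)), act q.2 (pole (m + 1))⟫) := by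
      have := continuous_act_left (pole (m + 1))
      apply Continuous.measurable
      fun_prop
    refine ⟨hmeas, ?_⟩
    ext S hS
    rw [Measure.map_apply hmeas hS, Measure.prod_apply (hmeas hS)]
    have h1 : ∀ k : O (m + 1), haarO (m + 1) (Prod.mk k ⁻¹' ((fun q : O (m + 1) × O (m + 1) =>
        ⟪act q.1 (pole (m + 1)), act q.2 (pole (m + 1))⟫) ⁻¹' S)) = zonal (m + 1) S := fun k =>
      (measurePreserving_inner_act hn (hw k) hp).measure_preimage hS.nullMeasurableSet
    simp [h1]
  have h0 : AEStronglyMeasurable (h (m + 1) F g) (zonal (m + 1)) :=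
    (integrable_gegenbauer_of_continuousOn (neg_half_le hn) hc).aestronglyMeasurable
  rw [← integral_inner_act hn hp hp h0]
  have h1 : ∀ k : O (m + 1), h (m + 1) F g ⟪pole (m + 1), act k (pole (m + 1))⟫ =
      ∫ l, threePoint F G (pole (m + 1)) (act k (pole (m + 1))) (act l (pole (m + 1)))
        ∂haarO (m + 1) := fun k => by
    rw [← pairAvg_eq_h hn F g hp (hw k) hp, pairAvg]
    simp only [threePoint_congr hgG]
  simp_rw [h1]
  rw [integral_integral_swap]
  · calc _ = ∫ l, F ⟪pole (m + 1), act l (pole (m + 1))⟫ *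
          ((∫ u, F u ∂zonal (m + 1)) * ∫ t, g t ∂zonal m) ∂haarO (m + 1) := by
          refine integral_congr_ae ?_
          filter_upwards [ae_inner_act_mem_Ioo hn hp hp] with l hl
          rw [← integral_fiber hm hF1 hg (norm_tilde hp (hw l) hl) (hw l)
            (inner_tilde_self (hw l) _), ← integral_const_mul]
          refine integral_congr_ae (.of_forall fun k => ?_)
          simp only [threePoint]
          rw [← hgG _ (inner_tilde_mem _ _ _), mul_assoc, real_inner_comm (act l _) (act k _)]
      _ = _ := by
          rw [integral_mul_const, integral_inner_act hn hp hp hF.aestronglyMeasurable]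
          ring
  · have h2 : MemLp (fun q : O (m + 1) × O (m + 1) =>
        F ⟪pole (m + 1), act q.2 (pole (m + 1))⟫) 2 ((haarO (m + 1)).prod (haarO (m + 1))) :=
      (memLp_inner_act hn hF hp hp).comp_snd (haarO (m + 1))
    have h3 := hF.comp_measurePreserving hpair
    refine (h2.integrable_mul h3).mul_bdd (c := g 1) ?_ (.of_forall fun k => hGb _)
    have h4 : Measurable fun q : O (m + 1) × O (m + 1) => act q.1 (pole (m + 1)) :=
      (continuous_act_left _).measurable.comp measurable_fst
    have h5 : Measurable fun q : O (m + 1) × O (m + 1) => act q.2 (pole (m + 1)) :=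
      (continuous_act_left _).measurable.comp measurable_snd
    have h6 := measurable_inner_pair
      (measurable_tilde_pair h5 (measurable_const (a := pole (m + 1))))
      (measurable_tilde_pair h5 h4)
    exact (hG.measurable.comp h6).aestronglyMeasurable

/-! ### Continuity of the averaged function -/

lemma continuous_tilted : Continuous (tilted n) := by
  refine (PiLp.continuous_toLp 2 _).comp (continuous_pi fun i => ?_)
  split_ifs <;> fun_prop

/-- For bounded continuous `F`, continuity holds by dominated convergence. -/
lemma continuousOn_h_of_bounded (hm : 2 ≤ m) (hg : g ∈ D (zonal m) s') (hF : Continuous F)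
    {B : ℝ} (hB : ∀ u, |F u| ≤ B) : ContinuousOn (h (m + 1) F g) (Icc (-1 : ℝ) 1) := by
  have hn : 2 ≤ m + 1 := by omega
  have hp := norm_pole (n := m + 1) (by omega)
  have := isProbabilityMeasure_zonal hn
  have hB0 : 0 ≤ B := (abs_nonneg _).trans (hB 0)
  have hFL : MemLp F 2 (zonal (m + 1)) :=
    MemLp.of_bound hF.aestronglyMeasurable B (.of_forall hB)
  obtain ⟨G, hG, hgG, hGb⟩ := exists_extension hm hg
  intro t₀ ht₀
  refine continuousWithinAt_of_dominated (bound := fun _ => B * B * g 1) ?_ ?_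
    (integrable_const _) ?_
  · filter_upwards [self_mem_nhdsWithin] with t ht
    exact (integrable_threePoint hn hm hFL hg hp (norm_tilted hn ht) hp).aestronglyMeasurable
  · refine .of_forall fun t => .of_forall fun k => ?_
    rw [threePoint_congr hgG, threePoint, norm_mul, norm_mul]
    exact mul_le_mul (mul_le_mul (hB _) (hB _) (norm_nonneg _) hB0) (hGb _) (norm_nonneg _)
      (by positivity)
  · filter_upwards [ae_inner_act_mem_Ioo hn (norm_tilted hn ht₀) hp] with k hk
    simp only [threePoint_congr hgG]
    have hct := continuous_tilted (n := m + 1)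
    set z := act k (pole (m + 1))
    have hne := norm_sub_proj_pos (norm_tilted hn ht₀) ((norm_act k _).trans hp) hk
    have h1 : Continuous fun t => tilted (m + 1) t - ⟪tilted (m + 1) t, z⟫ • z := by fun_prop
    have h2 : ContinuousAt (fun t => tilde z (tilted (m + 1) t)) t₀ :=
      (h1.norm.continuousAt.inv₀ hne.ne').smul h1.continuousAt
    refine ContinuousAt.continuousWithinAt ?_
    unfold threePoint
    refine ContinuousAt.mul (by fun_prop) ?_
    have h3 : ContinuousAt (fun t => ⟪tilde z (pole (m + 1)), tilde z (tilted (m + 1) t)⟫) t₀ :=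
      ContinuousAt.inner (𝕜 := ℝ) continuousAt_const h2
    exact hG.continuousAt.comp h3

/-- The average is continuous: in `L²`, approximate `F` by bounded continuous functions; the
averages then converge uniformly. -/
theorem continuousOn_h (hm : 2 ≤ m) (hF : MemLp F 2 (zonal (m + 1))) (hg : g ∈ D (zonal m) s') :
    ContinuousOn (h (m + 1) F g) (Icc (-1 : ℝ) 1) := by
  have hn : 2 ≤ m + 1 := by omega
  have hp := norm_pole (n := m + 1) (by omega)
  have := isProbabilityMeasure_zonal hn
  have hB := eval_one_pos_of_mem_D hm hg
  set B := g 1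
  obtain ⟨G, hG, hgG, hGb⟩ := exists_extension hm hg
  have hS : 0 ≤ ∫ u, F u ^ 2 ∂zonal (m + 1) := integral_nonneg fun u => sq_nonneg _
  set S := ∫ u, F u ^ 2 ∂zonal (m + 1) with hSdef
  refine continuousOn_of_uniform_approx_of_continuousOn fun u hu => ?_
  obtain ⟨ε, hε, hεu⟩ := Metric.mem_uniformity_dist.1 hu
  -- `|a b - a' b'|` is bounded by Young's inequality with weights `η`, `η⁻¹`; `η` makes the part
  -- containing `S = ‖F‖²` at most `ε / 4`, and then `δ` that containing `‖F - F'‖²`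
  let η := ε / (4 * B * (S + 1))
  have hη : 0 < η := by positivity
  let δ := ε / (4 * B * (η⁻¹ + 1))
  have hδ : 0 < δ := by positivity
  obtain ⟨F', hF', hF'L⟩ := MemLp.exists_boundedContinuous_integral_rpow_sub_le (p := 2)
    (f := F) (by norm_num) (by simpa using hF) hδ
  rw [ENNReal.ofReal_ofNat] at hF'L
  refine ⟨h (m + 1) F' g, continuousOn_h_of_bounded hm hg F'.continuous F'.norm_coe_le_norm,
    fun t ht => hεu ?_⟩
  have hx := norm_tilted hn ht
  have hD : MemLp (fun u => F u - F' u) 2 (zonal (m + 1)) := hF.sub hF'L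
  have hsq : ∀ {f : ℝ → ℝ}, MemLp f 2 (zonal (m + 1)) → ∀ {x : E (m + 1)}, ‖x‖ = 1 →
      Integrable (fun k => f ⟪x, act k (pole (m + 1))⟫ ^ 2) (haarO (m + 1)) ∧
      ∫ k, f ⟪x, act k (pole (m + 1))⟫ ^ 2 ∂haarO (m + 1) = ∫ u, f u ^ 2 ∂zonal (m + 1) :=
    fun hf x hx => ⟨(memLp_inner_act hn hf hx hp).integrable_sq,
      integral_inner_act hn hx hp (hf.aestronglyMeasurable.pow 2)⟩
  set d := ∫ u, (F u - F' u) ^ 2 ∂zonal (m + 1) with hd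
  have hdδ : d ≤ δ := by
    refine le_trans (le_of_eq ?_) hF'
    exact integral_congr_ae (.of_forall fun u => by simp)
  obtain ⟨i1, e1⟩ := hsq hF hp
  obtain ⟨i2, e2⟩ := hsq hF hx
  obtain ⟨i3, e3⟩ := hsq hD hp
  obtain ⟨i4, e4⟩ := hsq hD hx
  have j1 := integrable_threePoint hn hm hF hg hp hx hp
  have j2 := integrable_threePoint hn hm hF'L hg hp hx hp
  rw [Real.dist_eq, h, h, pairAvg, pairAvg, ← integral_sub j1 j2]
  have i12 : Integrable (fun k => F ⟪pole (m + 1), act k (pole (m + 1))⟫ ^ 2 +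
    F ⟪tilted (m + 1) t, act k (pole (m + 1))⟫ ^ 2) (haarO (m + 1)) := i1.add i2
  have i34 : Integrable (fun k => (F ⟪pole (m + 1), act k (pole (m + 1))⟫ -
      F' ⟪pole (m + 1), act k (pole (m + 1))⟫) ^ 2 +
      (F ⟪tilted (m + 1) t, act k (pole (m + 1))⟫ -
        F' ⟪tilted (m + 1) t, act k (pole (m + 1))⟫) ^ 2) (haarO (m + 1)) := i3.add i4
  let bd : O (m + 1) → ℝ := fun k => B * ((η / 2) *
    (F ⟪pole (m + 1), act k (pole (m + 1))⟫ ^ 2 + F ⟪tilted (m + 1) t, act k (pole (m + 1))⟫ ^ 2) +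
    ((η⁻¹ + 1) / 2) * ((F ⟪pole (m + 1), act k (pole (m + 1))⟫ -
      F' ⟪pole (m + 1), act k (pole (m + 1))⟫) ^ 2 +
      (F ⟪tilted (m + 1) t, act k (pole (m + 1))⟫ -
        F' ⟪tilted (m + 1) t, act k (pole (m + 1))⟫) ^ 2))
  have hbd : Integrable bd (haarO (m + 1)) :=
    ((i12.const_mul _).add (i34.const_mul _)).const_mul _
  have hbe : ∫ k, bd k ∂haarO (m + 1) = B * (η * S + (η⁻¹ + 1) * d) := by
    simp only [bd]
    rw [integral_const_mul, integral_add (i12.const_mul _) (i34.const_mul _),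
      integral_const_mul, integral_const_mul, integral_add i1 i2, integral_add i3 i4, e1, e2, e3,
      e4]
    ring
  have hle : |∫ k, (threePoint F g (pole (m + 1)) (tilted (m + 1) t) (act k (pole (m + 1))) -
      threePoint F' g (pole (m + 1)) (tilted (m + 1) t) (act k (pole (m + 1)))) ∂haarO (m + 1)| ≤
      ∫ k, bd k ∂haarO (m + 1) := by
    rw [← Real.norm_eq_abs]
    refine norm_integral_le_of_norm_le hbd (.of_forall fun k => ?_)
    rw [threePoint_congr hgG, threePoint_congr hgG]
    simp only [threePoint, bd]
    rw [← sub_mul, norm_mul, mul_comm B]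
    refine mul_le_mul ?_ (hGb _) (norm_nonneg _) (by positivity)
    generalize F ⟪pole (m + 1), act k (pole (m + 1))⟫ = a
    generalize F ⟪tilted (m + 1) t, act k (pole (m + 1))⟫ = b
    generalize F' ⟪pole (m + 1), act k (pole (m + 1))⟫ = a'
    generalize F' ⟪tilted (m + 1) t, act k (pole (m + 1))⟫ = b'
    have young : ∀ p q : ℝ, |p * q| ≤ η / 2 * p ^ 2 + η⁻¹ / 2 * q ^ 2 := by
      intro p q
      have h1 : η * η⁻¹ = 1 := mul_inv_cancel₀ hη.ne'
      have hpos := inv_pos.2 hη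
      have h2 : 0 ≤ η⁻¹ / 2 * (η * p - q) ^ 2 := by positivity
      have h3 : 0 ≤ η⁻¹ / 2 * (η * p + q) ^ 2 := by positivity
      have h4 : η⁻¹ / 2 * (η * p - q) ^ 2 = η / 2 * p ^ 2 - p * q + η⁻¹ / 2 * q ^ 2 := by
        field_simp
        ring
      have h5 : η⁻¹ / 2 * (η * p + q) ^ 2 = η / 2 * p ^ 2 + p * q + η⁻¹ / 2 * q ^ 2 := by
        field_simp
        ring
      rw [abs_le]
      constructor <;> linarith
    have y1 := young b (a - a')
    have y2 := young a (b - b')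
    have y3 : |(a - a') * (b - b')| ≤ 1 / 2 * (a - a') ^ 2 + 1 / 2 * (b - b') ^ 2 := by
      rw [abs_le]
      constructor <;> nlinarith [sq_nonneg (a - a' + (b - b')), sq_nonneg (a - a' - (b - b'))]
    have h6 : a * b - a' * b' = b * (a - a') + a * (b - b') - (a - a') * (b - b') := by ring
    rw [h6, Real.norm_eq_abs]
    have h7 := abs_sub (b * (a - a') + a * (b - b')) ((a - a') * (b - b'))
    have h8 := abs_add_le (b * (a - a')) (a * (b - b'))
    linarith
  refine (hle.trans_eq hbe).trans_lt ?_
  have h1 : B * (η * S) ≤ ε / 4 := by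
    have : B * (η * S) = ε / 4 * (S / (S + 1)) := by
      simp only [η]
      field_simp
    rw [this]
    exact mul_le_of_le_one_right (by positivity) (by rw [div_le_one (by positivity)]; linarith)
  have h2 : B * ((η⁻¹ + 1) * d) ≤ ε / 4 := by
    have h3 : B * ((η⁻¹ + 1) * δ) = ε / 4 := by
      have : η⁻¹ + 1 ≠ 0 := by positivity
      simp only [δ]
      field_simp
    rw [← h3]
    have : 0 < η⁻¹ + 1 := by positivity
    gcongr
  rw [mul_add]
  linarith

end Average

end SphCode

namespace SphCode

variable {n m : ℕ} {F g : ℝ → ℝ} {θ θ' : ℝ}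

/-! ### The bound for general weights -/

theorem h_mem_D {s s' : ℝ} (hm : 2 ≤ m) (hF : Admissible (m + 1) F) (hg : g ∈ D (zonal m) s')
    (hneg : ∀ t ∈ Icc (-1 : ℝ) s, h (m + 1) F g t ≤ 0) :
    h (m + 1) F g ∈ D (zonal (m + 1)) s := by
  have hn : 2 ≤ m + 1 := by omega
  have hc := continuousOn_h hm hF.memLp hg
  have hpd := zonalPosDef_h hm hF.memLp hg
  obtain ⟨p, hp⟩ := exists_isOrthonormalBasis hn
  refine ⟨p, hp, fun i => ∫ u, h (m + 1) F g u * (p i).eval u ∂zonal (m + 1),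
    hpd.coeff_nonneg hn hc hp, ?_, fun t ht => hpd.hasSum hn hc hp ht, hneg⟩
  simp only [ortho_zero hn hp, mul_one]
  rw [integral_h hm hF.memLp hg hc]
  exact mul_pos (integral_pos_of_mem_D hm hg) (pow_pos hF.pos 2)

theorem L_h {s' : ℝ} (hm : 2 ≤ m) (hF : Admissible (m + 1) F) (hg : g ∈ D (zonal m) s') :
    L (zonal (m + 1)) (h (m + 1) F g) = L (zonal m) g *
      ((∫ u, F u ^ 2 ∂zonal (m + 1)) / (∫ u, F u ∂zonal (m + 1)) ^ 2) := by
  rw [L, L, integral_h hm hF.memLp hg (continuousOn_h hm hF.memLp hg), h_eval_one hm hF.memLp,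
    mul_div_mul_comm]

/-! ### Geometry of the strip -/

lemma r_nonneg (θ θ' : ℝ) : 0 ≤ r θ θ' := Real.sqrt_nonneg _

lemma R_le_one (θ θ' : ℝ) : R θ θ' ≤ 1 := cos_le_one _

section Strip

lemma cos_bounds (hθ : 0 < θ) (hθθ' : θ < θ') (hθ' : θ' < π / 2) :
    0 < cos θ' ∧ cos θ' < cos θ ∧ cos θ < 1 := by
  have hpi := pi_pos
  refine ⟨cos_pos_of_mem_Ioo ⟨by linarith, hθ'⟩,
    cos_lt_cos_of_nonneg_of_le_pi hθ.le (by linarith) hθθ', ?_⟩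
  have := cos_lt_cos_of_nonneg_of_le_pi le_rfl (by linarith : θ ≤ π) hθ
  rwa [cos_zero] at this

lemma r_sq (hθ : 0 < θ) (hθθ' : θ < θ') (hθ' : θ' < π / 2) :
    r θ θ' ^ 2 = (cos θ - cos θ') / (1 - cos θ') := by
  obtain ⟨h1, h2, h3⟩ := cos_bounds hθ hθθ' hθ'
  exact Real.sq_sqrt (div_nonneg (by linarith) (by linarith))

lemma r_pos (hθ : 0 < θ) (hθθ' : θ < θ') (hθ' : θ' < π / 2) : 0 < r θ θ' := by
  obtain ⟨h1, h2, h3⟩ := cos_bounds hθ hθθ' hθ'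
  exact Real.sqrt_pos.2 (div_pos (by linarith) (by linarith))

lemma r_lt_one (hθ : 0 < θ) (hθθ' : θ < θ') (hθ' : θ' < π / 2) : r θ θ' < 1 := by
  obtain ⟨h1, h2, h3⟩ := cos_bounds hθ hθθ' hθ'
  have := r_sq hθ hθθ' hθ'
  have h4 : (cos θ - cos θ') / (1 - cos θ') < 1 := by
    rw [div_lt_one (by linarith)]
    linarith
  nlinarith [r_nonneg θ θ']

lemma r_sq_add (hθ : 0 < θ) (hθθ' : θ < θ') (hθ' : θ' < π / 2) :
    r θ θ' ^ 2 + cos θ' * (1 - r θ θ' ^ 2) = cos θ := by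
  obtain ⟨h1, h2, h3⟩ := cos_bounds hθ hθθ' hθ'
  have h4 : (1 - cos θ') ≠ 0 := by linarith
  rw [r_sq hθ hθθ' hθ']
  field_simp
  ring

lemma sqrt_mul_r (hθ : 0 < θ) (hθθ' : θ < θ') (hθ' : θ' < π / 2) :
    √((1 - cos θ) * (cos θ - cos θ')) =
      (1 - cos θ') * (r θ θ' * √(1 - r θ θ' ^ 2)) := by
  obtain ⟨h1, h2, h3⟩ := cos_bounds hθ hθθ' hθ'
  have h5 : 0 ≤ 1 - r θ θ' ^ 2 := by
    have := r_lt_one hθ hθθ' hθ'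
    nlinarith [r_nonneg θ θ']
  rw [Real.sqrt_eq_iff_mul_self_eq (by apply mul_nonneg <;> linarith)
    (mul_nonneg (by linarith) (mul_nonneg (r_nonneg _ _) (Real.sqrt_nonneg _)))]
  have h6 : (1 - cos θ') * (r θ θ' * √(1 - r θ θ' ^ 2)) *
      ((1 - cos θ') * (r θ θ' * √(1 - r θ θ' ^ 2))) =
      (1 - cos θ') ^ 2 * (r θ θ' ^ 2 * √(1 - r θ θ' ^ 2) ^ 2) := by ring
  rw [h6, Real.sq_sqrt h5, r_sq hθ hθθ' hθ']
  have h7 : (1 - cos θ') ≠ 0 := by linarith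
  field_simp
  ring

/-- With `a = arccos r` and `tan δ = √((1 - s)(s - s')) / s`, the angle `γ` is `a - 2 δ`. -/
lemma γ_eq (hθ : 0 < θ) (hθθ' : θ < θ') (hθ' : θ' < π / 2) :
    γ θ θ' = arccos (r θ θ') -
      2 * arctan (√((1 - cos θ) * (cos θ - cos θ')) / cos θ) := by
  obtain ⟨h1, h2, h3⟩ := cos_bounds hθ hθθ' hθ'
  have h4 : 0 < √((1 - cos θ) * (cos θ - cos θ')) :=
    Real.sqrt_pos.2 (mul_pos (by linarith) (by linarith))
  have h5 := arctan_inv_of_pos (div_pos h4 (h1.trans h2))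
  rw [inv_div] at h5
  rw [γ, h5]
  ring

lemma r_lt_R (hθ : 0 < θ) (hθθ' : θ < θ') (hθ' : θ' < π / 2) : r θ θ' < R θ θ' := by
  obtain ⟨h1, h2, h3⟩ := cos_bounds hθ hθθ' hθ'
  have hr0 := r_pos hθ hθθ' hθ'
  have hr1 := r_lt_one hθ hθθ' hθ'
  have h4 : 0 < √((1 - cos θ) * (cos θ - cos θ')) :=
    Real.sqrt_pos.2 (mul_pos (by linarith) (by linarith))
  have hσ : 0 < √(1 - r θ θ' ^ 2) := Real.sqrt_pos.2 (by nlinarith)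
  have hδ : 0 < arctan (√((1 - cos θ) * (cos θ - cos θ')) / cos θ) :=
    arctan_pos.2 (div_pos h4 (h1.trans h2))
  -- `0 < δ < a` gives `|a - 2 δ| < a`
  have hδa : arctan (√((1 - cos θ) * (cos θ - cos θ')) / cos θ) < arccos (r θ θ') := by
    rw [arccos_eq_arctan hr0]
    refine arctan_strictMono ?_
    rw [div_lt_div_iff₀ (h1.trans h2) hr0, sqrt_mul_r hθ hθθ' hθ']
    have h5 : (1 - cos θ') * r θ θ' ^ 2 = cos θ - cos θ' := by
      rw [r_sq hθ hθθ' hθ', mul_div_cancel₀ _ (by linarith)]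
    have h6 : (1 - cos θ') * (r θ θ' * √(1 - r θ θ' ^ 2)) * r θ θ' =
        √(1 - r θ θ' ^ 2) * (cos θ - cos θ') := by rw [← h5]; ring
    rw [h6]
    exact mul_lt_mul_of_pos_left (by linarith) hσ
  have hγ := γ_eq hθ hθθ' hθ'
  have habs : |γ θ θ'| < arccos (r θ θ') := by
    rw [hγ, abs_lt]
    constructor <;> linarith
  rw [R, ← cos_abs]
  conv_lhs => rw [← cos_arccos (by linarith : -1 ≤ r θ θ') hr1.le]
  exact cos_lt_cos_of_nonneg_of_le_pi (abs_nonneg _) (arccos_le_pi _) habs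

/-- The corner `(r, R)` of the strip. By the choice of `γ` equality holds with `sin γ` in place of
`√(1 - R²) = |sin γ|`. -/
lemma corner_inequality (hθ : 0 < θ) (hθθ' : θ < θ') (hθ' : θ' < π / 2) :
    cos θ ≤ r θ θ' * R θ θ' + cos θ' * (√(1 - r θ θ' ^ 2) * √(1 - R θ θ' ^ 2)) := by
  obtain ⟨h1, h2, h3⟩ := cos_bounds hθ hθθ' hθ'
  have hr0 := r_pos hθ hθθ' hθ'
  have hr1 := r_lt_one hθ hθθ' hθ'
  have hs0 : cos θ ≠ 0 := (h1.trans h2).ne'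
  have hR : √(1 - R θ θ' ^ 2) = |sin (γ θ θ')| := by
    rw [R, ← sin_sq, Real.sqrt_sq_eq_abs]
  have hσ := Real.sqrt_nonneg (1 - r θ θ' ^ 2)
  have hle : r θ θ' * cos (γ θ θ') + cos θ' * (√(1 - r θ θ' ^ 2) * sin (γ θ θ')) ≤
      r θ θ' * R θ θ' + cos θ' * (√(1 - r θ θ' ^ 2) * √(1 - R θ θ' ^ 2)) := by
    rw [hR, R]
    have := le_abs_self (sin (γ θ θ'))
    gcongr
  refine le_trans (le_of_eq ?_) hle
  have hσ2 : √(1 - r θ θ' ^ 2) ^ 2 = 1 - r θ θ' ^ 2 := Real.sq_sqrt (by nlinarith)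
  have hq := sqrt_mul_r hθ hθθ' hθ'
  have hadd := r_sq_add hθ hθθ' hθ'
  rw [γ_eq hθ hθθ' hθ', cos_sub, sin_sub, cos_arccos (by linarith) hr1.le, sin_arccos]
  set q := √((1 - cos θ) * (cos θ - cos θ'))
  set δ := arctan (q / cos θ)
  set σ := √(1 - r θ θ' ^ 2)
  have hc2 : cos δ ^ 2 * (1 + (q / cos θ) ^ 2) = 1 := by
    rw [cos_sq_arctan]
    exact one_div_mul_cancel (by positivity)
  have hsin : sin δ = q / cos θ * cos δ := by
    rw [← tan_arctan (q / cos θ), tan_mul_cos (cos_arctan_pos _).ne']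
  have e1 : r θ θ' * (r θ θ' * cos (2 * δ) + σ * sin (2 * δ)) +
      cos θ' * (σ * (σ * cos (2 * δ) - r θ θ' * sin (2 * δ))) =
      (r θ θ' ^ 2 + cos θ' * σ ^ 2) * cos (2 * δ) +
        ((1 - cos θ') * (r θ θ' * σ)) * sin (2 * δ) := by ring
  rw [e1, hσ2, hadd, ← hq, cos_two_mul, sin_two_mul, hsin]
  have e2 : cos θ * (2 * cos δ ^ 2 - 1) + q * (2 * (q / cos θ * cos δ) * cos δ) =
      2 * cos θ * (cos δ ^ 2 * (1 + (q / cos θ) ^ 2)) - cos θ := by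
    field_simp
    ring
  rw [e2, hc2]
  ring

lemma concaveOn_sqrt_one_sub_sq : ConcaveOn ℝ (Icc (-1 : ℝ) 1) fun u => √(1 - u ^ 2) := by
  refine ⟨convex_Icc _ _, fun u hu v hv a b ha hb hab => ?_⟩
  simp only [smul_eq_mul]
  have hu' := one_sub_sq_nonneg hu
  have hv' := one_sub_sq_nonneg hv
  refine Real.le_sqrt_of_sq_le ?_
  have h1 : √(1 - u ^ 2) * √(1 - v ^ 2) ≤ 1 - u * v := by
    rw [← Real.sqrt_mul hu']
    refine Real.sqrt_le_iff.2 ⟨?_, by nlinarith [sq_nonneg (u - v)]⟩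
    nlinarith [sq_nonneg (u - v)]
  have h2 : (a * √(1 - u ^ 2) + b * √(1 - v ^ 2)) ^ 2 =
      a ^ 2 * √(1 - u ^ 2) ^ 2 + b ^ 2 * √(1 - v ^ 2) ^ 2 +
        2 * (a * b) * (√(1 - u ^ 2) * √(1 - v ^ 2)) := by ring
  rw [h2, Real.sq_sqrt hu', Real.sq_sqrt hv']
  have h3 := mul_le_mul_of_nonneg_left h1 (mul_nonneg ha hb)
  have h4 : (a + b) ^ 2 = 1 := by rw [hab, one_pow]
  nlinarith

/-- On the strip, `u v + s' √(1 - u²) √(1 - v²) ≥ s`: the left side is concave in each variable, so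
it suffices to look at the corners. -/
lemma strip_inequality (hθ : 0 < θ) (hθθ' : θ < θ') (hθ' : θ' < π / 2)
    {u v : ℝ} (hu : u ∈ Icc (r θ θ') (R θ θ'))
    (hv : v ∈ Icc (r θ θ') (R θ θ')) :
    cos θ ≤ u * v + cos θ' * (√(1 - u ^ 2) * √(1 - v ^ 2)) := by
  obtain ⟨h1, h2, h3⟩ := cos_bounds hθ hθθ' hθ'
  have hr0 := r_pos hθ hθθ' hθ'
  have hr1 := r_lt_one hθ hθθ' hθ'
  have hrR := r_lt_R hθ hθθ' hθ'
  have hR1 := R_le_one θ θ'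
  have hadd := r_sq_add hθ hθθ' hθ'
  have hcor := corner_inequality hθ hθθ' hθ'
  set r₀ := r θ θ'
  set R₀ := R θ θ'
  have hrI : r₀ ∈ Icc (-1 : ℝ) 1 := ⟨by linarith, hr1.le⟩
  have hRI : R₀ ∈ Icc (-1 : ℝ) 1 := ⟨by linarith, hR1⟩
  -- concavity in one variable
  have key : ∀ w : ℝ, cos θ ≤ r₀ * w + cos θ' * (√(1 - r₀ ^ 2) * √(1 - w ^ 2)) →
      cos θ ≤ R₀ * w + cos θ' * (√(1 - R₀ ^ 2) * √(1 - w ^ 2)) →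
      ∀ x ∈ Icc r₀ R₀, cos θ ≤ x * w + cos θ' * (√(1 - x ^ 2) * √(1 - w ^ 2)) := by
    intro w hw1 hw2 x hx
    rw [← segment_eq_Icc hrR.le] at hx
    obtain ⟨a, b, ha, hb, hab, rfl⟩ := hx
    have hcc := concaveOn_sqrt_one_sub_sq.2 hrI hRI ha hb hab
    simp only [smul_eq_mul] at hcc ⊢
    have h5 := mul_le_mul_of_nonneg_right hcc (mul_nonneg h1.le (Real.sqrt_nonneg (1 - w ^ 2)))
    have h6 := mul_le_mul_of_nonneg_left hw1 ha
    have h7 := mul_le_mul_of_nonneg_left hw2 hb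
    have h8 : cos θ = a * cos θ + b * cos θ := by rw [← add_mul, hab, one_mul]
    nlinarith
  have hrr : cos θ ≤ r₀ * r₀ + cos θ' * (√(1 - r₀ ^ 2) * √(1 - r₀ ^ 2)) := by
    rw [Real.mul_self_sqrt (one_sub_sq_nonneg hrI)]
    linarith
  have hRR : cos θ ≤ R₀ * R₀ + cos θ' * (√(1 - R₀ ^ 2) * √(1 - R₀ ^ 2)) := by
    rw [Real.mul_self_sqrt (one_sub_sq_nonneg hRI)]
    nlinarith [mul_nonneg (by nlinarith : 0 ≤ R₀ ^ 2 - r₀ ^ 2) (by linarith : 0 ≤ 1 - cos θ')]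
  have hRr : cos θ ≤ R₀ * r₀ + cos θ' * (√(1 - R₀ ^ 2) * √(1 - r₀ ^ 2)) := by
    rw [mul_comm R₀, mul_comm (√(1 - R₀ ^ 2))]
    exact hcor
  have hxr := key r₀ hrr hRr
  have hxR := key R₀ hcor hRR
  refine key v ?_ ?_ u hu
  · rw [mul_comm r₀, mul_comm (√(1 - r₀ ^ 2))]
    exact hxr v hv
  · rw [mul_comm R₀, mul_comm (√(1 - R₀ ^ 2))]
    exact hxR v hv

/-- A weight supported in the strip is feasible: if `⟨x, y⟩ ≤ s` and `x, y` lie in the strip around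
`z`, then `⟨x̃, ỹ⟩ ≤ s'`. -/
theorem h_nonpos_of_strip (hθ : 0 < θ) (hθθ' : θ < θ') (hθ' : θ' < π / 2)
    (hm : 2 ≤ m) (hF : Admissible (m + 1) F)
    (hg : g ∈ D (zonal m) (cos θ'))
    (hsupp : ∀ u ∈ Icc (-1 : ℝ) 1, u ∉ Icc (r θ θ') (R θ θ') → F u = 0)
    {t : ℝ} (ht : t ∈ Icc (-1 : ℝ) (cos θ)) : h (m + 1) F g t ≤ 0 := by
  have hn : 2 ≤ m + 1 := by omega
  have hp := norm_pole (n := m + 1) (by omega)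
  have ht1 : t ∈ Icc (-1 : ℝ) 1 := ⟨ht.1, ht.2.trans (cos_le_one θ)⟩
  have hx := norm_tilted hn ht1
  have hgneg : ∀ w ∈ Icc (-1 : ℝ) (cos θ'), g w ≤ 0 := by
    obtain ⟨p, hp, c, hc, hc0, hs, hneg⟩ := hg
    exact hneg
  refine integral_nonpos_of_ae ?_
  filter_upwards [ae_inner_act_mem_Ioo hn hp hp, ae_inner_act_mem_Ioo hn hx hp] with k hu hv
  have hz : ‖act k (pole (m + 1))‖ = 1 := (norm_act k _).trans hp
  have hw := inner_tilde_mem (act k (pole (m + 1))) (pole (m + 1)) (tilted (m + 1) t)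
  have hwe := inner_tilde_tilde hp hx hz
  rw [inner_pole_tilted (by omega)] at hwe
  change threePoint F g (pole (m + 1)) (tilted (m + 1) t) (act k (pole (m + 1))) ≤ 0
  rw [threePoint]
  set u := ⟪pole (m + 1), act k (pole (m + 1))⟫
  set v := ⟪tilted (m + 1) t, act k (pole (m + 1))⟫
  have hu' := Ioo_subset_Icc_self hu
  have hv' := Ioo_subset_Icc_self hv
  by_cases hus : u ∈ Icc (r θ θ') (R θ θ')
  swap
  · simp [hsupp u hu' hus]
  by_cases hvs : v ∈ Icc (r θ θ') (R θ θ')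
  swap
  · simp [hsupp v hv' hvs]
  refine mul_nonpos_of_nonneg_of_nonpos (mul_nonneg (hF.nonneg u hu') (hF.nonneg v hv'))
    (hgneg _ ⟨hw.1, ?_⟩)
  have hst := strip_inequality hθ hθθ' hθ' hus hvs
  have hpos : 0 < √(1 - u ^ 2) * √(1 - v ^ 2) :=
    mul_pos (Real.sqrt_pos.2 (one_sub_sq_pos hu)) (Real.sqrt_pos.2 (one_sub_sq_pos hv))
  rw [hwe, div_le_iff₀ hpos]
  linarith [ht.2]

end Strip

end SphCode

namespace SphCode

variable {n m : ℕ} {F g : ℝ → ℝ} {θ θ' : ℝ}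

/-! ### The indicator weight and its optimality -/

lemma χ_eq_indicator (θ θ' : ℝ) : χ θ θ' = (Ioc (r θ θ') (R θ θ')).indicator 1 := by
  funext y
  simp only [χ, indicator, mem_Ioc, Pi.one_apply]

lemma χ_sq (θ θ' y : ℝ) : χ θ θ' y ^ 2 = χ θ θ' y := by
  rw [χ_eq_indicator]
  by_cases hy : y ∈ Ioc (r θ θ') (R θ θ') <;> simp [hy]

lemma integral_χ (n : ℕ) (θ θ' : ℝ) :
    ∫ u, χ θ θ' u ∂zonal n = (zonal n).real (Ioc (r θ θ') (R θ θ')) := by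
  rw [χ_eq_indicator, integral_indicator_one measurableSet_Ioc]

lemma zonal_real_Ioc (hn : 2 ≤ n) {a b : ℝ} (ha : -1 ≤ a) (hab : a ≤ b) (hb : b ≤ 1) :
    (zonal n).real (Ioc a b) = (∫ t in a..b, (1 - t ^ 2) ^ (((n : ℝ) - 3) / 2)) /
      ∫ u in (-1 : ℝ)..1, (1 - u ^ 2) ^ (((n : ℝ) - 3) / 2) := by
  rw [← integral_indicator_one measurableSet_Ioc, integral_gegenbauer (neg_half_le hn)]
  congr 1
  have h1 : ∀ t : ℝ, (Ioc a b).indicator (1 : ℝ → ℝ) t * (1 - t ^ 2) ^ (((n : ℝ) - 3) / 2) =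
      (Ioc a b).indicator (fun t => (1 - t ^ 2) ^ (((n : ℝ) - 3) / 2)) t := by
    intro t
    by_cases ht : t ∈ Ioc a b <;> simp [ht]
  simp_rw [h1]
  rw [intervalIntegral.integral_of_le (by norm_num), setIntegral_indicator measurableSet_Ioc,
    intervalIntegral.integral_of_le hab, inter_eq_right.2 (Ioc_subset_Ioc ha hb)]

lemma zonal_real_Ioc_pos (hn : 2 ≤ n) {a b : ℝ} (ha : -1 ≤ a) (hab : a < b) (hb : b ≤ 1) :
    0 < (zonal n).real (Ioc a b) := by
  have := isProbabilityMeasure_zonal hn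
  refine ENNReal.toReal_pos (fun h0 => ?_) (measure_ne_top _ _)
  have h1 := absolutelyContinuous_gegenbauer (neg_half_le hn) h0
  rw [Measure.restrict_apply measurableSet_Ioc,
    inter_eq_left.2 (Ioc_subset_Icc_self.trans (Icc_subset_Icc ha hb)), Real.volume_Ioc,
    ENNReal.ofReal_eq_zero] at h1
  linarith

lemma admissible_χ (hn : 2 ≤ n) (hrR : r θ θ' < R θ θ') : Admissible n (χ θ θ') := by
  have := isProbabilityMeasure_zonal hn
  refine ⟨fun u _ => ?_, ?_, ?_⟩
  · rw [← χ_sq]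
    positivity
  · rw [χ_eq_indicator]
    exact (memLp_const (1 : ℝ)).indicator measurableSet_Ioc
  · rw [integral_χ]
    exact zonal_real_Ioc_pos hn (by linarith [r_nonneg θ θ']) hrR (R_le_one _ _)

/-- For the indicator weight, `L(h) = L(g) / μ((r, R])`. -/
lemma L_h_χ {s' : ℝ} (hm : 2 ≤ m) (hrR : r θ θ' < R θ θ') (hg : g ∈ D (zonal m) s') :
    L (zonal (m + 1)) (h (m + 1) (χ θ θ') g) =
      L (zonal m) g / (zonal (m + 1)).real (Ioc (r θ θ') (R θ θ')) := by
  rw [L_h hm (admissible_χ (by omega) hrR) hg]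
  simp only [χ_sq, integral_χ]
  rw [sq, div_self_mul_self', ← div_eq_mul_inv]

/-- Optimality of the indicator weight is the Cauchy–Schwarz inequality
`(∫ F)² ≤ μ((r, R]) ∫ F²`. -/
lemma L_h_χ_le {s' : ℝ} (hm : 2 ≤ m) (hrR : r θ θ' < R θ θ') (hg : g ∈ D (zonal m) s')
    (hF : Admissible (m + 1) F)
    (hsupp : ∀ u ∈ Icc (-1 : ℝ) 1, u ∉ Icc (r θ θ') (R θ θ') → F u = 0) :
    L (zonal (m + 1)) (h (m + 1) (χ θ θ') g) ≤ L (zonal (m + 1)) (h (m + 1) F g) := by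
  have hn : 2 ≤ m + 1 := by omega
  have := isProbabilityMeasure_zonal hn
  have hM := zonal_real_Ioc_pos hn (by linarith [r_nonneg θ θ']) hrR (R_le_one θ θ')
  have hχ := integral_χ (m + 1) θ θ'
  have hχL := (admissible_χ hn hrR).memLp
  have hFL : MemLp F 2 (zonal (m + 1)) := hF.memLp
  rw [L_h_χ hm hrR hg, L_h hm hF hg, div_eq_mul_inv]
  set M := (zonal (m + 1)).real (Ioc (r θ θ') (R θ θ'))
  set I := ∫ u, F u ∂zonal (m + 1) with hI
  have hIpos : 0 < I := hF.pos
  refine mul_le_mul_of_nonneg_left ?_ (L_pos_of_mem_D hm hg).le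
  rw [inv_eq_one_div, div_le_div_iff₀ hM (by positivity), one_mul]
  have hFχ : ∫ u, F u * χ θ θ' u ∂zonal (m + 1) = I := by
    refine integral_congr_ae ?_
    filter_upwards [ae_gegenbauer_mem_Icc, Measure.ae_ne (zonal (m + 1)) (r θ θ')] with u hu hur
    by_cases hs : u ∈ Icc (r θ θ') (R θ θ')
    · have hmem : u ∈ Ioc (r θ θ') (R θ θ') := ⟨lt_of_le_of_ne hs.1 (Ne.symm hur), hs.2⟩
      rw [χ_eq_indicator, indicator_of_mem hmem, Pi.one_apply, mul_one]
    · rw [hsupp u hu hs, zero_mul]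
  -- Cauchy–Schwarz, as the nonnegativity of this square
  have h0 : 0 ≤ ∫ u, (M * F u - I * χ θ θ' u) ^ 2 ∂zonal (m + 1) :=
    integral_nonneg fun u => sq_nonneg _
  have e1 : ∀ u, (M * F u - I * χ θ θ' u) ^ 2 =
      M ^ 2 * F u ^ 2 - 2 * M * I * (F u * χ θ θ' u) + I ^ 2 * χ θ θ' u := by
    intro u
    have := χ_sq θ θ' u
    linear_combination I ^ 2 * this
  have i1 : Integrable (fun u => F u ^ 2) (zonal (m + 1)) := hFL.integrable_sq
  have i2 : Integrable (fun u => F u * χ θ θ' u) (zonal (m + 1)) := hFL.integrable_mul hχL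
  have i3 : Integrable (χ θ θ') (zonal (m + 1)) := hχL.integrable (by norm_num)
  have i12 : Integrable (fun u => M ^ 2 * F u ^ 2 - 2 * M * I * (F u * χ θ θ' u))
      (zonal (m + 1)) := (i1.const_mul _).sub (i2.const_mul _)
  simp_rw [e1] at h0
  rw [integral_add i12 (i3.const_mul _),
    integral_sub (i1.const_mul _) (i2.const_mul _), integral_const_mul, integral_const_mul,
    integral_const_mul, hFχ, hχ] at h0
  refine le_of_mul_le_mul_left ?_ hM
  nlinarith

/-! ### Comparison with the cap -/

lemma sin_half_div_sq (hθ : 0 < θ) (hθθ' : θ < θ') (hθ' : θ' < π / 2) :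
    (sin (θ / 2) / sin (θ' / 2)) ^ 2 = 1 - r θ θ' ^ 2 := by
  obtain ⟨h1, h2, h3⟩ := cos_bounds hθ hθθ' hθ'
  have hs : ∀ x : ℝ, sin (x / 2) ^ 2 = (1 - cos x) / 2 := fun x => by
    have := cos_sq' (x / 2)
    have h4 := cos_two_mul (x / 2)
    rw [mul_div_cancel₀ x two_ne_zero] at h4
    linarith
  have h5 : 1 - cos θ' ≠ 0 := by linarith
  rw [div_pow, hs, hs, r_sq hθ hθθ' hθ']
  field_simp
  ring

/-- The cap of the statement has height `r`, so that its mass is `μ((r, 1])`. -/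
lemma capMass_eq (hn : 2 ≤ n) (hθ : 0 < θ) (hθθ' : θ < θ') (hθ' : θ' < π / 2) :
    capMass n θ θ' = (zonal n).real (Ioc (r θ θ') 1) := by
  have hp := norm_pole (n := n) (by omega)
  have hm : Measurable fun x : Metric.sphere (0 : E n) 1 => ⟪(x : E n), pole n⟫ := by fun_prop
  have h1 : {x : Metric.sphere (0 : E n) 1 |
      √(1 - (sin (θ / 2) / sin (θ' / 2)) ^ 2) ≤ ⟪(x : E n), pole n⟫} =
      (fun x : Metric.sphere (0 : E n) 1 => ⟪(x : E n), pole n⟫) ⁻¹' Ici (r θ θ') := by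
    rw [sin_half_div_sq hθ hθθ' hθ', sub_sub_cancel, Real.sqrt_sq (r_nonneg _ _)]
    rfl
  rw [capMass, h1, ← map_measureReal_apply hm measurableSet_Ici, map_inner_sphereMeasure hn hp]
  refine measureReal_congr ?_
  filter_upwards [ae_gegenbauer_mem_Icc, Measure.ae_ne (zonal n) (r θ θ')] with t ht htr
  refine propext ⟨fun h => ⟨lt_of_le_of_ne h (Ne.symm htr), ht.2⟩, fun h => h.1.le⟩

/-- The part of the cap above the strip is exponentially small compared with the strip. With
`a = (n - 3) / 2` the exponent `a + 3 / 2` is `n / 2`, and `w ^ (n / 2) = e ^ (-n c)` for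
`w = (1 - σ²) / (1 - ρ²)`; the factor `w ^ (-3 / 2)` compensates the shift. -/
lemma tail_le {a ρ σ : ℝ} (ha : 0 ≤ a) (hρ : 0 ≤ ρ) (hρσ : ρ < σ) (hσ : σ < 1) :
    ∫ t in σ..1, (1 - t ^ 2) ^ a ≤
      (((1 - σ ^ 2) / (1 - ρ ^ 2)) ^ (-(3 / 2) : ℝ) /
        ((1 - ρ ^ 2) * (1 - (1 - σ ^ 2) / (1 - ρ ^ 2)))) *
      ((2 * a + 3) * ((1 - σ ^ 2) / (1 - ρ ^ 2)) ^ (a + 3 / 2)) *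
        ∫ t in ρ..σ, (1 - t ^ 2) ^ a := by
  have hx : 0 < 1 - σ ^ 2 := by nlinarith
  have hy : 0 < 1 - ρ ^ 2 := by nlinarith
  have hxy : 1 - σ ^ 2 < 1 - ρ ^ 2 := by nlinarith
  have hcont : Continuous fun t : ℝ => (1 - t ^ 2) ^ a :=
    Continuous.rpow_const (by fun_prop) fun t => Or.inr ha
  have hup : ∫ t in σ..1, (1 - t ^ 2) ^ a ≤ (1 - σ ^ 2) ^ a := by
    have h1 : ∫ t in σ..1, (1 - t ^ 2) ^ a ≤ ∫ _ in σ..1, (1 - σ ^ 2) ^ a := by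
      refine intervalIntegral.integral_mono_on hσ.le (hcont.intervalIntegrable _ _)
        (by simp) fun t ht => ?_
      refine Real.rpow_le_rpow ?_ ?_ ha <;> nlinarith [ht.1, ht.2]
    rw [intervalIntegral.integral_const, smul_eq_mul] at h1
    refine h1.trans (mul_le_of_le_one_left (Real.rpow_nonneg hx.le _) (by linarith))
  -- insert a factor `t ≤ 1`, which makes the weight an exact derivative
  have hlow : (1 - ρ ^ 2) ^ (a + 1) - (1 - σ ^ 2) ^ (a + 1) ≤
      (2 * a + 2) * ∫ t in ρ..σ, (1 - t ^ 2) ^ a := by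
    have h1 : ∫ t in ρ..σ, (2 * a + 2) * (t * (1 - t ^ 2) ^ a) =
        -(1 - σ ^ 2) ^ (a + 1) - -(1 - ρ ^ 2) ^ (a + 1) := by
      refine intervalIntegral.integral_eq_sub_of_hasDerivAt
        (f := fun t : ℝ => -(1 - t ^ 2) ^ (a + 1)) (fun t ht => ?_)
        (Continuous.intervalIntegrable (by fun_prop) _ _)
      have h2 : HasDerivAt (fun t : ℝ => 1 - t ^ 2) (-(2 * t)) t := by
        simpa using (hasDerivAt_pow 2 t).const_sub 1
      refine (h2.rpow_const (p := a + 1) (Or.inr (by linarith))).neg.congr_deriv ?_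
      rw [add_sub_cancel_right]
      ring
    have h3 : ∫ t in ρ..σ, (2 * a + 2) * (t * (1 - t ^ 2) ^ a) ≤
        ∫ t in ρ..σ, (2 * a + 2) * (1 - t ^ 2) ^ a := by
      refine intervalIntegral.integral_mono_on hρσ.le
        (Continuous.intervalIntegrable (by fun_prop) _ _)
        (Continuous.intervalIntegrable (by fun_prop) _ _) fun t ht => ?_
      refine mul_le_mul_of_nonneg_left (mul_le_of_le_one_left (weight_nonneg ⟨?_, ?_⟩) ?_) ?_ <;>
        linarith [ht.1, ht.2]
    rw [h1, intervalIntegral.integral_const_mul] at h3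
    linarith
  set x := 1 - σ ^ 2
  set y := 1 - ρ ^ 2
  set A := ∫ t in ρ..σ, (1 - t ^ 2) ^ a
  set w := x / y with hw
  have hw0 : 0 < w := div_pos hx hy
  have hw1 : w < 1 := (div_lt_one hy).2 hxy
  have hxw : x = w * y := by rw [hw, div_mul_cancel₀ _ hy.ne']
  have hA : 0 ≤ A := intervalIntegral.integral_nonneg hρσ.le fun t ht =>
    weight_nonneg ⟨by linarith [ht.1], by linarith [ht.2]⟩
  have hwa : w ^ (a + 1) ≤ w := by
    have := Real.rpow_le_rpow_of_exponent_ge hw0 hw1.le (by linarith : (1 : ℝ) ≤ a + 1)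
    rwa [Real.rpow_one] at this
  have hya := Real.rpow_pos_of_pos hy a
  have h4 : y ^ a * y * (1 - w) ≤ (2 * a + 3) * A := by
    rw [hxw, Real.mul_rpow hw0.le hy.le, Real.rpow_add_one hy.ne'] at hlow
    have h5 : y ^ a * y * (1 - w) ≤ y ^ a * y - w ^ (a + 1) * (y ^ a * y) := by
      have := mul_le_mul_of_nonneg_right hwa (mul_pos hya hy).le
      linarith
    linarith
  have hpos : 0 < y * (1 - w) := mul_pos hy (by linarith)
  refine hup.trans ?_
  have h6 : w ^ (-(3 / 2) : ℝ) / (y * (1 - w)) * ((2 * a + 3) * w ^ (a + 3 / 2)) * A =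
      w ^ a * ((2 * a + 3) * A) / (y * (1 - w)) := by
    have h7 : w ^ a = w ^ (-(3 / 2) : ℝ) * w ^ (a + 3 / 2) := by
      rw [← Real.rpow_add hw0]
      congr 1
      ring
    rw [h7]
    ring
  rw [h6, le_div_iff₀ hpos, hxw, Real.mul_rpow hw0.le hy.le]
  have := mul_le_mul_of_nonneg_left h4 (Real.rpow_nonneg hw0.le a)
  linarith

/-- The exponent `c` in terms of `w = (1 - R²) / (1 - r²)`. -/
lemma exp_neg_mul_c {ρ σ : ℝ} (hρ : 0 < 1 - ρ ^ 2) (hσ : 0 < 1 - σ ^ 2) (x : ℝ) :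
    exp (-(x * (1 / 2 * log ((1 - ρ ^ 2) / (1 - σ ^ 2))))) =
      ((1 - σ ^ 2) / (1 - ρ ^ 2)) ^ (x / 2) := by
  rw [Real.rpow_def_of_pos (div_pos hσ hρ), ← inv_div (1 - σ ^ 2), Real.log_inv]
  congr 1
  ring

lemma c_pos (hrR : r θ θ' < R θ θ') (hR : R θ θ' < 1) : 0 < c θ θ' := by
  have hr := r_nonneg θ θ'
  refine mul_pos (by norm_num) (Real.log_pos ?_)
  rw [one_lt_div (by nlinarith)]
  nlinarith

theorem L_h_χ_le_cap (hθ : 0 < θ) (hθθ' : θ < θ') (hθ' : θ' < π / 2) (hR : R θ θ' < 1)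
    {s' : ℝ} (hm : 2 ≤ m) (hg : g ∈ D (zonal m) s') :
    L (zonal (m + 1)) (h (m + 1) (χ θ θ') g) ≤ L (zonal m) g / capMass (m + 1) θ θ' *
      (1 + ((1 - R θ θ' ^ 2) / (1 - r θ θ' ^ 2)) ^ (-(3 / 2) : ℝ) /
        ((1 - r θ θ' ^ 2) * (1 - (1 - R θ θ' ^ 2) / (1 - r θ θ' ^ 2))) *
        (((m + 1 : ℕ) : ℝ) * exp (-(((m + 1 : ℕ) : ℝ) * c θ θ')))) := by
  have hn : 2 ≤ m + 1 := by omega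
  have hrR := r_lt_R hθ hθθ' hθ'
  have hr := r_nonneg θ θ'
  have hx : 0 < 1 - R θ θ' ^ 2 := by nlinarith
  have hy : 0 < 1 - r θ θ' ^ 2 := by nlinarith
  have hm' : (2 : ℝ) ≤ m := by exact_mod_cast hm
  have ht := tail_le (a := (((m + 1 : ℕ) : ℝ) - 3) / 2) (by push_cast; linarith) hr hrR hR
  rw [L_h_χ hm hrR hg, capMass_eq hn hθ hθθ' hθ', c, exp_neg_mul_c hy hx]
  have hM := zonal_real_Ioc_pos hn (by linarith) hrR hR.le
  rw [zonal_real_Ioc hn (by linarith) hrR.le hR.le] at hM ⊢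
  have hcap := zonal_real_Ioc_pos hn (by linarith) (hrR.trans hR) le_rfl
  rw [zonal_real_Ioc hn (by linarith) (hrR.trans hR).le le_rfl] at hcap ⊢
  have hZ := integral_weight_pos (neg_half_le hn)
  have hint : ∀ a b : ℝ, IntervalIntegrable
      (fun t : ℝ => (1 - t ^ 2) ^ ((((m + 1 : ℕ) : ℝ) - 3) / 2)) volume a b := fun a b =>
    (Continuous.rpow_const (by fun_prop)
      fun t => Or.inr (by push_cast; linarith)).intervalIntegrable _ _
  rw [← intervalIntegral.integral_add_adjacent_intervals (hint (r θ θ') (R θ θ'))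
    (hint (R θ θ') 1)] at hcap ⊢
  rw [show 2 * ((((m + 1 : ℕ) : ℝ) - 3) / 2) + 3 = ((m + 1 : ℕ) : ℝ) by ring,
    show (((m + 1 : ℕ) : ℝ) - 3) / 2 + 3 / 2 = ((m + 1 : ℕ) : ℝ) / 2 by ring] at ht
  set A := ∫ t in r θ θ'..R θ θ', (1 - t ^ 2) ^ ((((m + 1 : ℕ) : ℝ) - 3) / 2)
  set T := ∫ t in R θ θ'..1, (1 - t ^ 2) ^ ((((m + 1 : ℕ) : ℝ) - 3) / 2)
  set Z := ∫ t in (-1 : ℝ)..1, (1 - t ^ 2) ^ ((((m + 1 : ℕ) : ℝ) - 3) / 2)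
  have hA : 0 < A := (div_pos_iff_of_pos_right hZ).1 hM
  have hAT : 0 < A + T := (div_pos_iff_of_pos_right hZ).1 hcap
  have hL := L_pos_of_mem_D hm hg
  have h1 : L (zonal m) g / (A / Z) = L (zonal m) g / ((A + T) / Z) * (1 + T / A) := by
    field_simp
  rw [h1]
  refine mul_le_mul_of_nonneg_left ?_ (div_pos hL hcap).le
  rw [add_le_add_iff_left, div_le_iff₀ hA]
  exact ht

end SphCode

open SphCode in
theorem proposition4p4 (θ θ' : ℝ) (hθ : 0 < θ) (hθθ' : θ < θ') (hθ' : θ' < π) :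
    -- general weights
    (∀ n : ℕ, 3 ≤ n → ∀ g ∈ D (gegenbauerMeasure (((n : ℝ) - 4) / 2)) (cos θ'),
      ∀ F : ℝ → ℝ, Admissible n F →
        -- the average is a point-pair invariant, independent of the base point
        (∀ x y z : E n, ‖x‖ = 1 → ‖y‖ = 1 → ‖z‖ = 1 →
          pairAvg F g z x y = h n F g (inner ℝ x y)) ∧
        ((∀ t ∈ Icc (-1 : ℝ) (cos θ), h n F g t ≤ 0) →
          h n F g ∈ D (gegenbauerMeasure (((n : ℝ) - 3) / 2)) (cos θ) ∧
          (maxCode n θ : ℝ≥0∞) ≤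
            ENNReal.ofReal (L (gegenbauerMeasure (((n : ℝ) - 3) / 2)) (h n F g)) ∧
          L (gegenbauerMeasure (((n : ℝ) - 3) / 2)) (h n F g) =
            L (gegenbauerMeasure (((n : ℝ) - 4) / 2)) g *
              ((∫ u, F u ^ 2 ∂(gegenbauerMeasure (((n : ℝ) - 3) / 2))) /
                (∫ u, F u ∂(gegenbauerMeasure (((n : ℝ) - 3) / 2))) ^ 2))) ∧
    -- weights supported in the strip
    (θ' < π / 2 →
      r θ θ' < R θ θ' ∧
      (∀ n : ℕ, 3 ≤ n → Admissible n (χ θ θ') ∧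
        ∀ g ∈ D (gegenbauerMeasure (((n : ℝ) - 4) / 2)) (cos θ'),
          -- every weight supported in the strip is feasible, and `χ` is optimal among them
          (∀ F : ℝ → ℝ, Admissible n F →
            (∀ u ∈ Icc (-1 : ℝ) 1, u ∉ Icc (r θ θ') (R θ θ') → F u = 0) →
            h n F g ∈ D (gegenbauerMeasure (((n : ℝ) - 3) / 2)) (cos θ) ∧
            L (gegenbauerMeasure (((n : ℝ) - 3) / 2)) (h n (χ θ θ') g) ≤
              L (gegenbauerMeasure (((n : ℝ) - 3) / 2)) (h n F g)) ∧
          (maxCode n θ : ℝ≥0∞) ≤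
            ENNReal.ofReal (L (gegenbauerMeasure (((n : ℝ) - 3) / 2)) (h n (χ θ θ') g))) ∧
      -- the quantitative bound; the constant depends only on the angles
      (R θ θ' < 1 → 0 < c θ θ' ∧ ∃ C : ℝ, ∀ n : ℕ, 3 ≤ n →
        ∀ g ∈ D (gegenbauerMeasure (((n : ℝ) - 4) / 2)) (cos θ'),
          L (gegenbauerMeasure (((n : ℝ) - 3) / 2)) (h n (χ θ θ') g) ≤
            L (gegenbauerMeasure (((n : ℝ) - 4) / 2)) g / capMass n θ θ' *
              (1 + C * (n * exp (-(n * c θ θ'))))) ∧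
      -- the degenerate case `R = 1`, that is `c = ∞`, where the error term vanishes
      (R θ θ' = 1 → ∀ n : ℕ, 3 ≤ n →
        ∀ g ∈ D (gegenbauerMeasure (((n : ℝ) - 4) / 2)) (cos θ'),
          L (gegenbauerMeasure (((n : ℝ) - 3) / 2)) (h n (χ θ θ') g) ≤
            L (gegenbauerMeasure (((n : ℝ) - 4) / 2)) g / capMass n θ θ')) := by
  have hcast : ∀ m : ℕ, gegenbauerMeasure ((((m + 1 : ℕ) : ℝ) - 4) / 2) = zonal m := fun m => by
    congr 1
    push_cast
    ring
  refine ⟨fun n hn => ?_, fun hθ'2 => ?_⟩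
  · obtain ⟨m, rfl⟩ : ∃ m, n = m + 1 := ⟨n - 1, by omega⟩
    have hm : 2 ≤ m := by omega
    rw [hcast]
    intro g hg F hF
    refine ⟨fun x y z hx hy hz => pairAvg_eq_h (by omega) F g hx hy hz, fun hneg => ?_⟩
    have hD := h_mem_D hm hF hg hneg
    exact ⟨hD, maxCode_le_L (by omega) hθ hD, L_h hm hF hg⟩
  · have hrR := r_lt_R hθ hθθ' hθ'2
    refine ⟨hrR, fun n hn => ⟨admissible_χ (by omega) hrR, ?_⟩,
      fun hR => ⟨c_pos hrR hR,
        ((1 - R θ θ' ^ 2) / (1 - r θ θ' ^ 2)) ^ (-(3 / 2) : ℝ) /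
          ((1 - r θ θ' ^ 2) * (1 - (1 - R θ θ' ^ 2) / (1 - r θ θ' ^ 2))), fun n hn => ?_⟩,
      fun hR n hn => ?_⟩
    · obtain ⟨m, rfl⟩ : ∃ m, n = m + 1 := ⟨n - 1, by omega⟩
      have hm : 2 ≤ m := by omega
      rw [hcast]
      intro g hg
      have hD : ∀ F : ℝ → ℝ, Admissible (m + 1) F →
          (∀ u ∈ Icc (-1 : ℝ) 1, u ∉ Icc (r θ θ') (R θ θ') → F u = 0) →
          h (m + 1) F g ∈ D (zonal (m + 1)) (cos θ) := fun F hF hsupp =>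
        h_mem_D hm hF hg fun t ht => h_nonpos_of_strip hθ hθθ' hθ'2 hm hF hg hsupp ht
      refine ⟨fun F hF hsupp => ⟨hD F hF hsupp, L_h_χ_le hm hrR hg hF hsupp⟩,
        maxCode_le_L (by omega) hθ (hD _ (admissible_χ (by omega) hrR) fun u _ hu => ?_)⟩
      rw [χ_eq_indicator, indicator_of_notMem fun h => hu (Ioc_subset_Icc_self h)]
    · obtain ⟨m, rfl⟩ : ∃ m, n = m + 1 := ⟨n - 1, by omega⟩
      rw [hcast]
      exact fun g hg => L_h_χ_le_cap hθ hθθ' hθ'2 hR (by omega) hg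
    · obtain ⟨m, rfl⟩ : ∃ m, n = m + 1 := ⟨n - 1, by omega⟩
      rw [hcast]
      intro g hg
      rw [L_h_χ (by omega) hrR hg, capMass_eq (by omega) hθ hθθ' hθ'2, hR]
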